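/- Let $n\ge 2$, let $\mathbb B$ be the open unit ball of $\mathbb R^n$, $\nu$ Lebesgue measure on $\mathbb B$ with $\nu(\mathbb B)=1$, and $h(\mathbb B)$ the space of complex-valued harmonic functions on $\mathbb B$. Let $(a)_k=a(a+1)\cdots(a+k-1)$ and, for $\alpha\in\mathbb R$ and $k\ge 0$, \[ \gamma_k(\alpha)=\begin{cases}\dfrac{(1+n/2+\alpha)_k}{(n/2)_k}, & \alpha>-(1+n/2),\\[2mm] \dfrac{(k!)^2}{(1-(n/2+\alpha))_k\,(n/2)_k}, & \alpha\le -(1+n/2),\end{cases}\qquad R_\alpha(x,y)=\sum_{k\ge 0}\gamma_k(\alpha)Z_k(x,y)\quad(x,y\in\mathbb B), \] where $Z_k(x,y)$ is the zonal harmonic of degree $k$: $Z_k(\cdot,y)$ is the homogeneous harmonic polynomial of degree $k$ with $p(y)=\int p\,Z_k(\cdot,y)\,d\sigma$ for every homogeneous harmonic polynomial $p$ of degree $k$, with $\sigma$ the normalized surface measure of the unit sphere. For $f=\sum_k f_k\in h(\mathbb B)$ with $f_k$ homogeneous harmonic polynomials of degree $k$ and for $s,t\in\mathbb R$, put \[ D^t_sf=\sum_{k\ge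 0}\frac{\gamma_k(s+t)}{\gamma_k(s)}f_k,\qquad I^t_sf(x)=(1-|x|^2)^tD^t_sf(x). \] For $\alpha\in\mathbb R$, let $b^\infty_\alpha$ be the space of all $f\in h(\mathbb B)$ such that $\sup_{x\in\mathbb B}(1-|x|^2)^{\alpha}|I^t_sf(x)|<\infty$ for some $s,t\in\mathbb R$ with $\alpha+t>0$. For each such pair $s,t$ this supremum is a norm on $b^\infty_\alpha$, called the $(s,t)$-norm. Let $V_s=\int_{\mathbb B}(1-|x|^2)^s\,d\nu(x)$ if $s>-1$ and $V_s=1$ if $s\le -1$. Let $\mu$ be a positive Borel measure on $\mathbb B$, $d\kappa(y)=(1-|y|^2)^{s+t}d\mu(y)$, and \[ {_{s,t}}T_\mu f(x)=\frac1{V_s}\int_{\mathbb B}R_s(x,y)\,I^t_sf(y)\,(1-|y|^2)^s\,d\mu(y),\qquad {_{s+t}}T_\kappa g(x)=\frac1{V_s}\int_{\mathbb B}R_{s+t}(x,y)\,g(y)\,d\kappa(y); \] the second operator is a classical Toeplitz operator. **Theorem 4.1.** Let $\alpha_1,\alpha_2,s,t\in\mathbb R$ with $\alpha_i+t>0$ and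 $s>\alpha_i-1$ for $i=1,2$, and suppose that $\int_{\mathbb B}(1-|y|^2)^{s-\alpha_1}d\mu(y)<\infty$. Then $D^t_s$ maps $b^\infty_{\alpha_1}$ into $b^\infty_{\alpha_1+t}$ and $D^{-t}_{s+t}$ maps $b^\infty_{\alpha_1+t}$ into $b^\infty_{\alpha_1}$. The integrals and series that define ${_{s,t}}T_\mu f$ for $f\in b^\infty_{\alpha_1}$ and ${_{s+t}}T_\kappa g$ for $g\in b^\infty_{\alpha_1+t}$ converge absolutely, ${_{s,t}}T_\mu f,\ {_{s+t}}T_\kappa g\in h(\mathbb B)$, the series of the operators $D$ below converge absolutely, and \[ D^t_s\,({_{s,t}}T_\mu)=({_{s+t}}T_\kappa)\,D^t_s\ \text{ on } b^\infty_{\alpha_1}. \] Consequently, \[ {_{s,t}}T_\mu=D^{-t}_{s+t}\,({_{s+t}}T_\kappa)\,D^t_s\ \text{ on } b^\infty_{\alpha_1},\qquad {_{s+t}}T_\kappa=D^t_s\,({_{s,t}}T_\mu)\,D^{-t}_{s+t}\ \text{ on } b^\infty_{\alpha_1+t}. \] In particular, ${_{s,t}}T_\mu$ maps $b^\infty_{\alpha_1}$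 into $b^\infty_{\alpha_2}$ if and only if ${_{s+t}}T_\kappa$ maps $b^\infty_{\alpha_1+t}$ into $b^\infty_{\alpha_2+t}$, and the same equivalence holds with "maps" replaced by "is a bounded operator from" (respectively "is a compact operator from") the first space into the second. Here $b^\infty_{\alpha_i}$ carries the $(s,t)$-norm and $b^\infty_{\alpha_i+t}$ the $(s+t,0)$-norm, which is $\sup_{x\in\mathbb B}(1-|x|^2)^{\alpha_i+t}|g(x)|$. -/

import Mathlib

open MeasureTheory Filter Topology

noncomputable section

namespace HarmonicBloch

/-- Euclidean space `ℝⁿ`. -/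
abbrev E (n : ℕ) : Type := EuclideanSpace ℝ (Fin n)

/-- The open unit ball of `ℝⁿ`. -/
abbrev B (n : ℕ) : Set (E n) := Metric.ball 0 1

/-! ### Harmonic polynomials and zonal harmonics -/

/-- Normalized surface measure on the unit sphere. -/
def sphereMeasure (n : ℕ) : Measure (Metric.sphere (0 : E n) 1) :=
  ((volume : Measure (E n)).toSphere Set.univ)⁻¹ • (volume : Measure (E n)).toSphere

/-- Real homogeneous harmonic polynomials of degree `k` on `ℝⁿ`, as functions. -/
def harmonicPoly (n k : ℕ) : Submodule ℝ (E n → ℝ) where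
  carrier := {p | (∃ P : MvPolynomial (Fin n) ℝ, P.IsHomogeneous k ∧
      ∀ x : E n, p x = MvPolynomial.eval (fun i => x i) P) ∧
    InnerProductSpace.HarmonicOnNhd p Set.univ}
  add_mem' := by
    rintro p q ⟨⟨P, hP, hp⟩, hp'⟩ ⟨⟨Q, hQ, hq⟩, hq'⟩
    exact ⟨⟨P + Q, hP.add hQ, fun x => by simp [hp, hq]⟩, hp'.add hq'⟩
  zero_mem' := ⟨⟨0, MvPolynomial.isHomogeneous_zero _ _ _, fun x => by simp⟩,
    InnerProductSpace.harmonicOnNhd_const 0⟩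
  smul_mem' := by
    rintro c p ⟨⟨P, hP, hp⟩, hp'⟩
    refine ⟨⟨c • P, ?_, fun x => by simp [hp]⟩, hp'.const_smul⟩
    exact (MvPolynomial.homogeneousSubmodule (Fin n) ℝ k).smul_mem c hP

/-- `q` represents evaluation at `y` on the space of homogeneous harmonic polynomials of degree
`k` with the inner product of `L²` of the unit sphere. -/
def IsZonal {n : ℕ} (k : ℕ) (y : E n) (q : E n → ℝ) : Prop :=
  q ∈ harmonicPoly n k ∧
    ∀ p ∈ harmonicPoly n k, p y = ∫ ζ, p ζ.1 * q ζ.1 ∂(sphereMeasure n)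

/-- The zonal harmonic `Z_k(x, y)`: the reproducing kernel of the homogeneous harmonic polynomials
of degree `k`, homogeneous of degree `k` in each variable; `Z_k(·, y)` is the unique `q` with
`IsZonal k y q` (see `zonal_spec` and `isZonal_unique`). -/
def zonal {n : ℕ} (k : ℕ) (x y : E n) : ℝ := Classical.epsilon (IsZonal k y) x

instance (n : ℕ) : IsFiniteMeasure (sphereMeasure n) := by
  unfold sphereMeasure
  by_cases h : (volume : Measure (E n)).toSphere Set.univ = 0
  · rw [Measure.measure_univ_eq_zero.1 h]; simp; infer_instance
  · exact Measure.smul_finite _ (by simpa using h)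

theorem harmonicPoly_continuous {n k : ℕ} {p : E n → ℝ} (hp : p ∈ harmonicPoly n k) :
    Continuous p := continuousOn_univ.1 (hp.2.continuousOn)

theorem harmonicPoly_mul_integrable {n k : ℕ} {p q : E n → ℝ} (hp : p ∈ harmonicPoly n k)
    (hq : q ∈ harmonicPoly n k) :
    Integrable (fun ζ : Metric.sphere (0 : E n) 1 => p ζ.1 * q ζ.1) (sphereMeasure n) := by
  have hc : Continuous (fun ζ : Metric.sphere (0 : E n) 1 => p ζ.1 * q ζ.1) :=
    ((harmonicPoly_continuous hp).comp continuous_subtype_val).mul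
      ((harmonicPoly_continuous hq).comp continuous_subtype_val)
  exact hc.integrable_of_hasCompactSupport (HasCompactSupport.of_compactSpace _)

theorem harmonicPoly_smul {n k : ℕ} {p : E n → ℝ} (hp : p ∈ harmonicPoly n k) (c : ℝ) (x : E n) :
    p (c • x) = c ^ k * p x := by
  obtain ⟨⟨P, hP, hp⟩, -⟩ := hp
  rw [hp, hp]
  rw [MvPolynomial.eval_eq, MvPolynomial.eval_eq, Finset.mul_sum]
  refine Finset.sum_congr rfl fun d hd => ?_
  have hdk : ∑ i, d i = k := by
    have h := hP (MvPolynomial.mem_support_iff.1 hd)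
    simpa [Finsupp.weight_apply, Finsupp.sum_fintype] using h
  have hs : ∏ i ∈ d.support, c ^ d i = c ^ k := by
    rw [Finset.prod_pow_eq_pow_sum, ← hdk]
    congr 1
    exact Finset.sum_subset (Finset.subset_univ _) fun i _ hi => by simpa using hi
  simp only [PiLp.smul_apply, smul_eq_mul, mul_pow, Finset.prod_mul_distrib, hs]
  ring

theorem harmonicPoly_eq_zero {n k : ℕ} (hn : 0 < n) {p : E n → ℝ} (hp : p ∈ harmonicPoly n k)
    (h : ∫ ζ, p ζ.1 * p ζ.1 ∂(sphereMeasure n) = 0) : p = 0 := by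
  have : NeZero n := ⟨hn.ne'⟩
  have h1 := (integral_eq_zero_iff_of_nonneg (fun ζ => mul_self_nonneg _)
    (harmonicPoly_mul_integrable hp hp)).1 h
  have : (sphereMeasure n).IsOpenPosMeasure := by
    unfold sphereMeasure
    exact Measure.isOpenPosMeasure_smul _ (ENNReal.inv_ne_zero.2 (measure_ne_top _ _))
  have hc : Continuous (fun ζ : Metric.sphere (0 : E n) 1 => p ζ.1 * p ζ.1) :=
    ((harmonicPoly_continuous hp).comp continuous_subtype_val).mul
      ((harmonicPoly_continuous hp).comp continuous_subtype_val)
  have h2 := (hc.ae_eq_iff_eq (sphereMeasure n) continuous_zero).1 h1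
  have h3 : ∀ u : E n, ‖u‖ = 1 → p u = 0 := fun u hu => by
    have := congrFun h2 ⟨u, by simpa using hu⟩
    simpa using this
  funext x
  obtain ⟨u, hu, hx⟩ : ∃ u : E n, ‖u‖ = 1 ∧ x = ‖x‖ • u := by
    by_cases hx : x = 0
    · obtain ⟨u, hu⟩ := exists_norm_eq (E n) zero_le_one
      exact ⟨u, hu, by simp [hx]⟩
    · exact ⟨‖x‖⁻¹ • x, norm_smul_inv_norm hx, by
        rw [smul_smul, mul_inv_cancel₀ (norm_ne_zero_iff.2 hx), one_smul]⟩
  rw [hx, harmonicPoly_smul hp, h3 u hu, mul_zero, Pi.zero_apply]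

instance (n k : ℕ) : FiniteDimensional ℝ (harmonicPoly n k) := by
  let φ : MvPolynomial (Fin n) ℝ →ₗ[ℝ] (E n → ℝ) :=
    { toFun := fun P x => MvPolynomial.eval (fun i => x i) P
      map_add' := fun P Q => by ext; simp
      map_smul' := fun c P => by ext; simp }
  have h1 : FiniteDimensional ℝ (MvPolynomial.homogeneousSubmodule (Fin n) ℝ k) :=
    Module.Finite.iff_fg.2 (MvPolynomial.homogeneousSubmodule_fg (Fin n) ℝ k)
  have h2 : harmonicPoly n k ≤ (MvPolynomial.homogeneousSubmodule (Fin n) ℝ k).map φ := by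
    rintro p ⟨⟨P, hP, hp⟩, -⟩
    exact ⟨P, hP, funext fun x => (hp x).symm⟩
  exact Submodule.finiteDimensional_of_le h2

theorem exists_isZonal {n : ℕ} (hn : 0 < n) (k : ℕ) (y : E n) : ∃ q, IsZonal k y q := by
  let Φ : harmonicPoly n k →ₗ[ℝ] Module.Dual ℝ (harmonicPoly n k) :=
    LinearMap.mk₂ ℝ (fun q p => ∫ ζ, p.1 ζ.1 * q.1 ζ.1 ∂(sphereMeasure n))
      (fun q₁ q₂ p => by
        rw [← integral_add (harmonicPoly_mul_integrable p.2 q₁.2)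
          (harmonicPoly_mul_integrable p.2 q₂.2)]
        simp [mul_add])
      (fun c q p => by
        rw [smul_eq_mul, ← integral_const_mul]
        simp [mul_left_comm])
      (fun q p₁ p₂ => by
        rw [← integral_add (harmonicPoly_mul_integrable p₁.2 q.2)
          (harmonicPoly_mul_integrable p₂.2 q.2)]
        simp [add_mul])
      (fun c q p => by
        rw [smul_eq_mul, ← integral_const_mul]
        simp [mul_assoc])
  have hinj : Function.Injective Φ := by
    rw [← LinearMap.ker_eq_bot, LinearMap.ker_eq_bot']
    intro q hq
    exact Subtype.ext (harmonicPoly_eq_zero hn q.2 (LinearMap.congr_fun hq q))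
  have hsurj : Function.Surjective Φ :=
    (LinearMap.injective_iff_surjective_of_finrank_eq_finrank
      Subspace.dual_finrank_eq.symm).1 hinj
  obtain ⟨q, hq⟩ := hsurj
    ((LinearMap.proj y : (E n → ℝ) →ₗ[ℝ] ℝ).comp (harmonicPoly n k).subtype)
  exact ⟨q.1, q.2, fun p hp => (LinearMap.congr_fun hq ⟨p, hp⟩).symm⟩

theorem zonal_spec {n : ℕ} (hn : 0 < n) (k : ℕ) (y : E n) :
    IsZonal k y (fun x => zonal k x y) := Classical.epsilon_spec (exists_isZonal hn k y)

theorem isZonal_unique {n k : ℕ} (hn : 0 < n) {y : E n} {q r : E n → ℝ} (hq : IsZonal k y q)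
    (hr : IsZonal k y r) : q = r := by
  have hd := (harmonicPoly n k).sub_mem hq.1 hr.1
  refine sub_eq_zero.1 (harmonicPoly_eq_zero hn hd ?_)
  have h := (hq.2 _ hd).symm.trans (hr.2 _ hd)
  rw [← sub_eq_zero, ← integral_sub (harmonicPoly_mul_integrable hd hq.1)
    (harmonicPoly_mul_integrable hd hr.1)] at h
  rw [← h]
  congr 1
  funext ζ
  simp only [Pi.sub_apply]
  ring

/-! ### Kernels and radial differential operators -/

/-- The rising factorial `(a)_k = a (a + 1) ⋯ (a + k - 1)`. -/
def poch (a : ℝ) (k : ℕ) : ℝ := (ascPochhammer ℝ k).eval a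

/-- The coefficients `γ_k(α)` in dimension `n`. -/
def gammaCoeff (n : ℕ) (α : ℝ) (k : ℕ) : ℝ :=
  if -(1 + (n : ℝ) / 2) < α then
    poch (1 + (n : ℝ) / 2 + α) k / poch ((n : ℝ) / 2) k
  else
    (k.factorial : ℝ) ^ 2 / (poch (1 - ((n : ℝ) / 2 + α)) k * poch ((n : ℝ) / 2) k)

/-- The harmonic Bergman-Besov kernel `R_α(x, y) = ∑ γ_k(α) Z_k(x, y)`. -/
def kernel {n : ℕ} (α : ℝ) (x y : E n) : ℝ := ∑' k : ℕ, gammaCoeff n α k * zonal k x y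

/-- The space `h(𝔹)` of complex-valued harmonic functions on the unit ball. Functions are defined
on all of `ℝⁿ`, but only their values on the ball matter. -/
def harm (n : ℕ) : Set (E n → ℂ) := {f | InnerProductSpace.HarmonicOnNhd f (B n)}

/-- The homogeneous part `f_k` of degree `k` of a harmonic function `f`: the degree `k` term
`(1/k!) (d/dr)^k f(r x)` at `r = 0` of its Taylor expansion at the origin. -/
def homPart {n : ℕ} (f : E n → ℂ) (k : ℕ) (x : E n) : ℂ :=
  ((k.factorial : ℂ))⁻¹ * iteratedDeriv k (fun r : ℝ => f (r • x)) 0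

/-- The `k`-th term of the series that defines `D^t_s f`. -/
def radialTerm {n : ℕ} (s t : ℝ) (f : E n → ℂ) (x : E n) (k : ℕ) : ℂ :=
  ((gammaCoeff n (s + t) k / gammaCoeff n s k : ℝ) : ℂ) * homPart f k x

/-- The radial differential operator `D^t_s f = ∑ (γ_k(s+t) / γ_k(s)) f_k`. -/
def radialD {n : ℕ} (s t : ℝ) (f : E n → ℂ) (x : E n) : ℂ := ∑' k : ℕ, radialTerm s t f x k

/-- `I^t_s f(x) = (1 - |x|²)^t D^t_s f(x)`. -/
def radialI {n : ℕ} (s t : ℝ) (f : E n → ℂ) (x : E n) : ℂ :=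
  (((1 - ‖x‖ ^ 2) ^ t : ℝ) : ℂ) * radialD s t f x

/-! ### Weighted harmonic Bloch spaces -/

/-- The weighted harmonic Bloch space `b^∞_α`: harmonic functions `f` with
`(1 - |x|²)^α I^t_s f(x)` bounded on the ball for some `s, t` with `α + t > 0`. -/
def bloch (n : ℕ) (α : ℝ) : Set (E n → ℂ) :=
  {f | f ∈ harm n ∧ ∃ s t : ℝ, 0 < α + t ∧
    ∃ C : ℝ, ∀ x ∈ B n, (1 - ‖x‖ ^ 2) ^ α * ‖radialI s t f x‖ ≤ C}

/-- The norm `sup (1 - |x|²)^α |I^t_s f(x)|` of `b^∞_α` that belongs to the pair `s, t`. -/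
def blochNorm {n : ℕ} (s t α : ℝ) (f : E n → ℂ) : ℝ :=
  ⨆ x : B n, (1 - ‖x.1‖ ^ 2) ^ α * ‖radialI s t f x.1‖

/-- `T` maps `X` into `Y`. Boundedness for the norms `N` on `X` and `M` on `Y`. -/
def BoundedBetween {n : ℕ} (X Y : Set (E n → ℂ)) (N M : (E n → ℂ) → ℝ)
    (T : (E n → ℂ) → E n → ℂ) : Prop :=
  ∃ C : ℝ, ∀ f ∈ X, T f ∈ Y ∧ M (T f) ≤ C * N f

/-- Compactness of `T` from `X` to `Y`, for the norms `N` on `X` and `M` on `Y`: the images of a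
sequence in the unit ball of `X` have a subsequence that converges in `Y`. -/
def CompactBetween {n : ℕ} (X Y : Set (E n → ℂ)) (N M : (E n → ℂ) → ℝ)
    (T : (E n → ℂ) → E n → ℂ) : Prop :=
  (∀ f ∈ X, T f ∈ Y) ∧ ∀ u : ℕ → E n → ℂ, (∀ j, u j ∈ X ∧ N (u j) ≤ 1) →
    ∃ g ∈ Y, ∃ φ : ℕ → ℕ, StrictMono φ ∧ Tendsto (fun j => M (T (u (φ j)) - g)) atTop (𝓝 0)

/-! ### Toeplitz operators -/

/-- The constant `V_α`: the total mass of `(1 - |x|²)^α dν` for `α > -1`, where `ν` is normalized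
Lebesgue measure on the ball, and `1` otherwise. -/
def V (n : ℕ) (α : ℝ) : ℝ :=
  if -1 < α then
    (volume.real (B n))⁻¹ * ∫ x in B n, (1 - ‖x‖ ^ 2) ^ α
  else 1

/-- The measure `(1 - |y|²)^β dμ(y)` on the unit ball. -/
def weighted {n : ℕ} (β : ℝ) (μ : Measure (E n)) : Measure (E n) :=
  (μ.restrict (B n)).withDensity fun y => ENNReal.ofReal ((1 - ‖y‖ ^ 2) ^ β)

/-- The Toeplitz operator
`_{s,t}T_μ f(x) = (1/V_s) ∫_𝔹 R_s(x, y) I^t_s f(y) (1 - |y|²)^s dμ(y)`. -/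
def toeplitz {n : ℕ} (s t : ℝ) (μ : Measure (E n)) (f : E n → ℂ) (x : E n) : ℂ :=
  ((V n s)⁻¹ : ℝ) *
    ∫ y in B n, (kernel s x y : ℂ) * radialI s t f y * (((1 - ‖y‖ ^ 2) ^ s : ℝ) : ℂ) ∂μ

/-- The classical Toeplitz operator `_{s+t}T_κ g(x) = (1/V_s) ∫_𝔹 R_{s+t}(x, y) g(y) dκ(y)`. -/
def classicalToeplitz {n : ℕ} (s t : ℝ) (κ : Measure (E n)) (g : E n → ℂ) (x : E n) : ℂ :=
  ((V n s)⁻¹ : ℝ) * ∫ y in B n, (kernel (s + t) x y : ℂ) * g y ∂κ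

end HarmonicBloch

end

open HarmonicBloch

/-!
In terms of homogeneous expansions, `D^t_s` multiplies the part of degree `k` by
`γ_k(s + t) / γ_k(s)`, and `T_μ f` is the function whose part of degree `k` is
`V_s⁻¹ γ_k(s) ∫ Z_k(x, y) F(y) dμ(y)` with `F(y) = (1 - |y|²)^(s+t) D^t_s f(y)`. Since `T_κ D^t_s f`
has the parts `V_s⁻¹ γ_k(s + t) ∫ Z_k(x, y) F(y) dμ(y)`, the relation `D^t_s T_μ = T_κ D^t_s` is the
comparison of coefficients (`radialD_toeplitz`). As all `γ_k` are positive, `D^t_s` and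
`D^{-t}_{s+t}` are inverse to each other, which gives the other two identities. Moreover `D^t_s` is
an isometry from `b^∞_{α_i}` with the `(s,t)`-norm onto `b^∞_{α_i+t}`, by definition of the norms, so
that mapping properties, boundedness and compactness are transported (`mapsTo_iff_of_intertwining`
and the two lemmas after it).

The work lies in the convergence of these series and in the fact that `D^t_s` maps `b^∞_α` onto
`b^∞_{α+t}`.

* A harmonic function on the ball is the sum of its Taylor components, with geometric convergence
  on smaller balls (`isExpansion_homPart`), and conversely such sums are harmonic
  (`IsExpansion.harm`). This rests on bounds for the components of harmonic polynomials that are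
  uniform in the degree (`exists_homogeneousComponent_bound`), obtained from orthogonality for a
  radial weight, and on density of harmonic polynomials (`exists_harmonic_near`).
* The sequence `γ_k(α)` is a product of quotients of rising factorials. Multiplication by
  `(c + k) / c` is a first order differential operator, which raises the order of growth at the
  boundary by one (`Growth.mult_add_div`); multiplication by `(a)_k / (a + c)_k` is an average of
  dilations, which lowers it by `c` (`Growth.mult_poch_div`). Hence `γ_k(s + t) / γ_k(s)` changes the
  order of growth by exactly `t` (`HasOrder`), and membership in `b^∞_α` does not depend on the
  pair of parameters used to test it (`mem_bloch_iff`).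
* The zonal harmonics satisfy `|Z_k(x, y)| ≤ C θ^k` with `θ < 1`, uniformly for `|x| ≤ r < 1` and
  `|y| ≤ 1` (`exists_abs_zonal_le_geometric`). So the kernels converge, are bounded in `y`, and can be
  integrated term by term (`isExpansion_integral_kernel`).
-/

namespace HarmonicBloch

noncomputable section

variable {n : ℕ}

/-! ### Harmonic polynomials -/

open MvPolynomial in
/-- The polynomial function on `ℝⁿ` defined by a polynomial. -/
def ev {n : ℕ} (P : MvPolynomial (Fin n) ℝ) (x : E n) : ℝ := eval (fun i => x i) P

/-- The `i`-th partial derivative of a function on `ℝⁿ`. -/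
def pd {n : ℕ} {F : Type*} [NormedAddCommGroup F] [NormedSpace ℝ F] (i : Fin n) (f : E n → F)
    (x : E n) : F := fderiv ℝ f x (EuclideanSpace.single i 1)

/-- The Laplacian on polynomials. -/
def polyLap {n : ℕ} : MvPolynomial (Fin n) ℝ →ₗ[ℝ] MvPolynomial (Fin n) ℝ :=
  ∑ i, (MvPolynomial.pderiv i).toLinearMap ∘ₗ (MvPolynomial.pderiv i).toLinearMap

theorem polyLap_apply (P : MvPolynomial (Fin n) ℝ) :
    polyLap P = ∑ i, MvPolynomial.pderiv i (MvPolynomial.pderiv i P) := by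
  simp [polyLap]

@[simp] theorem ev_add (P Q : MvPolynomial (Fin n) ℝ) (x : E n) :
    ev (P + Q) x = ev P x + ev Q x := by simp [ev]
@[simp] theorem ev_sub (P Q : MvPolynomial (Fin n) ℝ) (x : E n) :
    ev (P - Q) x = ev P x - ev Q x := by simp [ev]
@[simp] theorem ev_mul (P Q : MvPolynomial (Fin n) ℝ) (x : E n) :
    ev (P * Q) x = ev P x * ev Q x := by simp [ev]
@[simp] theorem ev_C (c : ℝ) (x : E n) : ev (MvPolynomial.C c) x = c := by simp [ev]
@[simp] theorem ev_zero (x : E n) : ev (0 : MvPolynomial (Fin n) ℝ) x = 0 := by simp [ev]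
@[simp] theorem ev_one (x : E n) : ev (1 : MvPolynomial (Fin n) ℝ) x = 1 := by simp [ev]
@[simp] theorem ev_X (i : Fin n) (x : E n) : ev (MvPolynomial.X i) x = x i := by simp [ev]
@[simp] theorem ev_sum {ι : Type*} (s : Finset ι) (P : ι → MvPolynomial (Fin n) ℝ) (x : E n) :
    ev (∑ j ∈ s, P j) x = ∑ j ∈ s, ev (P j) x := by simp [ev]

theorem hasFDerivAt_ev (P : MvPolynomial (Fin n) ℝ) (x : E n) :
    HasFDerivAt (ev P) (∑ i, ev (MvPolynomial.pderiv i P) x •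
      (EuclideanSpace.proj i : E n →L[ℝ] ℝ)) x := by
  induction P using MvPolynomial.induction_on with
  | C a =>
    have : ev (MvPolynomial.C a : MvPolynomial (Fin n) ℝ) = fun _ => a := by ext; simp
    rw [this]
    simpa using hasFDerivAt_const a x
  | add P Q hP hQ =>
    have : ev (P + Q) = fun y => ev P y + ev Q y := by ext; simp
    rw [this]
    refine (hP.add hQ).congr_fderiv ?_
    simp [add_smul, Finset.sum_add_distrib]
  | mul_X P i hP =>
    have : ev (P * MvPolynomial.X i) = fun y => ev P y * (EuclideanSpace.proj i : E n →L[ℝ] ℝ) y := by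
      ext; simp
    rw [this]
    refine (hP.mul (EuclideanSpace.proj i : E n →L[ℝ] ℝ).hasFDerivAt).congr_fderiv ?_
    simp only [Derivation.leibniz, MvPolynomial.pderiv_X, smul_eq_mul, ev_add, ev_mul, ev_X, add_smul,
      Finset.sum_add_distrib, Finset.smul_sum, smul_smul]
    congr 1
    rw [Finset.sum_eq_single i] <;> simp +contextual

theorem ev_differentiable (P : MvPolynomial (Fin n) ℝ) : Differentiable ℝ (ev P) :=
  fun x => (hasFDerivAt_ev P x).differentiableAt

theorem ev_continuous (P : MvPolynomial (Fin n) ℝ) : Continuous (ev P) :=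
  (ev_differentiable P).continuous

theorem pd_ev (i : Fin n) (P : MvPolynomial (Fin n) ℝ) : pd i (ev P) = ev (MvPolynomial.pderiv i P) := by
  ext x
  rw [pd, (hasFDerivAt_ev P x).fderiv]
  simp

theorem ev_contDiff (P : MvPolynomial (Fin n) ℝ) (m : ℕ) : ContDiff ℝ m (ev P) := by
  induction P using MvPolynomial.induction_on with
  | C a =>
    have : ev (MvPolynomial.C a : MvPolynomial (Fin n) ℝ) = fun _ => a := by ext; simp
    rw [this]; exact contDiff_const
  | add P Q hP hQ =>
    have : ev (P + Q) = fun y => ev P y + ev Q y := by ext; simp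
    rw [this]; exact hP.add hQ
  | mul_X P i hP =>
    have : ev (P * MvPolynomial.X i) = fun y => ev P y * (EuclideanSpace.proj i : E n →L[ℝ] ℝ) y := by
      ext; simp
    rw [this]; exact hP.mul (ContinuousLinearMap.contDiff _)

theorem laplacian_eq_sum_pd {F : Type*} [NormedAddCommGroup F] [NormedSpace ℝ F] {f : E n → F}
    {x : E n} (hf : ContDiffAt ℝ 2 f x) : Laplacian.laplacian f x = ∑ i, pd i (pd i f) x := by
  rw [InnerProductSpace.laplacian_eq_iteratedFDeriv_orthonormalBasis f
    (EuclideanSpace.basisFun (Fin n) ℝ)]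
  refine Finset.sum_congr rfl fun i _ => ?_
  rw [iteratedFDeriv_two_apply]
  have hd : DifferentiableAt ℝ (fderiv ℝ f) x :=
    (hf.fderiv_right (m := 1) (by norm_num)).differentiableAt (by norm_num)
  unfold pd
  rw [fderiv_clm_apply hd (by fun_prop)]
  simp

theorem laplacian_ev (P : MvPolynomial (Fin n) ℝ) (x : E n) :
    Laplacian.laplacian (ev P) x = ev (polyLap P) x := by
  rw [laplacian_eq_sum_pd (by exact_mod_cast (ev_contDiff P 2).contDiffAt), polyLap_apply]
  simp [pd_ev]

theorem ev_injective {P Q : MvPolynomial (Fin n) ℝ} (h : ∀ x : E n, ev P x = ev Q x) : P = Q := by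
  refine MvPolynomial.funext fun x => ?_
  simpa [ev] using h (WithLp.toLp 2 x)

theorem harmonicOnNhd_ev_iff (P : MvPolynomial (Fin n) ℝ) :
    InnerProductSpace.HarmonicOnNhd (ev P) Set.univ ↔ polyLap P = 0 := by
  constructor
  · intro h
    refine ev_injective fun x => ?_
    rw [← laplacian_ev, (h x trivial).2.self_of_nhds]; simp
  · intro h x _
    refine ⟨by exact_mod_cast (ev_contDiff P 2).contDiffAt, Eventually.of_forall fun y => ?_⟩
    rw [laplacian_ev, h]; simp

theorem mem_harmonicPoly_iff {k : ℕ} {p : E n → ℝ} :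
    p ∈ harmonicPoly n k ↔ ∃ P : MvPolynomial (Fin n) ℝ, P.IsHomogeneous k ∧ polyLap P = 0 ∧
      p = ev P := by
  constructor
  · rintro ⟨⟨P, hP, hp⟩, h⟩
    obtain rfl : p = ev P := funext hp
    exact ⟨P, hP, (harmonicOnNhd_ev_iff P).1 h, rfl⟩
  · rintro ⟨P, hP, h, rfl⟩
    exact ⟨⟨P, hP, fun _ => rfl⟩, (harmonicOnNhd_ev_iff P).2 h⟩

theorem polyLap_pderiv (i : Fin n) (P : MvPolynomial (Fin n) ℝ) :
    polyLap (MvPolynomial.pderiv i P) = MvPolynomial.pderiv i (polyLap P) := by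
  rw [polyLap_apply, polyLap_apply, map_sum]
  refine Finset.sum_congr rfl fun j _ => ?_
  have hc : ∀ Q : MvPolynomial (Fin n) ℝ,
      MvPolynomial.pderiv j (MvPolynomial.pderiv i Q) = MvPolynomial.pderiv i (MvPolynomial.pderiv j Q) := by
    intro Q
    ext m
    simp only [MvPolynomial.coeff_pderiv]
    rw [add_right_comm]
    by_cases hij : i = j
    · subst hij; ring
    · simp [hij, Ne.symm hij]; ring
  rw [hc, hc]

theorem pd_mem_harmonicPoly {k : ℕ} {p : E n → ℝ} (hp : p ∈ harmonicPoly n k) (i : Fin n) :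
    pd i p ∈ harmonicPoly n (k - 1) := by
  obtain ⟨P, hP, h, rfl⟩ := mem_harmonicPoly_iff.1 hp
  exact mem_harmonicPoly_iff.2 ⟨MvPolynomial.pderiv i P, hP.pderiv, by rw [polyLap_pderiv, h, map_zero],
    pd_ev i P⟩

theorem pderiv_homogeneousComponent (i : Fin n) (k : ℕ) (P : MvPolynomial (Fin n) ℝ) :
    MvPolynomial.pderiv i (MvPolynomial.homogeneousComponent (k + 1) P) =
      MvPolynomial.homogeneousComponent k (MvPolynomial.pderiv i P) := by
  ext m
  simp only [MvPolynomial.coeff_pderiv, MvPolynomial.coeff_homogeneousComponent, map_add,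
    Finsupp.degree_single, add_left_inj]
  split_ifs <;> simp

/-- The homogeneous components of a harmonic polynomial are harmonic. -/
theorem polyLap_homogeneousComponent {P : MvPolynomial (Fin n) ℝ} (hP : polyLap P = 0) (k : ℕ) :
    polyLap (MvPolynomial.homogeneousComponent k P) = 0 := by
  rcases k with _ | _ | k
  · simp [polyLap_apply, MvPolynomial.homogeneousComponent_zero]
  · rw [polyLap_apply]
    refine Finset.sum_eq_zero fun i _ => ?_
    rw [pderiv_homogeneousComponent, MvPolynomial.homogeneousComponent_zero, MvPolynomial.pderiv_C]
  · rw [polyLap_apply]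
    simp_rw [pderiv_homogeneousComponent]
    rw [← map_sum, ← polyLap_apply, hP, map_zero]

theorem ev_homogeneousComponent_mem {P : MvPolynomial (Fin n) ℝ} (hP : polyLap P = 0) (k : ℕ) :
    ev (MvPolynomial.homogeneousComponent k P) ∈ harmonicPoly n k :=
  mem_harmonicPoly_iff.2 ⟨_, MvPolynomial.homogeneousComponent_isHomogeneous k P,
    polyLap_homogeneousComponent hP k, rfl⟩

theorem ev_eq_sum_homogeneousComponent (P : MvPolynomial (Fin n) ℝ) (x : E n) :
    ev P x = ∑ k ∈ Finset.range (P.totalDegree + 1), ev (MvPolynomial.homogeneousComponent k P) x := by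
  rw [← ev_sum, MvPolynomial.sum_homogeneousComponent]

/-- Euler's identity. -/
theorem sum_mul_pd {k : ℕ} {p : E n → ℝ} (hp : p ∈ harmonicPoly n k) (x : E n) :
    ∑ i, x i * pd i p x = k * p x := by
  obtain ⟨P, hP, -, rfl⟩ := mem_harmonicPoly_iff.1 hp
  have := congrArg (fun Q => ev Q x) hP.sum_X_mul_pderiv
  simpa [pd_ev, nsmul_eq_mul, ev] using this

theorem sum_pd_pd {k : ℕ} {p : E n → ℝ} (hp : p ∈ harmonicPoly n k) (x : E n) :
    ∑ i, pd i (pd i p) x = 0 := by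
  obtain ⟨P, hP, h, rfl⟩ := mem_harmonicPoly_iff.1 hp
  rw [show ∑ i, pd i (pd i (ev P)) x = ev (polyLap P) x by simp [pd_ev, polyLap_apply], h, ev_zero]

theorem pd_comp_affine {F : Type*} [NormedAddCommGroup F] [NormedSpace ℝ F] (i : Fin n)
    (f : E n → F) (a : E n) (c : ℝ) (x : E n) :
    pd i (fun y => f (a + c • y)) x = c • pd i f (a + c • x) := by
  unfold pd
  have := fderiv_comp_smul (𝕜 := ℝ) (f := fun y => f (a + y)) (x := x) c
  rw [this, fderiv_comp_add_left]
  rfl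

theorem pd_const_smul {F : Type*} [NormedAddCommGroup F] [NormedSpace ℝ F] (i : Fin n)
    (f : E n → F) (c : ℝ) (x : E n) :
    pd i (fun y => c • f y) x = c • pd i f x := by
  unfold pd
  rw [show (fun y => c • f y) = c • f from rfl, fderiv_const_smul_field]
  rfl

/-- Harmonicity is preserved by translations and dilations. -/
theorem harmonicAt_comp_affine {F : Type*} [NormedAddCommGroup F] [NormedSpace ℝ F] {f : E n → F}
    {a x : E n} {c : ℝ} (h : InnerProductSpace.HarmonicAt f (a + c • x)) :
    InnerProductSpace.HarmonicAt (fun y => f (a + c • y)) x := by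
  have hc : ∀ y, ContDiffAt ℝ 2 f (a + c • y) → ContDiffAt ℝ 2 (fun y => f (a + c • y)) y :=
    fun y hy => ContDiffAt.comp y hy (by fun_prop)
  refine ⟨hc x h.1, ?_⟩
  have ht : Tendsto (fun y : E n => a + c • y) (𝓝 x) (𝓝 (a + c • x)) :=
    Continuous.tendsto (by fun_prop) x
  filter_upwards [ht.eventually h.eventually] with y hy
  rw [laplacian_eq_sum_pd (hc y hy.1)]
  have h0 := hy.2.self_of_nhds
  rw [laplacian_eq_sum_pd hy.1] at h0
  have : ∀ i, pd i (pd i fun y => f (a + c • y)) y = c • c • pd i (pd i f) (a + c • y) := by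
    intro i
    rw [← pd_comp_affine i (pd i f), ← pd_const_smul]
    congr 1
    ext z
    exact pd_comp_affine i f a c z
  simp_rw [this, ← Finset.smul_sum, h0]
  simp

theorem exists_ev_comp_affine (P : MvPolynomial (Fin n) ℝ) (a : E n) (c : ℝ) :
    ∃ Q : MvPolynomial (Fin n) ℝ, ∀ x, ev Q x = ev P (a + c • x) := by
  refine ⟨MvPolynomial.bind₁ (fun i => MvPolynomial.C (a i) + MvPolynomial.C c * MvPolynomial.X i) P,
    fun x => ?_⟩
  simp only [ev, ← MvPolynomial.coe_aeval_eq_eval, RingHom.coe_coe, MvPolynomial.aeval_bind₁]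
  simp

theorem exists_harmonic_comp_affine {P : MvPolynomial (Fin n) ℝ} (hP : polyLap P = 0) (a : E n)
    (c : ℝ) :
    ∃ Q : MvPolynomial (Fin n) ℝ, polyLap Q = 0 ∧ ∀ x, ev Q x = ev P (a + c • x) := by
  obtain ⟨Q, hQ⟩ := exists_ev_comp_affine P a c
  refine ⟨Q, (harmonicOnNhd_ev_iff Q).1 fun x _ => ?_, hQ⟩
  rw [funext hQ]
  exact harmonicAt_comp_affine ((harmonicOnNhd_ev_iff P).2 hP _ trivial)

/-! ### Interior bounds for harmonic polynomials -/

/-- The radial weight `max (0, 1 - |x|²)`. The gradient of its square, a `C¹` function, is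
`-4 bump(x) x`; so an integration by parts against `bump ^ 2` produces, by Euler's identity, the
degrees of homogeneous polynomials. Integrals against `bump` replace integrals over the sphere. -/
def bump (x : E n) : ℝ := max 0 (1 - ‖x‖ ^ 2)

theorem bump_nonneg (x : E n) : 0 ≤ bump x := le_max_left _ _

theorem bump_le_one (x : E n) : bump x ≤ 1 := max_le zero_le_one (by nlinarith [sq_nonneg ‖x‖])

theorem bump_eq_zero {x : E n} (hx : 1 ≤ ‖x‖) : bump x = 0 :=
  max_eq_left (by nlinarith)

theorem bump_continuous : Continuous (bump : E n → ℝ) := by unfold bump; fun_prop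

theorem bump_hasCompactSupport : HasCompactSupport (bump : E n → ℝ) :=
  HasCompactSupport.intro (isCompact_closedBall 0 1) fun x hx => bump_eq_zero (by
    simp at hx; exact hx.le)

theorem integrable_mul_bump {g : E n → ℝ} (hg : Continuous g) :
    Integrable (fun x => g x * bump x) :=
  (hg.mul bump_continuous).integrable_of_hasCompactSupport bump_hasCompactSupport.mul_left

theorem integrable_mul_bump_sq {g : E n → ℝ} (hg : Continuous g) :
    Integrable (fun x => g x * bump x ^ 2) := by
  simp_rw [pow_two, ← mul_assoc]
  exact integrable_mul_bump (hg.mul bump_continuous)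

theorem integral_bump_pos : 0 < ∫ x : E n, bump x := by
  refine bump_continuous.integral_pos_of_hasCompactSupport_nonneg_nonzero
    bump_hasCompactSupport bump_nonneg (x := 0) ?_
  simp [bump]

theorem hasDerivAt_max_zero_sq (v : ℝ) :
    HasDerivAt (fun v : ℝ => (max 0 v) ^ 2) (2 * max 0 v) v := by
  rcases lt_trichotomy v 0 with h | rfl | h
  · rw [max_eq_left h.le, mul_zero]
    refine (hasDerivAt_const v (0 : ℝ)).congr_of_eventuallyEq ?_
    filter_upwards [gt_mem_nhds h] with u hu
    simp [max_eq_left hu.le]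
  · rw [hasDerivAt_iff_isLittleO_nhds_zero]
    simp only [zero_add, max_self, mul_zero, smul_zero, sub_zero, ne_eq, OfNat.ofNat_ne_zero,
      not_false_eq_true, zero_pow]
    refine Asymptotics.IsBigO.trans_isLittleO (g := fun u : ℝ => u ^ 2) ?_
      (Asymptotics.isLittleO_pow_id one_lt_two)
    refine Asymptotics.IsBigO.of_bound 1 (Eventually.of_forall fun u => ?_)
    rw [one_mul, norm_pow, norm_pow]
    refine pow_le_pow_left₀ (norm_nonneg _) ?_ 2
    rcases le_total u 0 with hu | hu <;> simp [hu]
  · rw [max_eq_right h.le]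
    have := hasDerivAt_pow 2 v
    refine (this.congr_of_eventuallyEq ?_).congr_deriv (by simp)
    filter_upwards [lt_mem_nhds h] with u hu
    simp [max_eq_right hu.le]

theorem hasFDerivAt_bump_sq (x : E n) :
    HasFDerivAt (fun x : E n => bump x ^ 2) (-(4 * bump x) • innerSL ℝ x) x := by
  have h1 : HasFDerivAt (fun x : E n => 1 - ‖x‖ ^ 2) (-(2 • innerSL ℝ x)) x :=
    ((hasStrictFDerivAt_norm_sq x).hasFDerivAt).const_sub 1
  refine ((hasDerivAt_max_zero_sq _).comp_hasFDerivAt x h1).congr_fderiv ?_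
  ext y
  simp [bump]
  ring

theorem pd_bump_sq (i : Fin n) (x : E n) :
    fderiv ℝ (fun x : E n => bump x ^ 2) x (EuclideanSpace.single i 1) = -(4 * bump x) * x i := by
  rw [(hasFDerivAt_bump_sq x).fderiv]
  simp [EuclideanSpace.inner_single_right]

theorem integral_pd_pd_mul_bump_sq (P Q : MvPolynomial (Fin n) ℝ) (i : Fin n) :
    ∫ x, pd i (pd i (ev P)) x * ev Q x * bump x ^ 2 =
      -(∫ x, pd i (ev P) x * pd i (ev Q) x * bump x ^ 2) +
        4 * ∫ x, x i * pd i (ev P) x * ev Q x * bump x := by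
  have hφ : Differentiable ℝ (fun x : E n => bump x ^ 2) :=
    fun x => (hasFDerivAt_bump_sq x).differentiableAt
  have hg : ∀ x, fderiv ℝ (fun x => ev Q x * bump x ^ 2) x (EuclideanSpace.single i 1) =
      pd i (ev Q) x * bump x ^ 2 - 4 * (x i * ev Q x * bump x) := by
    intro x
    rw [fderiv_fun_mul (ev_differentiable Q x) (hφ x)]
    simp only [_root_.add_apply, _root_.smul_apply, smul_eq_mul, pd_bump_sq, pd]
    ring
  have hcP : Continuous (ev P) := ev_continuous P
  have hcQ : Continuous (ev Q) := ev_continuous Q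
  have hcP1 : Continuous (pd i (ev P)) := by rw [pd_ev]; exact ev_continuous _
  have hcP2 : Continuous (pd i (pd i (ev P))) := by rw [pd_ev, pd_ev]; exact ev_continuous _
  have hcQ1 : Continuous (pd i (ev Q)) := by rw [pd_ev]; exact ev_continuous _
  have hxi : Continuous (fun x : E n => x i) := by fun_prop
  have i1 := integrable_mul_bump_sq (hcP1.fun_mul hcQ1)
  have i2 := integrable_mul_bump ((hxi.fun_mul hcP1).fun_mul hcQ)
  have i3 := integrable_mul_bump_sq (hcP2.fun_mul hcQ)
  have key := integral_mul_fderiv_eq_neg_fderiv_mul_of_integrable (μ := (volume : Measure (E n)))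
    (f := pd i (ev P)) (g := fun x => ev Q x * bump x ^ 2) (v := EuclideanSpace.single i 1)
    ?_ ?_ ?_ (fun x _ => by rw [pd_ev]; exact ev_differentiable _ x)
    (fun x _ => (ev_differentiable Q x).mul (hφ x))
  · have e1 : ∀ x, fderiv ℝ (pd i (ev P)) x (EuclideanSpace.single i 1) * (ev Q x * bump x ^ 2) =
        pd i (pd i (ev P)) x * ev Q x * bump x ^ 2 := fun x => by simp only [pd]; ring
    have e2 : ∀ x, pd i (ev P) x * fderiv ℝ (fun x => ev Q x * bump x ^ 2) x
        (EuclideanSpace.single i 1) = pd i (ev P) x * pd i (ev Q) x * bump x ^ 2 -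
        4 * (x i * pd i (ev P) x * ev Q x * bump x) := fun x => by rw [hg]; ring
    simp_rw [e1, e2] at key
    rw [integral_sub i1 (i2.const_mul 4), integral_const_mul] at key
    linarith
  · refine i3.congr (Eventually.of_forall fun x => ?_)
    simp only [pd]; ring
  · refine (i1.sub (i2.const_mul 4)).congr (Eventually.of_forall fun x => ?_)
    simp only [hg, Pi.sub_apply]; ring
  · refine (integrable_mul_bump_sq (hcP1.fun_mul hcQ)).congr (Eventually.of_forall fun x => ?_)
    simp only; ring

/-- Green's identity for the weight `bump`. -/
theorem nat_mul_integral_bump {k : ℕ} {p : E n → ℝ} (hp : p ∈ harmonicPoly n k)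
    (Q : MvPolynomial (Fin n) ℝ) :
    4 * (k * ∫ x, p x * ev Q x * bump x) =
      ∑ i, ∫ x, pd i p x * pd i (ev Q) x * bump x ^ 2 := by
  have hs := sum_pd_pd hp
  have he := sum_mul_pd hp
  obtain ⟨P, hP, hP0, rfl⟩ := mem_harmonicPoly_iff.1 hp
  have hcP : Continuous (ev P) := ev_continuous P
  have hcQ : Continuous (ev Q) := ev_continuous Q
  have hcP1 : ∀ i, Continuous (pd i (ev P)) := fun i => by rw [pd_ev]; exact ev_continuous _
  have hcP2 : ∀ i, Continuous (pd i (pd i (ev P))) := fun i => by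
    rw [pd_ev, pd_ev]; exact ev_continuous _
  have hxi : ∀ i, Continuous (fun x : E n => x i) := fun i => by fun_prop
  have h := Finset.sum_congr (rfl : Finset.univ = Finset.univ) fun i _ =>
    integral_pd_pd_mul_bump_sq P Q i
  rw [← integral_finsetSum _ (fun i _ => integrable_mul_bump_sq ((hcP2 i).fun_mul hcQ)),
    Finset.sum_add_distrib, ← Finset.mul_sum,
    ← integral_finsetSum _ (fun i _ => integrable_mul_bump (((hxi i).fun_mul (hcP1 i)).fun_mul hcQ))] at h
  simp_rw [← Finset.sum_mul, hs, he, zero_mul, integral_zero] at h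
  rw [Finset.sum_neg_distrib] at h
  simp_rw [mul_assoc (k : ℝ)] at h
  rw [integral_const_mul] at h
  simp_rw [← mul_assoc] at h ⊢
  linarith

/-- Homogeneous harmonic polynomials of different degrees are orthogonal for a radial weight. -/
theorem integral_mul_bump_eq_zero {k l : ℕ} (hkl : k ≠ l) {p q : E n → ℝ}
    (hp : p ∈ harmonicPoly n k) (hq : q ∈ harmonicPoly n l) : ∫ x, p x * q x * bump x = 0 := by
  obtain ⟨P, -, -, rfl⟩ := mem_harmonicPoly_iff.1 hp
  obtain ⟨Q, -, -, rfl⟩ := mem_harmonicPoly_iff.1 hq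
  have h1 := nat_mul_integral_bump hp Q
  have h2 := nat_mul_integral_bump hq P
  simp_rw [mul_comm (pd _ (ev Q) _), mul_comm (ev Q _)] at h2
  have h3 : ((k : ℝ) - l) * ∫ x, ev P x * ev Q x * bump x = 0 := by linarith
  rcases mul_eq_zero.1 h3 with h | h
  · exact absurd (by exact_mod_cast sub_eq_zero.1 h) hkl
  · exact h

/-- The weighted mean value property of harmonic polynomials. -/
theorem mean_value_bump {P : MvPolynomial (Fin n) ℝ} (hP : polyLap P = 0) (a : E n) (c : ℝ) :
    ∫ x, ev P (a + c • x) * bump x = ev P a * ∫ x : E n, bump x := by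
  obtain ⟨Q, hQ, hQP⟩ := exists_harmonic_comp_affine hP a c
  simp_rw [← hQP]
  have ha : ev P a = ev Q 0 := by rw [hQP]; simp
  rw [ha]
  have h1 : (fun _ => 1 : E n → ℝ) ∈ harmonicPoly n 0 :=
    mem_harmonicPoly_iff.2 ⟨1, MvPolynomial.isHomogeneous_one _ _, by simp [polyLap_apply], by ext; simp⟩
  have h0 : ∀ x, ev (MvPolynomial.homogeneousComponent 0 Q) x = ev Q 0 := by
    intro x
    rw [MvPolynomial.homogeneousComponent_zero, ev_C, ev]
    rw [← MvPolynomial.constantCoeff_eq]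
    exact (RingHom.congr_fun MvPolynomial.eval_zero Q).symm
  simp_rw [ev_eq_sum_homogeneousComponent Q _, Finset.sum_mul]
  rw [integral_finsetSum _ (fun k _ => integrable_mul_bump (ev_continuous _)),
    ← Finset.sum_mul, ← ev_eq_sum_homogeneousComponent, Finset.sum_eq_single 0]
  · simp_rw [h0]
    rw [integral_const_mul]
  · intro k _ hk
    have := integral_mul_bump_eq_zero hk (ev_homogeneousComponent_mem hQ k) h1
    simpa using this
  · simp

/-- Interior pointwise bound of harmonic polynomials by a weighted `L²` norm, uniform in the degree. -/
theorem exists_sq_le_integral_bump (n : ℕ) {r : ℝ} (hr : r < 1) : ∃ C : ℝ, 0 ≤ C ∧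
    ∀ P : MvPolynomial (Fin n) ℝ, polyLap P = 0 → ∀ a : E n, ‖a‖ ≤ r →
      ev P a ^ 2 ≤ C * ∫ x, ev P x ^ 2 * bump x := by
  by_cases hr0 : r < 0
  · exact ⟨0, le_rfl, fun P _ a ha => absurd ((norm_nonneg a).trans ha) (not_le.2 hr0)⟩
  rw [not_lt] at hr0
  set δ : ℝ := (1 - r) / 2 with hδ
  set ρ : ℝ := (1 + r) / 2 with hρ
  have hδ0 : 0 < δ := by rw [hδ]; linarith
  have hρ1 : 0 < 1 - ρ ^ 2 := by rw [hρ]; nlinarith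
  set I : ℝ := ∫ x : E n, bump x with hI
  have hI0 : 0 < I := integral_bump_pos
  set J : ℝ := |(δ ^ Module.finrank ℝ (E n))⁻¹| with hJ
  refine ⟨I⁻¹ * ((1 - ρ ^ 2)⁻¹ * J), by positivity, fun P hP a ha => ?_⟩
  have hcP : Continuous (ev P) := ev_continuous P
  have hcA : Continuous (fun x : E n => ev P (a + δ • x)) := hcP.comp (by fun_prop)
  have hcB : Continuous (fun x : E n => bump (a + δ • x)) := bump_continuous.comp (by fun_prop)
  -- the Cauchy-Schwarz inequality for the mean value, in the form `2uv ≤ u² + v²`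
  have h1 : ev P a ^ 2 * I ≤ ∫ x, ev P (a + δ • x) ^ 2 * bump x := by
    have hm := mean_value_bump hP a δ
    have : ∫ x, ev P a * (ev P (a + δ • x) * bump x) ≤
        ∫ x, (1 / 2 * (ev P a ^ 2 * bump x) + 1 / 2 * (ev P (a + δ • x) ^ 2 * bump x)) := by
      refine integral_mono ((integrable_mul_bump hcA).const_mul _)
        (((integrable_mul_bump continuous_const).const_mul _).add
          ((integrable_mul_bump (hcA.fun_pow 2)).const_mul _)) fun x => ?_
      nlinarith [mul_nonneg (sq_nonneg (ev P a - ev P (a + δ • x))) (bump_nonneg x)]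
    rw [integral_const_mul, hm, integral_add ((integrable_mul_bump continuous_const).const_mul _)
          ((integrable_mul_bump (hcA.fun_pow 2)).const_mul _), integral_const_mul, integral_const_mul,
          integral_const_mul] at this
    nlinarith
  have hsupp : HasCompactSupport fun x : E n => bump (a + δ • x) := by
    have := bump_hasCompactSupport (n := n) |>.comp_homeomorph
      ((Homeomorph.smulOfNeZero δ hδ0.ne').trans (Homeomorph.addLeft a))
    exact this
  have hint : Integrable fun x => ev P (a + δ • x) ^ 2 * bump (a + δ • x) :=
    ((hcA.fun_pow 2).mul hcB).integrable_of_hasCompactSupport hsupp.mul_left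
  have h2 : ∫ x, ev P (a + δ • x) ^ 2 * bump x ≤
      (1 - ρ ^ 2)⁻¹ * ∫ x, ev P (a + δ • x) ^ 2 * bump (a + δ • x) := by
    rw [← integral_const_mul]
    refine integral_mono (integrable_mul_bump (hcA.fun_pow 2)) (hint.const_mul _) fun x => ?_
    rcases le_total 1 ‖x‖ with hx | hx
    · simp only [bump_eq_zero hx, mul_zero]
      exact mul_nonneg (inv_nonneg.2 hρ1.le) (mul_nonneg (sq_nonneg _) (bump_nonneg _))
    · have hn : ‖a + δ • x‖ ≤ ρ := by
        refine (norm_add_le _ _).trans ?_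
        rw [norm_smul, Real.norm_of_nonneg hδ0.le]
        nlinarith
      have hb : 1 - ρ ^ 2 ≤ bump (a + δ • x) :=
        le_max_of_le_right (by nlinarith [norm_nonneg (a + δ • x)])
      have : 1 ≤ (1 - ρ ^ 2)⁻¹ * bump (a + δ • x) := by
        rw [inv_mul_eq_div, le_div_iff₀ hρ1]; linarith
      calc ev P (a + δ • x) ^ 2 * bump x ≤ ev P (a + δ • x) ^ 2 * 1 :=
            mul_le_mul_of_nonneg_left (bump_le_one x) (sq_nonneg _)
        _ ≤ ev P (a + δ • x) ^ 2 * ((1 - ρ ^ 2)⁻¹ * bump (a + δ • x)) :=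
            mul_le_mul_of_nonneg_left this (sq_nonneg _)
        _ = _ := by ring
  have h3 : ∫ x, ev P (a + δ • x) ^ 2 * bump (a + δ • x) =
      J * ∫ x, ev P x ^ 2 * bump x := by
    rw [Measure.integral_comp_smul volume (fun x => ev P (a + x) ^ 2 * bump (a + x)) δ,
      integral_add_left_eq_self (fun x => ev P x ^ 2 * bump x) a, smul_eq_mul]
  rw [h3] at h2
  have h4 := h1.trans h2
  rw [mul_assoc, inv_mul_eq_div, le_div_iff₀ hI0, mul_assoc]
  exact h4

/-- Interior bounds for the homogeneous components of a harmonic polynomial, uniform in the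
degree. -/
theorem exists_homogeneousComponent_bound (n : ℕ) {r : ℝ} (hr : r < 1) : ∃ C : ℝ, 0 ≤ C ∧
    ∀ P : MvPolynomial (Fin n) ℝ, polyLap P = 0 → ∀ M : ℝ, (∀ x : E n, ‖x‖ ≤ 1 → |ev P x| ≤ M) →
      ∀ k (a : E n), ‖a‖ ≤ r → |ev (MvPolynomial.homogeneousComponent k P) a| ≤ C * M := by
  obtain ⟨C, hC0, hC⟩ := exists_sq_le_integral_bump n hr
  set I : ℝ := ∫ x : E n, bump x with hI
  have hI0 : 0 < I := integral_bump_pos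
  refine ⟨√(C * I), Real.sqrt_nonneg _, fun P hP M hM k a ha => ?_⟩
  have hM0 : 0 ≤ M := (abs_nonneg _).trans (hM 0 (by simp))
  set p := ev (MvPolynomial.homogeneousComponent k P) with hp
  have hcp : Continuous p := ev_continuous _
  have hcP : Continuous (ev P) := ev_continuous _
  have hpm := ev_homogeneousComponent_mem hP k
  have h1 : ∫ x, p x ^ 2 * bump x = ∫ x, ev P x * p x * bump x := by
    simp_rw [ev_eq_sum_homogeneousComponent P _, Finset.sum_mul]
    rw [integral_finsetSum _ (fun j _ => integrable_mul_bump ((ev_continuous _).fun_mul hcp))]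
    by_cases hk : k ∈ Finset.range (P.totalDegree + 1)
    · rw [Finset.sum_eq_single_of_mem k hk]
      · simp_rw [pow_two]; rfl
      · intro j _ hj
        exact integral_mul_bump_eq_zero hj (ev_homogeneousComponent_mem hP j) hpm
    · have : p = fun _ => 0 := by
        rw [hp, MvPolynomial.homogeneousComponent_eq_zero _ _ (by simpa using hk)]
        ext; simp
      simp [this]
  have h2 : ∫ x, p x ^ 2 * bump x ≤ M ^ 2 * I := by
    have : ∫ x, ev P x * p x * bump x ≤
        ∫ x, (1 / 2 * (M ^ 2 * bump x) + 1 / 2 * (p x ^ 2 * bump x)) := by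
      refine integral_mono (integrable_mul_bump (hcP.fun_mul hcp))
        (((integrable_mul_bump continuous_const).const_mul _).add
          ((integrable_mul_bump (hcp.fun_pow 2)).const_mul _)) fun x => ?_
      rcases le_total 1 ‖x‖ with hx | hx
      · simp [bump_eq_zero hx]
      · have h3 : ev P x ^ 2 ≤ M ^ 2 := sq_le_sq' (abs_le.1 (hM x hx)).1 (abs_le.1 (hM x hx)).2
        have : ev P x * p x ≤ 1 / 2 * M ^ 2 + 1 / 2 * p x ^ 2 := by
          nlinarith [sq_nonneg (ev P x - p x)]
        calc ev P x * p x * bump x ≤ (1 / 2 * M ^ 2 + 1 / 2 * p x ^ 2) * bump x :=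
              mul_le_mul_of_nonneg_right this (bump_nonneg x)
          _ = _ := by ring
    rw [integral_add ((integrable_mul_bump continuous_const).const_mul _)
          ((integrable_mul_bump (hcp.fun_pow 2)).const_mul _), integral_const_mul, integral_const_mul,
          integral_const_mul, ← h1] at this
    linarith
  have h3 := hC _ (polyLap_homogeneousComponent hP k) a ha
  have h4 : p a ^ 2 ≤ (√(C * I) * M) ^ 2 := by
    rw [mul_pow, Real.sq_sqrt (by positivity)]
    calc p a ^ 2 ≤ C * ∫ x, p x ^ 2 * bump x := h3
      _ ≤ C * (M ^ 2 * I) := mul_le_mul_of_nonneg_left h2 hC0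
      _ = _ := by ring
  exact abs_le_of_sq_le_sq h4 (by positivity)

/-! ### The maximum principle -/

theorem deriv_deriv_nonpos_of_isLocalMax {g : ℝ → ℝ} {x : ℝ} (hg : ContinuousAt g x)
    (h : IsLocalMax g x) : deriv (deriv g) x ≤ 0 := by
  by_contra! hpos
  have hmin := isLocalMin_of_deriv_deriv_pos hpos h.deriv_eq_zero hg
  have heq : g =ᶠ[𝓝 x] fun _ => g x := by
    filter_upwards [h, hmin] with y h1 h2 using le_antisymm h1 h2
  have : deriv (deriv g) x = 0 := by
    rw [heq.deriv.deriv_eq]; simp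
  linarith

theorem laplacian_nonpos_of_isLocalMax {v : E n → ℝ} {x : E n} (hv : ContDiffAt ℝ 2 v x)
    (h : IsLocalMax v x) : Laplacian.laplacian v x ≤ 0 := by
  rw [laplacian_eq_sum_pd hv]
  refine Finset.sum_nonpos fun i _ => ?_
  set e : E n := EuclideanSpace.single i 1 with he
  have hl : ∀ τ : ℝ, HasDerivAt (fun τ : ℝ => x + τ • e) e τ := fun τ => by
    simpa using ((hasDerivAt_id τ).smul_const e).const_add x
  have hlc : Tendsto (fun τ : ℝ => x + τ • e) (𝓝 0) (𝓝 x) := by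
    have := (hl 0).continuousAt.tendsto; simpa using this
  have hd : ∀ᶠ y in 𝓝 x, DifferentiableAt ℝ v y :=
    (hv.eventually (by simp)).mono fun y hy => hy.differentiableAt (by norm_num)
  have h1 : deriv (fun τ : ℝ => v (x + τ • e)) =ᶠ[𝓝 0] fun τ => pd i v (x + τ • e) := by
    filter_upwards [hlc.eventually hd] with τ hτ
    exact (hτ.hasFDerivAt.comp_hasDerivAt τ (hl τ)).deriv
  have hd2 : DifferentiableAt ℝ (pd i v) (x + (0 : ℝ) • e) := by
    have : DifferentiableAt ℝ (fderiv ℝ v) x :=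
      (hv.fderiv_right (m := 1) (by norm_num)).differentiableAt (by norm_num)
    simp only [zero_smul, add_zero]
    exact this.clm_apply (by fun_prop)
  have h2 : deriv (deriv fun τ : ℝ => v (x + τ • e)) 0 = pd i (pd i v) x := by
    rw [h1.deriv_eq]
    refine (hd2.hasFDerivAt.comp_hasDerivAt 0 (hl 0)).deriv.trans ?_
    simp [pd, e]
  rw [← h2]
  refine deriv_deriv_nonpos_of_isLocalMax ?_ ?_
  · have := hv.continuousAt
    exact ContinuousAt.comp (g := v) (by simpa using this) (hl 0).continuousAt
  · have : ∀ᶠ τ in 𝓝 (0 : ℝ), v (x + τ • e) ≤ v x := hlc.eventually h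
    simpa [IsLocalMax, IsMaxFilter] using this

/-- The polynomial `|x|²`. -/
def normSqPoly (n : ℕ) : MvPolynomial (Fin n) ℝ := ∑ i, MvPolynomial.X i ^ 2

theorem ev_normSqPoly (x : E n) : ev (normSqPoly n) x = ‖x‖ ^ 2 := by
  rw [EuclideanSpace.real_norm_sq_eq, normSqPoly]
  simp [pow_two]

theorem polyLap_normSqPoly : polyLap (normSqPoly n) = MvPolynomial.C (2 * n : ℝ) := by
  have : ∀ i, MvPolynomial.pderiv i (normSqPoly n) = MvPolynomial.C 2 * MvPolynomial.X i := by
    intro i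
    simp only [normSqPoly, map_sum, MvPolynomial.pderiv_pow]
    rw [Finset.sum_eq_single i]
    · simp; rfl
    · intro j _ hj; simp [MvPolynomial.pderiv_X_of_ne hj]
    · simp
  rw [polyLap_apply]
  simp only [this, Derivation.leibniz, MvPolynomial.pderiv_X_self, MvPolynomial.pderiv_C, mul_zero,
    smul_eq_mul, mul_one, add_zero, Finset.sum_const, Finset.card_univ, Fintype.card_fin, nsmul_eq_mul]
  rw [mul_comm, MvPolynomial.C_mul, map_natCast]

/-- The maximum principle: adding `ε |x|²` makes the Laplacian positive, which excludes interior
maxima. -/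
theorem le_of_harmonicOnNhd_of_le_sphere (hn : 0 < n) {u : E n → ℝ} {M : ℝ}
    (hc : ContinuousOn u (Metric.closedBall 0 1)) (hu : InnerProductSpace.HarmonicOnNhd u (B n))
    (hM : ∀ x, ‖x‖ = 1 → u x ≤ M) {x : E n} (hx : ‖x‖ ≤ 1) : u x ≤ M := by
  refine le_of_forall_pos_le_add fun ε hε => ?_
  have hv : ContinuousOn (fun y => u y + ε • ev (normSqPoly n) y) (Metric.closedBall 0 1) :=
    hc.add ((ev_continuous _).const_smul ε).continuousOn
  obtain ⟨x₀, hx₀, hmax⟩ := (isCompact_closedBall (0 : E n) 1).exists_isMaxOn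
    ⟨0, by simp⟩ hv
  have hx₀' : ‖x₀‖ ≤ 1 := by simpa using hx₀
  have hx₁ : ‖x₀‖ = 1 := by
    refine hx₀'.antisymm (not_lt.1 fun hlt => ?_)
    have hb : x₀ ∈ B n := by simpa using hlt
    have hloc : IsLocalMax (fun y => u y + ε • ev (normSqPoly n) y) x₀ :=
      hmax.isLocalMax (mem_of_superset (Metric.isOpen_ball.mem_nhds hb) Metric.ball_subset_closedBall)
    have hs2 : ContDiffAt ℝ 2 (ev (normSqPoly n)) x₀ := by
      exact_mod_cast (ev_contDiff _ 2).contDiffAt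
    have h1 : ContDiffAt ℝ 2 u x₀ := (hu x₀ hb).1
    have h2 := laplacian_nonpos_of_isLocalMax (h1.add (hs2.const_smul ε)) hloc
    have h3 : Laplacian.laplacian (u + ε • ev (normSqPoly n)) x₀ ≤ 0 := h2
    rw [h1.laplacian_add (f₂ := ε • ev (normSqPoly n)) (hs2.const_smul ε), InnerProductSpace.laplacian_smul ε hs2,
      (hu x₀ hb).2.self_of_nhds, laplacian_ev, polyLap_normSqPoly, ev_C, Pi.zero_apply, zero_add, smul_eq_mul] at h3
    have : (0 : ℝ) < n := by exact_mod_cast hn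
    nlinarith
  have h4 := hmax (show x ∈ Metric.closedBall (0 : E n) 1 by simpa using hx)
  simp only [Set.mem_ofPred_eq, ev_normSqPoly, hx₁, smul_eq_mul, one_pow, mul_one] at h4
  have := hM x₀ hx₁
  nlinarith [sq_nonneg ‖x‖]

theorem abs_le_of_harmonicOnNhd_of_abs_le_sphere (hn : 0 < n) {u : E n → ℝ} {M : ℝ}
    (hc : ContinuousOn u (Metric.closedBall 0 1)) (hu : InnerProductSpace.HarmonicOnNhd u (B n))
    (hM : ∀ x, ‖x‖ = 1 → |u x| ≤ M) {x : E n} (hx : ‖x‖ ≤ 1) : |u x| ≤ M := by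
  refine abs_le'.2 ⟨le_of_harmonicOnNhd_of_le_sphere hn hc hu (fun y hy => (abs_le'.1 (hM y hy)).1) hx,
    le_of_harmonicOnNhd_of_le_sphere hn hc.neg hu.neg (fun y hy => (abs_le'.1 (hM y hy)).2) hx⟩

theorem totalDegree_pderiv_le (i : Fin n) (P : MvPolynomial (Fin n) ℝ) :
    (MvPolynomial.pderiv i P).totalDegree ≤ P.totalDegree - 1 := by
  refine Finset.sup_le fun m hm => ?_
  have h1 : m + Finsupp.single i 1 ∈ P.support := by
    rw [MvPolynomial.mem_support_iff] at hm ⊢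
    rw [MvPolynomial.coeff_pderiv] at hm
    exact left_ne_zero_of_mul hm
  have h2 := MvPolynomial.le_totalDegree h1
  rw [Finsupp.sum_add_index' (by simp) (by simp)] at h2
  simp at h2
  omega

/-! ### Approximation by harmonic polynomials and homogeneous expansions -/

/-- Every polynomial agrees on the unit sphere with a harmonic polynomial: by the maximum principle
the map `Q ↦ Δ((1 - |x|²) Q)` is injective on the polynomials of degree at most `m`, a finite
dimensional space that it preserves, so it is surjective and `P` can be corrected by a multiple of
`1 - |x|²`. -/
theorem exists_harmonic_eq_on_sphere (hn : 0 < n) (P : MvPolynomial (Fin n) ℝ) :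
    ∃ H : MvPolynomial (Fin n) ℝ, polyLap H = 0 ∧ ∀ x : E n, ‖x‖ = 1 → ev H x = ev P x := by
  set m := P.totalDegree
  set S : MvPolynomial (Fin n) ℝ := 1 - normSqPoly n with hS
  have hevS : ∀ x : E n, ev S x = 1 - ‖x‖ ^ 2 := fun x => by
    rw [hS, ev_sub, ev_one, ev_normSqPoly]
  let V := MvPolynomial.restrictTotalDegree (Fin n) ℝ m
  let T : MvPolynomial (Fin n) ℝ →ₗ[ℝ] MvPolynomial (Fin n) ℝ := polyLap ∘ₗ LinearMap.mulLeft ℝ S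
  have hlap : ∀ (Q : MvPolynomial (Fin n) ℝ) d, Q.totalDegree ≤ d + 2 →
      (polyLap Q).totalDegree ≤ d := by
    intro Q d hd
    rw [polyLap_apply]
    refine MvPolynomial.totalDegree_finsetSum_le fun i _ => ?_
    have h1 := totalDegree_pderiv_le i (MvPolynomial.pderiv i Q)
    have h2 := totalDegree_pderiv_le i Q
    omega
  have hSdeg : S.totalDegree ≤ 2 := by
    refine (MvPolynomial.totalDegree_sub _ _).trans (max_le (by simp) ?_)
    exact MvPolynomial.totalDegree_finsetSum_le fun i _ => by simp
  have hT : ∀ Q ∈ V, T Q ∈ V := by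
    intro Q hQ
    rw [MvPolynomial.mem_restrictTotalDegree] at hQ ⊢
    refine hlap _ _ ((MvPolynomial.totalDegree_mul _ _).trans ?_)
    omega
  have hinj : Function.Injective (T.restrict hT) := by
    rw [← LinearMap.ker_eq_bot, LinearMap.ker_eq_bot']
    rintro ⟨Q, hQ⟩ h
    have h0 : polyLap (S * Q) = 0 := congrArg Subtype.val h
    have hz : ∀ x : E n, ‖x‖ ≤ 1 → ev (S * Q) x = 0 := fun x hx => by
      have := abs_le_of_harmonicOnNhd_of_abs_le_sphere hn (M := 0) (ev_continuous _).continuousOn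
        (((harmonicOnNhd_ev_iff _).2 h0).mono (Set.subset_univ _))
        (fun y hy => by simp [hevS, hy]) hx
      exact abs_nonpos_iff.1 this
    have hz' : ∀ x : E n, ‖x‖ < 1 → ev Q x = 0 := fun x hx => by
      have := hz x hx.le
      rw [ev_mul, hevS] at this
      refine (mul_eq_zero.1 this).resolve_left ?_
      nlinarith [norm_nonneg x]
    have hn' : (0 : ℝ) < n := by exact_mod_cast hn
    -- `Q` vanishes on the ball, hence on a cube
    refine Subtype.ext (MvPolynomial.funext_set (fun _ => Set.Ioo 0 ((n : ℝ)⁻¹))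
      (fun _ => Set.Ioo_infinite (inv_pos.2 hn')) fun x hx => ?_)
    have hx' : ∀ i, x i ∈ Set.Ioo 0 ((n : ℝ)⁻¹) := fun i => hx i trivial
    have hlt : ‖(WithLp.toLp 2 x : E n)‖ < 1 := by
      rw [← sq_lt_one_iff₀ (norm_nonneg _), EuclideanSpace.real_norm_sq_eq]
      have : NeZero n := ⟨hn.ne'⟩
      calc ∑ i, x i ^ 2 < ∑ _i : Fin n, (n : ℝ)⁻¹ := by
            refine Finset.sum_lt_sum_of_nonempty Finset.univ_nonempty fun i _ => ?_
            obtain ⟨h0, h1⟩ := hx' i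
            have : (n : ℝ)⁻¹ ≤ 1 := inv_le_one_of_one_le₀ (by exact_mod_cast hn)
            nlinarith
        _ = 1 := by simp [hn'.ne']
    simpa [ev] using hz' _ hlt
  have hsurj := LinearMap.injective_iff_surjective.1 hinj
  obtain ⟨⟨Q, hQ⟩, hQP⟩ := hsurj ⟨polyLap P, (MvPolynomial.mem_restrictTotalDegree _ _ _).2
    (hlap P m (Nat.le_add_right _ _))⟩
  have hQP' : polyLap (S * Q) = polyLap P := congrArg Subtype.val hQP
  refine ⟨P - S * Q, by rw [map_sub, hQP', sub_self], fun x hx => ?_⟩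
  simp [hevS, hx]

/-- A function harmonic in the ball and continuous up to the sphere is a uniform limit of harmonic
polynomials, by the Stone-Weierstrass theorem on the sphere and the maximum principle. -/
theorem exists_harmonic_near (hn : 0 < n) {f : E n → ℝ}
    (hc : ContinuousOn f (Metric.closedBall 0 1)) (hf : InnerProductSpace.HarmonicOnNhd f (B n))
    {ε : ℝ} (hε : 0 < ε) : ∃ H : MvPolynomial (Fin n) ℝ, polyLap H = 0 ∧
      ∀ x : E n, ‖x‖ ≤ 1 → |ev H x - f x| ≤ ε := by
  let Φ : MvPolynomial (Fin n) ℝ →ₐ[ℝ] C(Metric.sphere (0 : E n) 1, ℝ) :=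
    MvPolynomial.aeval fun i => ⟨fun x => x.1 i, by fun_prop⟩
  have hΦ : ∀ P x, Φ P x = ev P x.1 := by
    intro P x
    have : (ContinuousMap.evalAlgHom ℝ ℝ x).comp Φ = MvPolynomial.aeval fun i => x.1 i := by
      ext i; simp [Φ]
    exact AlgHom.congr_fun this P
  have hsep : Φ.range.SeparatesPoints := by
    intro x y hxy
    obtain ⟨i, hi⟩ : ∃ i, x.1 i ≠ y.1 i := by
      by_contra! h
      exact hxy (Subtype.ext (PiLp.ext h))
    exact ⟨_, ⟨Φ (MvPolynomial.X i), ⟨_, rfl⟩, rfl⟩, by simpa [hΦ] using hi⟩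
  have hcs : Continuous fun x : Metric.sphere (0 : E n) 1 => f x.1 :=
    hc.comp_continuous continuous_subtype_val fun x => Metric.sphere_subset_closedBall x.2
  obtain ⟨⟨_, P, rfl⟩, hP⟩ := ContinuousMap.exists_mem_subalgebra_near_continuous_of_separatesPoints
    Φ.range hsep _ hcs ε hε
  obtain ⟨H, hH, hHP⟩ := exists_harmonic_eq_on_sphere hn P
  refine ⟨H, hH, fun x hx => ?_⟩
  refine abs_le_of_harmonicOnNhd_of_abs_le_sphere hn (u := ev H - f) ((ev_continuous H).continuousOn.sub hc)
    ((((harmonicOnNhd_ev_iff H).2 hH).mono (Set.subset_univ _)).sub hf) (fun y hy => ?_) hx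
  have := hP ⟨y, by simpa using hy⟩
  rw [Pi.sub_apply, hHP y hy]
  exact (by simpa [hΦ] using this : |ev P y - f y| < ε).le

/-- A bound, on the closed ball of radius `r < 1`, of the homogeneous components of a harmonic
function that is bounded by `1` on the unit ball. The value for `1 ≤ r` is irrelevant. -/
def compConst (n : ℕ) (r : ℝ) : ℝ :=
  if h : r < 1 then (exists_homogeneousComponent_bound n h).choose else 0

theorem compConst_nonneg (n : ℕ) (r : ℝ) : 0 ≤ compConst n r := by
  unfold compConst
  split_ifs with h
  · exact (exists_homogeneousComponent_bound n h).choose_spec.1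
  · exact le_rfl

theorem abs_homogeneousComponent_le {r : ℝ} (hr : r < 1) {P : MvPolynomial (Fin n) ℝ}
    (hP : polyLap P = 0) {M : ℝ} (hM : ∀ x : E n, ‖x‖ ≤ 1 → |ev P x| ≤ M) (k : ℕ) {a : E n}
    (ha : ‖a‖ ≤ r) : |ev (MvPolynomial.homogeneousComponent k P) a| ≤ compConst n r * M := by
  rw [compConst, dif_pos hr]
  exact (exists_homogeneousComponent_bound n hr).choose_spec.2 P hP M hM k a ha

/-- Homogeneous functions that are locally bounded on the unit ball decay geometrically there. -/
theorem exists_geometric_bound {F : Type*} [NormedAddCommGroup F] [NormedSpace ℝ F]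
    {r : ℝ} (hr0 : 0 ≤ r) (hr : r < 1) : ∃ r' θ : ℝ, 0 ≤ r' ∧ r' < 1 ∧ 0 < θ ∧ θ < 1 ∧
      ∀ (k : ℕ) (p : E n → F) (C : ℝ), (∀ (c : ℝ) x, p (c • x) = c ^ k • p x) →
        (∀ a, ‖a‖ ≤ r' → ‖p a‖ ≤ C) → ∀ a, ‖a‖ ≤ r → ‖p a‖ ≤ C * θ ^ k := by
  have hθ : 0 < (1 + r) / 2 := by linarith
  refine ⟨r / ((1 + r) / 2), (1 + r) / 2, by positivity, by rw [div_lt_one hθ]; linarith, hθ,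
    by linarith, fun k p C hp hC a ha => ?_⟩
  have h1 : a = ((1 + r) / 2) • (((1 + r) / 2)⁻¹ • a) := by
    rw [smul_smul, mul_inv_cancel₀ hθ.ne', one_smul]
  rw [h1, hp, norm_smul, norm_pow, Real.norm_of_nonneg hθ.le, mul_comm]
  refine mul_le_mul_of_nonneg_right (hC _ ?_) (by positivity)
  rw [norm_smul, norm_inv, Real.norm_of_nonneg hθ.le, inv_mul_eq_div]
  gcongr

/-- The expansion of a harmonic function in homogeneous harmonic polynomials: these are the limits
of the homogeneous components of approximating harmonic polynomials. -/
theorem exists_harmonic_expansion (hn : 0 < n) {f : E n → ℝ}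
    (hc : ContinuousOn f (Metric.closedBall 0 1)) (hf : InnerProductSpace.HarmonicOnNhd f (B n)) :
    ∃ p : ℕ → E n → ℝ, (∀ k, p k ∈ harmonicPoly n k) ∧
      (∀ r < 1, ∀ M, (∀ x : E n, ‖x‖ ≤ 1 → |f x| ≤ M) → ∀ k a, ‖a‖ ≤ r →
        |p k a| ≤ compConst n r * M) ∧
      ∀ x ∈ B n, HasSum (fun k => p k x) (f x) := by
  choose H hH hHf using fun j : ℕ => exists_harmonic_near hn hc hf (ε := 1 / ((j : ℝ) + 1)) (by positivity)
  have htend : Tendsto (fun j : ℕ => 1 / ((j : ℝ) + 1)) atTop (𝓝 0) :=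
    tendsto_one_div_add_atTop_nhds_zero_nat
  set q : ℕ → ℕ → E n → ℝ := fun j k => ev (MvPolynomial.homogeneousComponent k (H j)) with hq
  have hqm : ∀ j k, q j k ∈ harmonicPoly n k := fun j k => ev_homogeneousComponent_mem (hH j) k
  have hcauchy0 : ∀ k a, ‖a‖ ≤ 1 / 2 → CauchySeq fun j => q j k a := by
    intro k a ha
    refine cauchySeq_of_le_tendsto_0 (fun N : ℕ => compConst n (1 / 2) * (2 * (1 / ((N : ℝ) + 1))))
      (fun i j N hi hj => ?_) (by simpa using (htend.const_mul 2).const_mul (compConst n (1 / 2)))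
    have hij : polyLap (H i - H j) = 0 := by rw [map_sub, hH, hH, sub_zero]
    have h1 : ∀ l : ℕ, N ≤ l → 1 / ((l : ℝ) + 1) ≤ 1 / ((N : ℝ) + 1) := fun l hl => by gcongr
    have := abs_homogeneousComponent_le (r := 1 / 2) (by norm_num) hij
      (M := 2 * (1 / ((N : ℝ) + 1))) (fun x hx => ?_) k ha
    · rw [map_sub, ev_sub] at this
      exact this
    · rw [ev_sub]
      have h2 := (hHf i x hx).trans (h1 i hi)
      have h3 := (hHf j x hx).trans (h1 j hj)
      rw [abs_le] at h2 h3 ⊢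
      constructor <;> linarith
  have hlim : ∀ k a, ∃ l, Tendsto (fun j => q j k a) atTop (𝓝 l) := by
    intro k a
    have hc0 : (0 : ℝ) < 2 * (‖a‖ + 1) := by positivity
    obtain ⟨l, hl⟩ := cauchySeq_tendsto_of_complete (hcauchy0 k ((2 * (‖a‖ + 1))⁻¹ • a) (by
      rw [norm_smul, norm_inv, Real.norm_of_nonneg hc0.le, inv_mul_eq_div, div_le_div_iff₀ hc0 two_pos]
      linarith))
    refine ⟨(2 * (‖a‖ + 1)) ^ k * l, (hl.const_mul _).congr fun j => ?_⟩
    rw [← harmonicPoly_smul (hqm j k), smul_smul, mul_inv_cancel₀ hc0.ne', one_smul]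
  choose p hp using hlim
  have hqbound : ∀ j k, ∀ r < 1, ∀ M, (∀ x : E n, ‖x‖ ≤ 1 → |f x| ≤ M) → ∀ a, ‖a‖ ≤ r →
      |q j k a| ≤ compConst n r * (M + 1 / ((j : ℝ) + 1)) := by
    intro j k r hr M hM a ha
    refine abs_homogeneousComponent_le hr (hH j) (fun x hx => ?_) k ha
    have h2 := hHf j x hx
    have h3 := hM x hx
    rw [abs_le] at h2 h3 ⊢
    constructor <;> linarith
  refine ⟨p, fun k => ?_, fun r hr M hM k a ha => ?_, fun x hx => ?_⟩
  · exact (Submodule.closed_of_finiteDimensional (harmonicPoly n k)).mem_of_tendsto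
      (tendsto_pi_nhds.2 (hp k)) (Eventually.of_forall fun j => hqm j k)
  · refine le_of_tendsto_of_tendsto' (hp k a).abs (b := atTop)
      (g := fun j : ℕ => compConst n r * (M + 1 / ((j : ℝ) + 1))) ?_
      fun j => hqbound j k r hr M hM a ha
    simpa using (htend.const_add M).const_mul (compConst n r)
  · have hx1 : ‖x‖ < 1 := by simpa using hx
    obtain ⟨M, hM⟩ := (isCompact_closedBall (0 : E n) 1).exists_bound_of_continuousOn hc
    have hM' : ∀ x : E n, ‖x‖ ≤ 1 → |f x| ≤ M := fun x hx => hM x (by simpa using hx)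
    obtain ⟨r', θ, -, hr', hθ0, hθ1, hgeo⟩ := exists_geometric_bound (n := n) (F := ℝ) (norm_nonneg x) hx1
    have hb : ∀ j k, ‖q j k x‖ ≤ compConst n r' * (M + 1) * θ ^ k := by
      intro j k
      refine hgeo k (q j k) _ (fun c y => harmonicPoly_smul (hqm j k) c y) (fun a ha => ?_) x le_rfl
      refine (hqbound j k r' hr' M hM' a ha).trans ?_
      refine mul_le_mul_of_nonneg_left ?_ (compConst_nonneg _ _)
      gcongr
      rw [div_le_one (by positivity)]
      linarith [(Nat.cast_nonneg j : (0 : ℝ) ≤ j)]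
    have hsum : Summable fun k => compConst n r' * (M + 1) * θ ^ k :=
      (summable_geometric_of_lt_one hθ0.le hθ1).mul_left _
    have hpb : ∀ k, ‖p k x‖ ≤ compConst n r' * (M + 1) * θ ^ k := fun k =>
      le_of_tendsto' (hp k x).norm fun j => hb j k
    have h1 : Tendsto (fun j => ∑' k, q j k x) atTop (𝓝 (∑' k, p k x)) :=
      tendsto_tsum_of_dominated_convergence hsum (fun k => hp k x)
        (Eventually.of_forall fun j k => hb j k)
    have h2 : ∀ j, ∑' k, q j k x = ev (H j) x := by
      intro j
      rw [ev_eq_sum_homogeneousComponent]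
      refine tsum_eq_sum fun k hk => ?_
      simp only [hq]
      rw [MvPolynomial.homogeneousComponent_eq_zero _ _ (by simpa using hk), ev_zero]
    simp_rw [h2] at h1
    have h3 : Tendsto (fun j => ev (H j) x) atTop (𝓝 (f x)) := by
      rw [tendsto_iff_dist_tendsto_zero]
      exact squeeze_zero (fun _ => dist_nonneg) (fun j => hHf j x hx1.le) htend
    rw [tendsto_nhds_unique h3 h1]
    exact (Summable.of_norm_bounded hsum hpb).hasSum

/-! ### Series of homogeneous harmonic polynomials -/

/-- The gradient estimate for harmonic polynomials. -/
theorem abs_pd_le {P : MvPolynomial (Fin n) ℝ} (hP : polyLap P = 0) {a : E n} {δ M : ℝ}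
    (hδ : 0 < δ) (hM : ∀ x : E n, ‖x‖ ≤ ‖a‖ + δ → |ev P x| ≤ M) (i : Fin n) :
    |pd i (ev P) a| ≤ 2 / δ * compConst n (1 / 2) * M := by
  obtain ⟨Q, hQ, hQP⟩ := exists_harmonic_comp_affine hP a δ
  have h1 : δ * pd i (ev P) a = pd i (ev Q) 0 := by
    rw [show ev Q = fun x => ev P (a + δ • x) from funext hQP, pd_comp_affine]
    simp
  -- the linear part of `Q` has the derivatives of `Q` at the origin as its coefficients
  have h2 : pd i (ev (MvPolynomial.homogeneousComponent 1 Q)) = fun _ => pd i (ev Q) 0 := by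
    rw [pd_ev, pd_ev, pderiv_homogeneousComponent]
    ext x
    rw [MvPolynomial.homogeneousComponent_zero, ev_C, ev, ← MvPolynomial.constantCoeff_eq]
    exact (RingHom.congr_fun MvPolynomial.eval_zero _).symm
  have h3 : 1 / 2 * pd i (ev Q) 0 =
      ev (MvPolynomial.homogeneousComponent 1 Q) (EuclideanSpace.single i (1 / 2)) := by
    have := sum_mul_pd (ev_homogeneousComponent_mem hQ 1) (EuclideanSpace.single i (1 / 2))
    rw [Finset.sum_eq_single i] at this
    · simpa [h2] using this
    · intro j _ hj; simp [hj]
    · simp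
  have h4 := abs_homogeneousComponent_le (r := 1 / 2) (by norm_num) hQ (M := M) (fun x hx => by
    rw [hQP]
    refine hM _ ((norm_add_le _ _).trans ?_)
    rw [norm_smul, Real.norm_of_nonneg hδ.le]
    nlinarith) 1 (a := EuclideanSpace.single i (1 / 2)) (by simp)
  rw [← h3, ← h1, abs_mul, abs_mul, abs_of_pos hδ, abs_of_pos (by norm_num : (0 : ℝ) < 1 / 2)] at h4
  have : |pd i (ev P) a| = 2 / δ * (1 / 2 * (δ * |pd i (ev P) a|)) := by field_simp
  rw [this, mul_assoc (2 / δ)]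
  gcongr

/-- The series of the functions `u k` converges absolutely, uniformly on compact subsets of the
unit ball. -/
def LocallyNormallySummable {F : Type*} [NormedAddCommGroup F] (u : ℕ → E n → F) : Prop :=
  ∀ r < 1, ∃ M : ℕ → ℝ, Summable M ∧ ∀ k x, ‖x‖ ≤ r → ‖u k x‖ ≤ M k

theorem LocallyNormallySummable.pd {u : ℕ → E n → ℝ} {d : ℕ → ℕ}
    (hu : ∀ k, u k ∈ harmonicPoly n (d k)) (h : LocallyNormallySummable u) (i : Fin n) :
    LocallyNormallySummable fun k => pd i (u k) := by
  intro r hr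
  obtain ⟨M, hM, hMu⟩ := h ((1 + r) / 2) (by linarith)
  refine ⟨fun k => 2 / ((1 - r) / 2) * compConst n (1 / 2) * M k, hM.mul_left _, fun k x hx => ?_⟩
  obtain ⟨P, -, hP, hPu⟩ := mem_harmonicPoly_iff.1 (hu k)
  change ‖HarmonicBloch.pd i (u k) x‖ ≤ _
  rw [hPu]
  exact abs_pd_le hP (by linarith) (fun y hy => by
    rw [← hPu]; exact hMu k y (by linarith)) i

theorem LocallyNormallySummable.summable {F : Type*} [NormedAddCommGroup F] [CompleteSpace F]
    {u : ℕ → E n → F} (h : LocallyNormallySummable u) {x : E n} (hx : x ∈ B n) :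
    Summable fun k => u k x := by
  obtain ⟨M, hM, hMu⟩ := h ‖x‖ (by simpa using hx)
  exact Summable.of_norm_bounded hM fun k => hMu k x le_rfl

theorem LocallyNormallySummable.hasFDerivAt_tsum {u : ℕ → E n → ℝ} {d : ℕ → ℕ}
    (hu : ∀ k, u k ∈ harmonicPoly n (d k)) (h : LocallyNormallySummable u) {x : E n}
    (hx : x ∈ B n) : HasFDerivAt (fun y => ∑' k, u k y)
      (∑ i, (∑' k, HarmonicBloch.pd i (u k) x) • (EuclideanSpace.proj i : E n →L[ℝ] ℝ)) x := by
  have hx1 : ‖x‖ < 1 := by simpa using hx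
  obtain ⟨r, hxr, hr⟩ := exists_between hx1
  have hf : ∀ k y, HasFDerivAt (u k)
      (∑ i, HarmonicBloch.pd i (u k) y • (EuclideanSpace.proj i : E n →L[ℝ] ℝ)) y := by
    intro k y
    obtain ⟨P, -, -, hPu⟩ := mem_harmonicPoly_iff.1 (hu k)
    simp_rw [hPu, pd_ev]
    exact hasFDerivAt_ev P y
  choose M hM hMu using fun i => h.pd hu i r hr
  have key := hasFDerivAt_tsum_of_isPreconnected (f := u) (s := Metric.ball (0 : E n) r)
    (u := fun k => ∑ i, M i k * ‖(EuclideanSpace.proj i : E n →L[ℝ] ℝ)‖)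
    (summable_sum fun i _ => (hM i).mul_right _) Metric.isOpen_ball
    (convex_ball _ _).isPreconnected (fun k y _ => hf k y) (fun k y hy => ?_)
    (x₀ := x) (by simpa using hxr) (h.summable hx) (x := x) (by simpa using hxr)
  · refine key.congr_fderiv ?_
    rw [Summable.tsum_finsetSum]
    · refine Finset.sum_congr rfl fun i _ => ?_
      exact ((h.pd hu i).summable hx).tsum_smul_const _
    · exact fun i _ => ((h.pd hu i).summable hx).smul_const _
  · refine (norm_sum_le _ _).trans (Finset.sum_le_sum fun i _ => ?_)
    rw [norm_smul]
    have hy' : ‖y‖ ≤ r := by simpa using (Metric.mem_ball.1 hy).le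
    exact mul_le_mul_of_nonneg_right (hMu i k y hy') (norm_nonneg _)

theorem LocallyNormallySummable.pd_tsum {u : ℕ → E n → ℝ} {d : ℕ → ℕ}
    (hu : ∀ k, u k ∈ harmonicPoly n (d k)) (h : LocallyNormallySummable u) {x : E n}
    (hx : x ∈ B n) (i : Fin n) :
    HarmonicBloch.pd i (fun y => ∑' k, u k y) x = ∑' k, HarmonicBloch.pd i (u k) x := by
  rw [HarmonicBloch.pd, (h.hasFDerivAt_tsum hu hx).fderiv]
  simp

theorem LocallyNormallySummable.contDiffOn_tsum (m : ℕ) : ∀ {u : ℕ → E n → ℝ} {d : ℕ → ℕ},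
    (∀ k, u k ∈ harmonicPoly n (d k)) → LocallyNormallySummable u →
      ContDiffOn ℝ m (fun y => ∑' k, u k y) (B n) := by
  induction m with
  | zero =>
    intro u d hu h
    rw [Nat.cast_zero, contDiffOn_zero]
    exact fun x hx => (h.hasFDerivAt_tsum hu hx).continuousAt.continuousWithinAt
  | succ m ih =>
    intro u d hu h
    rw [Nat.cast_add, Nat.cast_one, contDiffOn_succ_iff_fderiv_of_isOpen Metric.isOpen_ball]
    refine ⟨fun x hx => (h.hasFDerivAt_tsum hu hx).differentiableAt.differentiableWithinAt,
      fun h => by simp at h, ?_⟩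
    have : ContDiffOn ℝ m (fun x => ∑ i, (∑' k, HarmonicBloch.pd i (u k) x) •
        (EuclideanSpace.proj i : E n →L[ℝ] ℝ)) (B n) :=
      ContDiffOn.sum fun i _ =>
        (ih (fun k => pd_mem_harmonicPoly (hu k) i) (h.pd hu i)).smul contDiffOn_const
    exact this.congr fun x hx => (h.hasFDerivAt_tsum hu hx).fderiv

theorem LocallyNormallySummable.harmonicOnNhd_tsum {u : ℕ → E n → ℝ} {d : ℕ → ℕ}
    (hu : ∀ k, u k ∈ harmonicPoly n (d k)) (h : LocallyNormallySummable u) :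
    InnerProductSpace.HarmonicOnNhd (fun y => ∑' k, u k y) (B n) := by
  have hc : ∀ x ∈ B n, ContDiffAt ℝ 2 (fun y => ∑' k, u k y) x := fun x hx =>
    (show ContDiffOn ℝ 2 _ _ by exact_mod_cast h.contDiffOn_tsum 2 hu).contDiffAt
      (Metric.isOpen_ball.mem_nhds hx)
  intro x hx
  refine ⟨hc x hx, ?_⟩
  filter_upwards [Metric.isOpen_ball.mem_nhds hx] with y hy
  rw [laplacian_eq_sum_pd (hc y hy)]
  have h1 : ∀ i, HarmonicBloch.pd i (HarmonicBloch.pd i fun y => ∑' k, u k y) y =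
      ∑' k, HarmonicBloch.pd i (HarmonicBloch.pd i (u k)) y := by
    intro i
    rw [← (h.pd hu i).pd_tsum (fun k => pd_mem_harmonicPoly (hu k) i) hy]
    have : HarmonicBloch.pd i (fun y => ∑' k, u k y) =ᶠ[𝓝 y]
        fun y => ∑' k, HarmonicBloch.pd i (u k) y := by
      filter_upwards [Metric.isOpen_ball.mem_nhds hy] with z hz using h.pd_tsum hu hz i
    simp only [HarmonicBloch.pd] at this ⊢
    rw [this.fderiv_eq]
  simp_rw [h1]
  rw [← Summable.tsum_finsetSum fun i _ =>
    ((h.pd hu i).pd (fun k => pd_mem_harmonicPoly (hu k) i) i).summable hy]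
  simp_rw [sum_pd_pd (hu _)]
  simp

/-! ### Expansions of complex-valued harmonic functions -/

/-- Complex-valued homogeneous harmonic polynomials of degree `k`. -/
def HPoly (k : ℕ) (p : E n → ℂ) : Prop :=
  (fun x => (p x).re) ∈ harmonicPoly n k ∧ (fun x => (p x).im) ∈ harmonicPoly n k

theorem HPoly.smul {k : ℕ} {p : E n → ℂ} (hp : HPoly k p) (c : ℝ) (x : E n) :
    p (c • x) = c ^ k • p x := by
  apply Complex.ext
  · rw [Complex.smul_re]; exact harmonicPoly_smul hp.1 c x
  · rw [Complex.smul_im]; exact harmonicPoly_smul hp.2 c x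

theorem HPoly.const_mul {k : ℕ} {p : E n → ℂ} (hp : HPoly k p) (c : ℂ) :
    HPoly k fun x => c * p x := by
  constructor
  · have := (harmonicPoly n k).sub_mem ((harmonicPoly n k).smul_mem c.re hp.1)
      ((harmonicPoly n k).smul_mem c.im hp.2)
    convert this using 1
    ext x; simp
  · have := (harmonicPoly n k).add_mem ((harmonicPoly n k).smul_mem c.re hp.2)
      ((harmonicPoly n k).smul_mem c.im hp.1)
    convert this using 1
    ext x; simp

theorem HPoly.sub {k : ℕ} {p q : E n → ℂ} (hp : HPoly k p) (hq : HPoly k q) :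
    HPoly k fun x => p x - q x :=
  ⟨(harmonicPoly n k).sub_mem hp.1 hq.1,
    (harmonicPoly n k).sub_mem hp.2 hq.2⟩

/-- On the unit ball, `f` is the sum of the homogeneous harmonic polynomials `p k` of degree `k`,
and the `p k` are locally bounded there, uniformly in `k`. -/
structure IsExpansion (f : E n → ℂ) (p : ℕ → E n → ℂ) : Prop where
  mem : ∀ k, HPoly k (p k)
  bound : ∀ r < 1, ∃ C : ℝ, ∀ k x, ‖x‖ ≤ r → ‖p k x‖ ≤ C
  hasSum : ∀ x ∈ B n, HasSum (fun k => p k x) (f x)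

theorem exists_geometric_bound_of_bound {p : ℕ → E n → ℂ} (hp : ∀ k, HPoly k (p k))
    (hb : ∀ r < 1, ∃ C : ℝ, ∀ k x, ‖x‖ ≤ r → ‖p k x‖ ≤ C) {r : ℝ} (hr : r < 1) :
    ∃ C θ : ℝ, 0 < C ∧ 0 < θ ∧ θ < 1 ∧ ∀ k x, ‖x‖ ≤ r → ‖p k x‖ ≤ C * θ ^ k := by
  by_cases hr0 : r < 0
  · exact ⟨1, 1 / 2, by norm_num, by norm_num, by norm_num, fun k x hx =>
      absurd ((norm_nonneg x).trans hx) (not_le.2 hr0)⟩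
  obtain ⟨r', θ, -, hr', hθ0, hθ1, hgeo⟩ := exists_geometric_bound (n := n) (F := ℂ) (not_lt.1 hr0) hr
  obtain ⟨C, hC⟩ := hb r' hr'
  refine ⟨max C 1, θ, by positivity, hθ0, hθ1, fun k x hx => ?_⟩
  exact hgeo k (p k) _ (fun c y => (hp k).smul c y)
    (fun a ha => (hC k a ha).trans (le_max_left _ _)) x hx

theorem IsExpansion.locallyNormallySummable {f : E n → ℂ} {p : ℕ → E n → ℂ}
    (h : IsExpansion f p) : LocallyNormallySummable p := by
  intro r hr
  obtain ⟨C, θ, -, h0, h1, hb⟩ := exists_geometric_bound_of_bound h.mem h.bound hr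
  exact ⟨_, (summable_geometric_of_lt_one h0.le h1).mul_left C, hb⟩

theorem isExpansion_tsum {p : ℕ → E n → ℂ} (hp : ∀ k, HPoly k (p k))
    (hb : ∀ r < 1, ∃ C : ℝ, ∀ k x, ‖x‖ ≤ r → ‖p k x‖ ≤ C) :
    IsExpansion (fun x => ∑' k, p k x) p := by
  refine ⟨hp, hb, fun x hx => Summable.hasSum ?_⟩
  obtain ⟨C, θ, -, h0, h1, hb⟩ := exists_geometric_bound_of_bound hp hb
    (r := ‖x‖) (by simpa using hx)
  exact Summable.of_norm_bounded ((summable_geometric_of_lt_one h0.le h1).mul_left C)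
    fun k => hb k x le_rfl

theorem IsExpansion.congr {f g : E n → ℂ} {p : ℕ → E n → ℂ} (h : IsExpansion f p)
    (hfg : ∀ x ∈ B n, f x = g x) : IsExpansion g p :=
  ⟨h.mem, h.bound, fun x hx => hfg x hx ▸ h.hasSum x hx⟩

theorem harm_congr {f g : E n → ℂ} (hf : f ∈ harm n) (hfg : ∀ x ∈ B n, f x = g x) : g ∈ harm n := by
  intro x hx
  refine (InnerProductSpace.harmonicAt_congr_nhds ?_).1 (hf x hx)
  filter_upwards [Metric.isOpen_ball.mem_nhds hx] with y hy using hfg y hy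

theorem IsExpansion.harm {f : E n → ℂ} {p : ℕ → E n → ℂ} (h : IsExpansion f p) : f ∈ harm n := by
  have hl := h.locallyNormallySummable
  have hre : LocallyNormallySummable fun k x => (p k x).re := fun r hr => by
    obtain ⟨M, hM, hb⟩ := hl r hr
    exact ⟨M, hM, fun k x hx => (Complex.abs_re_le_norm _).trans (hb k x hx)⟩
  have him : LocallyNormallySummable fun k x => (p k x).im := fun r hr => by
    obtain ⟨M, hM, hb⟩ := hl r hr
    exact ⟨M, hM, fun k x hx => (Complex.abs_im_le_norm _).trans (hb k x hx)⟩
  have h1 := (hre.harmonicOnNhd_tsum fun k => (h.mem k).1).comp_CLM Complex.ofRealCLM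
  have h2 := (him.harmonicOnNhd_tsum fun k => (h.mem k).2).comp_CLM
    (Complex.I • Complex.ofRealCLM)
  refine harm_congr (h1.add h2) fun x hx => ?_
  have hs := h.hasSum x hx
  apply Complex.ext
  · simp [(Complex.hasSum_re hs).tsum_eq]
  · simp [(Complex.hasSum_im hs).tsum_eq]

/-- The Taylor coefficients of a function of one real variable given by a power series. -/
theorem iteratedDeriv_of_hasSum {g : ℝ → ℂ} {a : ℕ → ℂ}
    (h : ∀ᶠ r in 𝓝 (0 : ℝ), HasSum (fun k => r ^ k • a k) (g r)) (k : ℕ) :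
    ((k.factorial : ℂ))⁻¹ * iteratedDeriv k g 0 = a k := by
  let P : FormalMultilinearSeries ℝ ℝ ℂ := fun k => ContinuousMultilinearMap.mkPiRing ℝ (Fin k) (a k)
  have hp : HasFPowerSeriesAt g P 0 := by
    refine hasFPowerSeriesAt_iff.2 ?_
    filter_upwards [h] with r hr
    simpa [FormalMultilinearSeries.coeff, P] using hr
  obtain ⟨ρ, hρ⟩ := hp
  have := hρ.factorial_smul 1 k
  rw [iteratedDeriv_eq_iteratedFDeriv, ← this]
  have hk : (k.factorial : ℂ) ≠ 0 := by exact_mod_cast k.factorial_ne_zero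
  simp [P]
  field_simp

theorem homPart_eq_of_hasSum {f : E n → ℂ} {x : E n} {a : ℕ → ℂ}
    (h : ∀ᶠ r in 𝓝 (0 : ℝ), HasSum (fun k => r ^ k • a k) (f (r • x))) (k : ℕ) :
    homPart f k x = a k := iteratedDeriv_of_hasSum h k

theorem eventually_smul_mem_ball (x : E n) : ∀ᶠ r in 𝓝 (0 : ℝ), r • x ∈ B n := by
  have : Tendsto (fun r : ℝ => r • x) (𝓝 0) (𝓝 ((0 : ℝ) • x)) :=
    Continuous.tendsto (by fun_prop) 0
  rw [zero_smul] at this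
  exact this.eventually (Metric.isOpen_ball.mem_nhds (by simp))

theorem IsExpansion.homPart {f : E n → ℂ} {p : ℕ → E n → ℂ} (h : IsExpansion f p) :
    homPart f = p := by
  ext k x
  refine homPart_eq_of_hasSum (a := fun k => p k x) ((eventually_smul_mem_ball x).mono fun r hr => ?_) k
  exact (h.hasSum _ hr).congr_fun fun k => ((h.mem k).smul r x).symm

theorem homPart_congr {f g : E n → ℂ} (hfg : ∀ x ∈ B n, f x = g x) : homPart f = homPart g := by
  ext k x
  rw [HarmonicBloch.homPart, HarmonicBloch.homPart]
  congr 1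
  refine Filter.EventuallyEq.iteratedDeriv_eq k ?_
  exact (eventually_smul_mem_ball x).mono fun r hr => hfg _ hr

/-- The expansion of a complex-valued harmonic function that is continuous on the closed ball, with
bounds for the homogeneous parts that are uniform in the degree. -/
theorem exists_isExpansion_of_closedBall (hn : 0 < n) {f : E n → ℂ}
    (hc : ContinuousOn f (Metric.closedBall 0 1)) (hf : f ∈ harm n) :
    IsExpansion f (homPart f) ∧ ∀ r < 1, ∀ M, (∀ x : E n, ‖x‖ ≤ 1 → ‖f x‖ ≤ M) → ∀ k a, ‖a‖ ≤ r →
      ‖homPart f k a‖ ≤ 2 * compConst n r * M := by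
  obtain ⟨p, hp, hpb, hps⟩ := exists_harmonic_expansion hn (f := fun x => (f x).re)
    (Complex.continuous_re.comp_continuousOn hc) (hf.comp_CLM Complex.reCLM)
  obtain ⟨q, hq, hqb, hqs⟩ := exists_harmonic_expansion hn (f := fun x => (f x).im)
    (Complex.continuous_im.comp_continuousOn hc) (hf.comp_CLM Complex.imCLM)
  have hb : ∀ r < 1, ∀ M, (∀ x : E n, ‖x‖ ≤ 1 → ‖f x‖ ≤ M) → ∀ k a, ‖a‖ ≤ r →
      ‖(⟨p k a, q k a⟩ : ℂ)‖ ≤ 2 * compConst n r * M := by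
    intro r hr M hM k a ha
    have h1 := hpb r hr M (fun x hx => (Complex.abs_re_le_norm _).trans (hM x hx)) k a ha
    have h2 := hqb r hr M (fun x hx => (Complex.abs_im_le_norm _).trans (hM x hx)) k a ha
    refine (Complex.norm_le_abs_re_add_abs_im _).trans ?_
    simp only
    linarith
  obtain ⟨M, hM⟩ := (isCompact_closedBall (0 : E n) 1).exists_bound_of_continuousOn hc
  have he : IsExpansion f fun k x => (⟨p k x, q k x⟩ : ℂ) :=
    ⟨fun k => ⟨hp k, hq k⟩, fun r hr => ⟨_, hb r hr M fun x hx => hM x (by simpa using hx)⟩,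
      fun x hx => (Complex.hasSum_iff _ _).2 ⟨hps x hx, hqs x hx⟩⟩
  rw [he.homPart]
  exact ⟨he, hb⟩

theorem homPart_comp_smul (f : E n → ℂ) (c : ℝ) (k : ℕ) (x : E n) :
    homPart (fun y => f (c • y)) k x = homPart f k (c • x) := by
  simp only [homPart, smul_comm c]

/-- A harmonic function on the unit ball is the sum of its homogeneous parts. Its dilations
`y ↦ f (c y)` with `c < 1` are harmonic up to the boundary, and `homPart` commutes with them. -/
theorem isExpansion_homPart (hn : 0 < n) {f : E n → ℂ} (hf : f ∈ harm n) :
    IsExpansion f (homPart f) := by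
  have key : ∀ c : ℝ, 0 < c → c < 1 → IsExpansion (fun y => f (c • y)) fun k x => homPart f k (c • x) := by
    intro c hc0 hc1
    have hmem : ∀ y : E n, ‖y‖ ≤ 1 → c • y ∈ B n := fun y hy => by
      rw [Metric.mem_ball, dist_zero_right, norm_smul, Real.norm_of_nonneg hc0.le]
      nlinarith [norm_nonneg y]
    have hh : ∀ y : E n, ‖y‖ ≤ 1 → InnerProductSpace.HarmonicAt (fun y => f (c • y)) y := fun y hy => by
      have := harmonicAt_comp_affine (a := 0) (f := f) (x := y) (c := c) (by
        rw [zero_add]; exact hf _ (hmem y hy))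
      simpa using this
    have := (exists_isExpansion_of_closedBall hn (f := fun y => f (c • y))
      (fun y hy => (hh y (by simpa using hy)).1.continuousAt.continuousWithinAt)
      (fun y hy => hh y (by simpa using (Metric.mem_ball.1 hy).le))).1
    simpa only [funext fun k => funext fun x => homPart_comp_smul f c k x] using this
  have hinv : ∀ (c : ℝ) (x : E n), 0 < c → c • (c⁻¹ • x) = x := fun c x hc => by
    rw [smul_smul, mul_inv_cancel₀ hc.ne', one_smul]
  refine ⟨fun k => ?_, fun r hr => ?_, fun x hx => ?_⟩
  · have h1 := key (1 / 2) (by norm_num) (by norm_num)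
    have h2 := (h1.mem k).const_mul ((1 / 2 : ℝ)⁻¹ ^ k : ℝ)
    convert h2 using 1
    ext x
    have := (h1.mem k).smul (1 / 2 : ℝ)⁻¹ x
    simp only [hinv (1 / 2) _ (by norm_num)] at this
    rw [this, Complex.real_smul]
  · by_cases hr0 : r < 0
    · exact ⟨0, fun k x hx => absurd ((norm_nonneg x).trans hx) (not_le.2 hr0)⟩
    have hc : 0 < (1 + r) / 2 := by linarith
    obtain ⟨C, hC⟩ := (key ((1 + r) / 2) hc (by linarith)).bound (r / ((1 + r) / 2))
      (by rw [div_lt_one hc]; linarith)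
    refine ⟨C, fun k x hx => ?_⟩
    have := hC k (((1 + r) / 2)⁻¹ • x) (by
      rw [norm_smul, norm_inv, Real.norm_of_nonneg hc.le, inv_mul_eq_div]; gcongr)
    rwa [hinv _ _ hc] at this
  · have hx1 : ‖x‖ < 1 := by simpa using hx
    have hc : 0 < (1 + ‖x‖) / 2 := by positivity
    have := (key ((1 + ‖x‖) / 2) hc (by linarith)).hasSum (((1 + ‖x‖) / 2)⁻¹ • x) (by
      rw [Metric.mem_ball, dist_zero_right, norm_smul, norm_inv, Real.norm_of_nonneg hc.le,
        inv_mul_eq_div, div_lt_one hc]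
      linarith)
    simpa only [hinv _ _ hc] using this

/-! ### Multipliers -/

/-- Sequences of subexponential growth. -/
def SubExp (m : ℕ → ℝ) : Prop := ∀ θ : ℝ, 0 < θ → θ < 1 → ∃ C : ℝ, ∀ k, |m k| * θ ^ k ≤ C

/-- The operator that multiplies the homogeneous part of degree `k` by `m k`. The radial differential
operator `D^t_s` is the case `m k = γ_k(s + t) / γ_k(s)`. -/
def mult (m : ℕ → ℝ) (f : E n → ℂ) (x : E n) : ℂ := ∑' k, (m k : ℂ) * homPart f k x

theorem SubExp.mul {m₁ m₂ : ℕ → ℝ} (h₁ : SubExp m₁) (h₂ : SubExp m₂) :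
    SubExp fun k => m₁ k * m₂ k := by
  intro θ h0 h1
  have hs0 : 0 < √θ := Real.sqrt_pos.2 h0
  have hs1 : √θ < 1 := by rw [Real.sqrt_lt' one_pos]; simpa
  obtain ⟨C₁, hC₁⟩ := h₁ _ hs0 hs1
  obtain ⟨C₂, hC₂⟩ := h₂ _ hs0 hs1
  refine ⟨C₁ * C₂, fun k => ?_⟩
  have : |m₁ k * m₂ k| * θ ^ k = (|m₁ k| * √θ ^ k) * (|m₂ k| * √θ ^ k) := by
    rw [abs_mul]
    nth_rw 1 [← Real.mul_self_sqrt h0.le]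
    rw [mul_pow]; ring
  rw [this]
  exact mul_le_mul (hC₁ k) (hC₂ k) (by positivity) ((by positivity : (0 : ℝ) ≤ _).trans (hC₁ k))

theorem isExpansion_of_subExp {p : ℕ → E n → ℂ} {m : ℕ → ℝ} (hm : SubExp m)
    (hp : ∀ k, HPoly k (p k))
    (hb : ∀ r < 1, ∃ C : ℝ, ∀ k x, ‖x‖ ≤ r → ‖p k x‖ ≤ C) :
    IsExpansion (fun x => ∑' k, (m k : ℂ) * p k x) fun k x => (m k : ℂ) * p k x := by
  refine isExpansion_tsum (fun k => (hp k).const_mul _) fun r hr => ?_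
  obtain ⟨C, θ, hC, h0, h1, hCθ⟩ := exists_geometric_bound_of_bound hp hb hr
  obtain ⟨D, hD⟩ := hm θ h0 h1
  refine ⟨D * C, fun k x hx => ?_⟩
  rw [norm_mul, Complex.norm_real, Real.norm_eq_abs]
  calc |m k| * ‖p k x‖ ≤ |m k| * (C * θ ^ k) := by gcongr; exact hCθ k x hx
    _ = |m k| * θ ^ k * C := by ring
    _ ≤ D * C := by gcongr; exact hD k

theorem mult_isExpansion (hn : 0 < n) {m : ℕ → ℝ} (hm : SubExp m) {f : E n → ℂ} (hf : f ∈ harm n) :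
    IsExpansion (mult m f) fun k x => (m k : ℂ) * homPart f k x :=
  isExpansion_of_subExp hm (isExpansion_homPart hn hf).mem (isExpansion_homPart hn hf).bound

theorem mult_mem_harm (hn : 0 < n) {m : ℕ → ℝ} (hm : SubExp m) {f : E n → ℂ} (hf : f ∈ harm n) :
    mult m f ∈ harm n := (mult_isExpansion hn hm hf).harm

theorem mult_mult (hn : 0 < n) {m : ℕ → ℝ} (hm : SubExp m) (m' : ℕ → ℝ) {f : E n → ℂ}
    (hf : f ∈ harm n) : mult m' (mult m f) = mult (fun k => m' k * m k) f := by
  ext x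
  simp only [mult, Complex.ofReal_mul, mul_assoc]
  rw [(mult_isExpansion hn hm hf).homPart]

theorem mult_congr {f g : E n → ℂ} (h : ∀ x ∈ B n, f x = g x) (m : ℕ → ℝ) : mult m f = mult m g := by
  ext x
  simp only [mult, homPart_congr h]

theorem mult_one (hn : 0 < n) {f : E n → ℂ} (hf : f ∈ harm n) {x : E n} (hx : x ∈ B n) :
    mult (fun _ => 1) f x = f x := by
  simpa [mult] using ((isExpansion_homPart hn hf).hasSum x hx).tsum_eq

/-! ### Rising factorials -/

theorem poch_zero (a : ℝ) : poch a 0 = 1 := by simp [poch]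

theorem poch_succ (a : ℝ) (k : ℕ) : poch a (k + 1) = poch a k * (a + k) :=
  ascPochhammer_succ_eval k a

theorem poch_pos {a : ℝ} (ha : 0 < a) (k : ℕ) : 0 < poch a k := ascPochhammer_pos k a ha

theorem poch_one (k : ℕ) : poch 1 k = k.factorial := ascPochhammer_eval_one ℝ k

theorem poch_add_one_div {q : ℝ} (hq : 0 < q) (k : ℕ) : poch (q + 1) k / poch q k = (q + k) / q := by
  rw [div_eq_div_iff (poch_pos hq k).ne' hq.ne']
  induction k with
  | zero => simp [poch_zero]
  | succ k ih =>
    rw [poch_succ, poch_succ]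
    push_cast
    calc poch (q + 1) k * (q + 1 + k) * q = (poch (q + 1) k * q) * (q + 1 + k) := by ring
      _ = _ := by rw [ih]; ring

theorem subExp_poch_div {p q : ℝ} (hp : 0 < p) (hq : 0 < q) : SubExp fun k => poch p k / poch q k := by
  intro θ h0 h1
  obtain ⟨K, hK⟩ := exists_nat_gt (p / (1 - θ))
  set a : ℕ → ℝ := fun k => |poch p k / poch q k| * θ ^ k with ha
  have ha0 : ∀ k, 0 ≤ a k := fun k => by positivity
  have hstep : ∀ k, K ≤ k → a (k + 1) ≤ a k := by
    intro k hk
    have h1' : 0 < 1 - θ := by linarith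
    have h2 : p < k * (1 - θ) := by
      rw [div_lt_iff₀ h1'] at hK
      have : (K : ℝ) ≤ k := by exact_mod_cast hk
      nlinarith
    have hP := poch_pos hp k
    have hQ := poch_pos hq k
    have hk0 : (0 : ℝ) ≤ k := Nat.cast_nonneg k
    have e : a (k + 1) = a k * ((p + k) * θ / (q + k)) := by
      simp only [ha, poch_succ, pow_succ]
      rw [mul_div_mul_comm, abs_mul, abs_of_pos (div_pos (by linarith : 0 < p + (k : ℝ)) (by linarith : 0 < q + (k : ℝ)))]
      ring
    rw [e]
    refine mul_le_of_le_one_right (ha0 k) ?_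
    rw [div_le_one (by linarith)]
    nlinarith
  refine ⟨∑ j ∈ Finset.range (K + 1), a j, fun k => ?_⟩
  change a k ≤ _
  have hle : ∀ j ≤ K, a j ≤ ∑ j ∈ Finset.range (K + 1), a j := fun j hj =>
    Finset.single_le_sum (f := a) (fun i _ => ha0 i) (by simpa using Nat.lt_succ_of_le hj)
  rcases le_total k K with h | h
  · exact hle k h
  · induction k, h using Nat.le_induction with
    | base => exact hle K le_rfl
    | succ k hk ih => exact (hstep k hk).trans ih

/-! ### Growth of harmonic functions -/

/-- `u` grows at the boundary of the ball at most like `(1 - |x|)^(-A)`. -/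
def Growth (A : ℝ) (u : E n → ℂ) : Prop := ∃ C : ℝ, ∀ x ∈ B n, (1 - ‖x‖) ^ A * ‖u x‖ ≤ C

theorem Growth.exists_bound {A : ℝ} {u : E n → ℂ} (h : Growth A u) :
    ∃ C : ℝ, 0 ≤ C ∧ ∀ x ∈ B n, ‖u x‖ ≤ C * (1 - ‖x‖) ^ (-A) := by
  obtain ⟨C, hC⟩ := h
  refine ⟨max C 0, le_max_right _ _, fun x hx => ?_⟩
  have hx1 : 0 < 1 - ‖x‖ := by simpa using hx
  rw [Real.rpow_neg hx1.le, ← div_eq_mul_inv, le_div_iff₀ (Real.rpow_pos_of_pos hx1 _), mul_comm]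
  exact (hC x hx).trans (le_max_left _ _)

theorem hasDerivAt_tsum_pow {a : ℕ → ℂ} {C θ : ℝ} (hθ0 : 0 < θ) (hθ1 : θ < 1)
    (ha : ∀ k, ‖a k‖ ≤ C * θ ^ k) :
    HasDerivAt (fun τ : ℝ => ∑' k, (τ ^ k) • a k) (∑' k : ℕ, (k : ℝ) • a k) 1 := by
  have hC : 0 ≤ C := by simpa using (norm_nonneg _).trans (ha 0)
  obtain ⟨ρ, hρ1, hρ⟩ := exists_between (one_lt_inv_iff₀.2 ⟨hθ0, hθ1⟩)
  have hρ0 : 0 < ρ := one_pos.trans hρ1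
  have hρθ : ρ * θ < 1 := by rwa [lt_inv_comm₀ hρ0 hθ0, lt_inv_comm₀ hθ0 hρ0, ← one_div, lt_div_iff₀ hθ0] at hρ
  have hsum : Summable fun k : ℕ => C * ((k : ℝ) * (ρ * θ) ^ k) := by
    have := summable_pow_mul_geometric_of_norm_lt_one 1 (r := ρ * θ) (by
      rw [Real.norm_of_nonneg (by positivity)]; exact hρθ)
    simpa using this.mul_left C
  have key := hasDerivAt_tsum_of_isPreconnected (g := fun k (τ : ℝ) => (τ ^ k) • a k)
    (g' := fun k τ => ((k : ℝ) * τ ^ (k - 1)) • a k) (t := Metric.ball (0 : ℝ) ρ) (y₀ := 0) (y := 1) hsum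
    Metric.isOpen_ball (convex_ball _ _).isPreconnected
    (fun k τ _ => (hasDerivAt_pow k τ).smul_const (a k)) (fun k τ hτ => ?_)
    (by simpa using hρ0) ?_ (by simpa using hρ1)
  · simpa using key
  · have hτ' : |τ| ≤ ρ := by simpa using (Metric.mem_ball.1 hτ).le
    rw [norm_smul, norm_mul, norm_pow, Real.norm_natCast, Real.norm_eq_abs]
    calc (k : ℝ) * |τ| ^ (k - 1) * ‖a k‖ ≤ k * ρ ^ (k - 1) * (C * θ ^ k) := by
          gcongr; exact ha k
      _ ≤ k * ρ ^ k * (C * θ ^ k) := by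
          gcongr
          · exact hρ1.le
          · omega
      _ = _ := by rw [mul_pow]; ring
  · refine summable_of_ne_finset_zero (s := {0}) fun k hk => ?_
    simp at hk
    simp [hk]

/-- The operator `f ↦ c⁻¹ (c f + x · ∇f)` raises the order of growth by one, by the gradient estimate
on balls of radius comparable to the distance to the boundary. -/
theorem Growth.mult_add_div (hn : 0 < n) {A c : ℝ} (hA : 0 < A) (hc : 0 < c) {u : E n → ℂ}
    (hu : u ∈ harm n) (h : Growth A u) : Growth (A + 1) (mult (fun k => (c + k) / c) u) := by
  obtain ⟨C, hC0, hC⟩ := h.exists_bound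
  have hexp := isExpansion_homPart hn hu
  set K := compConst n (1 / 2) with hK
  refine ⟨C + c⁻¹ * (2 ^ (A + 1) * (4 * K * C)), fun x hx => ?_⟩
  have hx1 : 0 < 1 - ‖x‖ := by simpa using hx
  obtain ⟨D, θ, hD, hθ0, hθ1, hgeo⟩ := exists_geometric_bound_of_bound hexp.mem hexp.bound
    (r := ‖x‖) (by linarith)
  set a : ℕ → ℂ := fun k => homPart u k x with ha
  have hderiv := hasDerivAt_tsum_pow hθ0 hθ1 (a := a) (fun k => hgeo k x le_rfl)
  have hsumk : Summable fun k : ℕ => (k : ℝ) • a k := by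
    have := (summable_pow_mul_geometric_of_norm_lt_one 1 (r := θ) (by
      rw [Real.norm_of_nonneg hθ0.le]; exact hθ1)).mul_left D
    refine Summable.of_norm_bounded this fun k => ?_
    rw [norm_smul, Real.norm_natCast, pow_one]
    calc (k : ℝ) * ‖a k‖ ≤ k * (D * θ ^ k) := by gcongr; exact hgeo k x le_rfl
      _ = _ := by ring
  set d : ℂ := ∑' k : ℕ, (k : ℝ) • a k with hd
  have hv : mult (fun k => (c + k) / c) u x = u x + (c⁻¹ : ℝ) • d := by
    rw [← (hexp.hasSum x hx).tsum_eq, hd, ← hsumk.tsum_const_smul,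
      ← (hexp.hasSum x hx).summable.tsum_add (hsumk.const_smul _)]
    refine tsum_congr fun k => ?_
    simp only [ha, Complex.real_smul, Complex.ofReal_div, Complex.ofReal_add, Complex.ofReal_inv]
    have : (c : ℂ) ≠ 0 := by exact_mod_cast hc.ne'
    field_simp
  -- the radial derivative is, up to scaling, the linear part of `u` expanded about `x`
  set δ : ℝ := (1 - ‖x‖) / 2 with hδ
  have hδ0 : 0 < δ := by positivity
  have hmem : ∀ y : E n, ‖y‖ ≤ 1 → x + δ • y ∈ B n ∧ δ ≤ 1 - ‖x + δ • y‖ := by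
    intro y hy
    have : ‖x + δ • y‖ ≤ ‖x‖ + δ := by
      refine (norm_add_le _ _).trans ?_
      rw [norm_smul, Real.norm_of_nonneg hδ0.le]
      nlinarith [norm_nonneg y]
    refine ⟨?_, ?_⟩
    · rw [Metric.mem_ball, dist_zero_right]; linarith
    · linarith
  have hharm : ∀ y : E n, ‖y‖ ≤ 1 →
      InnerProductSpace.HarmonicAt (fun y => u (x + δ • y)) y := fun y hy =>
    harmonicAt_comp_affine (hu _ (hmem y hy).1)
  have hlin := (exists_isExpansion_of_closedBall hn (f := fun y => u (x + δ • y))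
    (fun y hy => (hharm y (by simpa using hy)).1.continuousAt.continuousWithinAt)
    (fun y hy => hharm y (by simpa using (Metric.mem_ball.1 hy).le))).2 (1 / 2) (by norm_num)
    (C * δ ^ (-A)) (fun y hy => (hC _ (hmem y hy).1).trans (by
      gcongr ?_ * ?_
      exact Real.rpow_le_rpow_of_nonpos hδ0 (hmem y hy).2 (by linarith))) 1 ((1 / 2 : ℝ) • x) (by
      rw [norm_smul]; norm_num; linarith)
  have hpart : homPart (fun y => u (x + δ • y)) 1 ((1 / 2 : ℝ) • x) = (δ / 2) • d := by
    rw [homPart, iteratedDeriv_one]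
    have hcomp : HasDerivAt (fun r : ℝ => 1 + δ / 2 * r) (δ / 2) 0 := by
      simpa using ((hasDerivAt_id (0 : ℝ)).const_mul (δ / 2)).const_add 1
    have h1 : HasDerivAt (fun r : ℝ => ∑' k, ((1 + δ / 2 * r) ^ k) • a k) ((δ / 2) • d) 0 := by
      refine HasDerivAt.scomp (h := fun r : ℝ => 1 + δ / 2 * r)
        (g₁ := fun τ : ℝ => ∑' k, (τ ^ k) • a k) (0 : ℝ) ?_ hcomp
      simpa using hderiv
    have h2 : (fun r : ℝ => u (x + δ • r • (1 / 2 : ℝ) • x)) =ᶠ[𝓝 0]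
        fun r : ℝ => ∑' k, ((1 + δ / 2 * r) ^ k) • a k := by
      have ht : ∀ᶠ r in 𝓝 (0 : ℝ), r • (1 / 2 : ℝ) • x ∈ B n := eventually_smul_mem_ball _
      filter_upwards [ht] with r hr
      have hr' : ‖r • (1 / 2 : ℝ) • x‖ ≤ 1 := by simpa using (Metric.mem_ball.1 hr).le
      rw [← (hexp.hasSum _ (hmem _ hr').1).tsum_eq]
      refine tsum_congr fun k => ?_
      rw [← (hexp.mem k).smul]
      congr 1
      rw [add_smul, one_smul, smul_smul, smul_smul]
      congr 2
      ring
    rw [h2.deriv_eq, h1.deriv]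
    simp
  rw [hpart, norm_smul, Real.norm_of_nonneg (by positivity : 0 ≤ δ / 2)] at hlin
  have hdb : ‖d‖ ≤ 4 * K * C * δ ^ (-A) / δ := by
    rw [le_div_iff₀ hδ0]
    linarith
  have h2δ : 1 - ‖x‖ = 2 * δ := by rw [hδ]; ring
  have hb1 : (1 - ‖x‖) ^ (A + 1) * ‖u x‖ ≤ C := by
    have hle : (1 - ‖x‖) ^ (A + 1) ≤ (1 - ‖x‖) ^ A :=
      Real.rpow_le_rpow_of_exponent_ge hx1 (by linarith [norm_nonneg x]) (by linarith)
    calc (1 - ‖x‖) ^ (A + 1) * ‖u x‖ ≤ (1 - ‖x‖) ^ A * (C * (1 - ‖x‖) ^ (-A)) := by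
          gcongr; exact hC x hx
      _ = C * ((1 - ‖x‖) ^ A * (1 - ‖x‖) ^ (-A)) := by ring
      _ = C := by rw [← Real.rpow_add hx1]; simp
  have hb2 : (1 - ‖x‖) ^ (A + 1) * ‖d‖ ≤ 2 ^ (A + 1) * (4 * K * C) := by
    rw [h2δ, Real.mul_rpow two_pos.le hδ0.le, mul_assoc]
    refine mul_le_mul_of_nonneg_left ?_ (by positivity)
    calc δ ^ (A + 1) * ‖d‖ ≤ δ ^ (A + 1) * (4 * K * C * δ ^ (-A) / δ) := by gcongr
      _ = 4 * K * C * (δ ^ A * δ ^ (-A)) := by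
          rw [Real.rpow_add_one hδ0.ne']; field_simp
      _ = 4 * K * C := by rw [← Real.rpow_add hδ0]; simp
  rw [hv]
  calc (1 - ‖x‖) ^ (A + 1) * ‖u x + (c⁻¹ : ℝ) • d‖
      ≤ (1 - ‖x‖) ^ (A + 1) * (‖u x‖ + c⁻¹ * ‖d‖) := by
        gcongr
        refine (norm_add_le _ _).trans ?_
        rw [norm_smul, Real.norm_of_nonneg (by positivity : 0 ≤ c⁻¹)]
    _ = (1 - ‖x‖) ^ (A + 1) * ‖u x‖ + c⁻¹ * ((1 - ‖x‖) ^ (A + 1) * ‖d‖) := by ring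
    _ ≤ _ := by gcongr

/-! ### Averages of dilations -/

theorem beta_integral {a b : ℝ} (ha : 0 < a) (hb : 0 < b) :
    IntegrableOn (fun r : ℝ => r ^ (a - 1) * (1 - r) ^ (b - 1)) (Set.Ioo 0 1) ∧
      ∫ r in Set.Ioo (0 : ℝ) 1, r ^ (a - 1) * (1 - r) ^ (b - 1) = ProbabilityTheory.beta a b := by
  have hβ := ProbabilityTheory.beta_pos ha hb
  have h1 := ProbabilityTheory.lintegral_betaPDF_eq_one ha hb
  rw [ProbabilityTheory.lintegral_betaPDF] at h1
  have hnn : 0 ≤ᵐ[volume.restrict (Set.Ioo (0 : ℝ) 1)]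
      fun x => 1 / ProbabilityTheory.beta a b * x ^ (a - 1) * (1 - x) ^ (b - 1) := by
    refine ae_restrict_of_forall_mem measurableSet_Ioo fun x hx => ?_
    have h0 : 0 < x := hx.1
    have h1 : 0 < 1 - x := by linarith [hx.2]
    positivity
  have hm : AEStronglyMeasurable
      (fun x : ℝ => 1 / ProbabilityTheory.beta a b * x ^ (a - 1) * (1 - x) ^ (b - 1))
      (volume.restrict (Set.Ioo (0 : ℝ) 1)) := Measurable.aestronglyMeasurable (by fun_prop)
  have hi : IntegrableOn
      (fun x : ℝ => 1 / ProbabilityTheory.beta a b * x ^ (a - 1) * (1 - x) ^ (b - 1)) (Set.Ioo 0 1) :=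
    (lintegral_ofReal_ne_top_iff_integrable hm hnn).1 (by rw [h1]; simp)
  have h2 : ∫ x in Set.Ioo (0 : ℝ) 1,
      1 / ProbabilityTheory.beta a b * x ^ (a - 1) * (1 - x) ^ (b - 1) = 1 := by
    rw [integral_eq_lintegral_of_nonneg_ae hnn hm, h1]; simp
  simp_rw [mul_assoc] at hi h2
  constructor
  · have := hi.const_mul (ProbabilityTheory.beta a b)
    refine this.congr (Eventually.of_forall fun x => ?_)
    simp only
    field_simp
  · rw [integral_const_mul] at h2
    field_simp at h2
    exact h2

theorem beta_add_nat_div {a c : ℝ} (ha : 0 < a) (hc : 0 < c) (k : ℕ) :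
    ProbabilityTheory.beta (a + k) c = poch a k / poch (a + c) k * ProbabilityTheory.beta a c := by
  have hΓ : ∀ (x : ℝ), 0 < x → Real.Gamma (x + k) = poch x k * Real.Gamma x := by
    intro x hx
    induction k with
    | zero => simp [poch_zero]
    | succ k ih =>
      rw [Nat.cast_add, Nat.cast_one, ← add_assoc, Real.Gamma_add_one (by positivity), ih, poch_succ]
      ring
  rw [ProbabilityTheory.beta, ProbabilityTheory.beta, hΓ a ha, add_right_comm, hΓ _ (add_pos ha hc)]
  field_simp

theorem rpow_le_two_rpow_abs {y e : ℝ} (h0 : 1 / 2 ≤ y) (h1 : y ≤ 1) : y ^ e ≤ 2 ^ |e| := by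
  have hy : 0 < y := by linarith
  calc y ^ e ≤ y ^ (-|e|) := Real.rpow_le_rpow_of_exponent_ge hy h1 (neg_abs_le e)
    _ ≤ (1 / 2) ^ (-|e|) := Real.rpow_le_rpow_of_nonpos (by norm_num) h0 (by simp)
    _ = 2 ^ |e| := by rw [one_div, Real.inv_rpow two_pos.le, Real.rpow_neg two_pos.le, inv_inv]

theorem intervalIntegral_rpow_mul_max_rpow_le {c A ε : ℝ} (hc : 0 < c) (hA : c < A) (hε : 0 < ε)
    (hε1 : ε ≤ 1) :
    IntervalIntegrable (fun y : ℝ => y ^ (c - 1) * (max y ε) ^ (-A)) volume 0 1 ∧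
    ∫ y in (0 : ℝ)..1, y ^ (c - 1) * (max y ε) ^ (-A) ≤ (1 / c + 1 / (A - c)) * ε ^ (c - A) := by
  have e1 : Set.EqOn (fun y : ℝ => y ^ (c - 1) * ε ^ (-A)) (fun y => y ^ (c - 1) * (max y ε) ^ (-A))
      (Set.uIcc 0 ε) := by
    intro y hy
    rw [Set.uIcc_of_le hε.le] at hy
    simp only [max_eq_right hy.2]
  have e2 : Set.EqOn (fun y : ℝ => y ^ (c - 1 - A)) (fun y => y ^ (c - 1) * (max y ε) ^ (-A))
      (Set.uIcc ε 1) := by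
    intro y hy
    rw [Set.uIcc_of_le hε1] at hy
    have hy0 : 0 < y := hε.trans_le hy.1
    simp only [max_eq_left hy.1]
    rw [← Real.rpow_add hy0]
    congr 1
  have h0 : (0 : ℝ) ∉ Set.uIcc ε 1 := by
    rw [Set.uIcc_of_le hε1]; exact fun h => absurd h.1 (not_le.2 hε)
  have i1 : IntervalIntegrable (fun y : ℝ => y ^ (c - 1) * (max y ε) ^ (-A)) volume 0 ε :=
    ((intervalIntegral.intervalIntegrable_rpow' (by linarith)).mul_const _).congr
      (e1.mono Set.uIoc_subset_uIcc)
  have i2 : IntervalIntegrable (fun y : ℝ => y ^ (c - 1) * (max y ε) ^ (-A)) volume ε 1 :=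
    (intervalIntegral.intervalIntegrable_rpow (Or.inr h0)).congr (e2.mono Set.uIoc_subset_uIcc)
  refine ⟨i1.trans i2, ?_⟩
  rw [← intervalIntegral.integral_add_adjacent_intervals i1 i2, ← intervalIntegral.integral_congr e1,
    ← intervalIntegral.integral_congr e2, intervalIntegral.integral_mul_const,
    integral_rpow (Or.inl (by linarith)), integral_rpow (Or.inr ⟨by linarith, h0⟩),
    sub_add_cancel, show c - 1 - A + 1 = -(A - c) by ring, Real.zero_rpow hc.ne', Real.one_rpow, sub_zero]
  have h3 : ε ^ c / c * ε ^ (-A) = 1 / c * ε ^ (c - A) := by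
    rw [sub_eq_add_neg c A, Real.rpow_add hε]; ring
  have h4 : (1 - ε ^ (-(A - c))) / -(A - c) ≤ 1 / (A - c) * ε ^ (c - A) := by
    have hAc : 0 < A - c := by linarith
    rw [neg_sub, ← neg_sub A c, div_neg, ← neg_div, neg_sub, neg_sub, one_div, inv_mul_eq_div]
    gcongr
    linarith
  rw [h3, add_mul]
  linarith

/-- The dilations of a function of growth `A`, averaged with respect to a Beta density, gain the
order `c` of vanishing of that density at `1`. -/
theorem exists_integral_dilation_le {a c A : ℝ} (ha : 0 < a) (hc : 0 < c) (hA : c < A) :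
    ∃ C : ℝ, 0 ≤ C ∧ ∀ ρ : ℝ, 0 ≤ ρ → ρ < 1 → ∃ h : ℝ → ℝ, IntegrableOn h (Set.Ioo 0 1) ∧
      (∀ r ∈ Set.Ioo (0 : ℝ) 1,
        (1 - r * ρ) ^ (-A) * (r ^ (a - 1) * (1 - r) ^ (c - 1)) ≤ h r) ∧
      ∫ r in Set.Ioo (0 : ℝ) 1, h r ≤ C * (1 - ρ) ^ (c - A) := by
  set K₁ : ℝ := 2 ^ A * 2 ^ |c - 1| with hK₁
  set K₂ : ℝ := 2 ^ |a - 1| with hK₂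
  have hAc : 0 < A - c := by linarith
  refine ⟨K₁ * (1 / a) + K₂ * (1 / c + 1 / (A - c)), by positivity, fun ρ h0 h1 => ?_⟩
  have hε : 0 < 1 - ρ := by linarith
  have hε1 : 1 - ρ ≤ 1 := by linarith
  obtain ⟨hi, hle⟩ := intervalIntegral_rpow_mul_max_rpow_le hc hA hε hε1
  have hi' : IntervalIntegrable (fun r : ℝ => (1 - r) ^ (c - 1) * (max (1 - r) (1 - ρ)) ^ (-A))
      volume 0 1 := by
    have := (hi.comp_sub_left 1).symm
    simpa using this
  have hle' : ∫ r in (0 : ℝ)..1, (1 - r) ^ (c - 1) * (max (1 - r) (1 - ρ)) ^ (-A) ≤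
      (1 / c + 1 / (A - c)) * (1 - ρ) ^ (c - A) := by
    rw [intervalIntegral.integral_comp_sub_left (fun y => y ^ (c - 1) * (max y (1 - ρ)) ^ (-A)) 1]
    simpa using hle
  have hia : IntervalIntegrable (fun r : ℝ => r ^ (a - 1)) volume 0 1 :=
    intervalIntegral.intervalIntegrable_rpow' (by linarith)
  have hint := (hia.const_mul K₁).add (hi'.const_mul K₂)
  refine ⟨fun r => K₁ * r ^ (a - 1) + K₂ * ((1 - r) ^ (c - 1) * (max (1 - r) (1 - ρ)) ^ (-A)),
    ((intervalIntegrable_iff_integrableOn_Ioo_of_le zero_le_one).1 hint), fun r hr => ?_, ?_⟩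
  · obtain ⟨hr0, hr1⟩ := hr
    have hq : 0 < 1 - r := by linarith
    have hrρ : 0 < 1 - r * ρ := by nlinarith
    have hm : 0 < max (1 - r) (1 - ρ) := lt_max_of_lt_left hq
    have hmax : (1 - r * ρ) ^ (-A) ≤ (max (1 - r) (1 - ρ)) ^ (-A) :=
      Real.rpow_le_rpow_of_nonpos hm (max_le (by nlinarith) (by nlinarith)) (by linarith)
    rcases le_total r (1 / 2) with h | h
    · have b1 : (1 - r * ρ) ^ (-A) ≤ 2 ^ A := by
        calc (1 - r * ρ) ^ (-A) ≤ (1 / 2) ^ (-A) :=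
              Real.rpow_le_rpow_of_nonpos (by norm_num) (by nlinarith) (by linarith)
          _ = 2 ^ A := by rw [one_div, Real.inv_rpow two_pos.le, Real.rpow_neg two_pos.le, inv_inv]
      have b2 : (1 - r) ^ (c - 1) ≤ 2 ^ |c - 1| := rpow_le_two_rpow_abs (by linarith) (by linarith)
      calc (1 - r * ρ) ^ (-A) * (r ^ (a - 1) * (1 - r) ^ (c - 1))
          ≤ 2 ^ A * (r ^ (a - 1) * 2 ^ |c - 1|) := by gcongr
        _ = K₁ * r ^ (a - 1) := by rw [hK₁]; ring
        _ ≤ _ := le_add_of_nonneg_right (by positivity)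
    · have b2 : r ^ (a - 1) ≤ K₂ := rpow_le_two_rpow_abs h hr1.le
      calc (1 - r * ρ) ^ (-A) * (r ^ (a - 1) * (1 - r) ^ (c - 1))
          ≤ (max (1 - r) (1 - ρ)) ^ (-A) * (K₂ * (1 - r) ^ (c - 1)) := by gcongr
        _ = K₂ * ((1 - r) ^ (c - 1) * (max (1 - r) (1 - ρ)) ^ (-A)) := by ring
        _ ≤ _ := le_add_of_nonneg_left (by positivity)
  · rw [← integral_Ioc_eq_integral_Ioo, ← intervalIntegral.integral_of_le zero_le_one,
      intervalIntegral.integral_add (hia.const_mul K₁) (hi'.const_mul K₂),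
      intervalIntegral.integral_const_mul, intervalIntegral.integral_const_mul,
      integral_rpow (Or.inl (by linarith)), sub_add_cancel, Real.one_rpow, Real.zero_rpow ha.ne',
      sub_zero, add_mul]
    have h1 : (1 : ℝ) ≤ (1 - ρ) ^ (c - A) :=
      Real.one_le_rpow_of_pos_of_le_one_of_nonpos hε hε1 (by linarith)
    have hK : 0 ≤ K₁ * (1 / a) := by positivity
    refine add_le_add (le_mul_of_one_le_right hK h1) ?_
    rw [mul_assoc]
    gcongr

/-- The multiplier `(a)_k / (a + c)_k` lowers the order of growth by `c`: by the Beta integral it is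
the average of the dilations `u (r x)` with density proportional to
`r ^ (a - 1) * (1 - r) ^ (c - 1)`. -/
theorem Growth.mult_poch_div (hn : 0 < n) {a c A : ℝ} (ha : 0 < a) (hc : 0 < c) (hA : c < A)
    {u : E n → ℂ} (hu : u ∈ harm n) (h : Growth A u) :
    Growth (A - c) (mult (fun k => poch a k / poch (a + c) k) u) := by
  obtain ⟨C, hC0, hC⟩ := h.exists_bound
  obtain ⟨K, hK0, hK⟩ := exists_integral_dilation_le ha hc hA
  have hexp := isExpansion_homPart hn hu
  have hβ := ProbabilityTheory.beta_pos ha hc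
  set β := ProbabilityTheory.beta a c with hβdef
  refine ⟨β⁻¹ * (C * K), fun x hx => ?_⟩
  have hx1 : 0 < 1 - ‖x‖ := by simpa using hx
  obtain ⟨D, θ, hD, hθ0, hθ1, hgeo⟩ := exists_geometric_bound_of_bound hexp.mem hexp.bound
    (r := ‖x‖) (by linarith)
  set w : ℕ → ℝ → ℝ := fun k r => r ^ (a + k - 1) * (1 - r) ^ (c - 1) with hw
  have hwi : ∀ k, IntegrableOn (w k) (Set.Ioo 0 1) := fun k =>
    (beta_integral (a := a + k) (by positivity) hc).1
  have hwv : ∀ k, ∫ r in Set.Ioo (0 : ℝ) 1, w k r = poch a k / poch (a + c) k * β := fun k =>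
    (beta_integral (a := a + k) (by positivity) hc).2.trans (beta_add_nat_div ha hc k)
  have hwnn : ∀ k, ∀ r ∈ Set.Ioo (0 : ℝ) 1, 0 ≤ w k r := fun k r hr => by
    have h0 : 0 < r := hr.1
    have h1 : 0 < 1 - r := by linarith [hr.2]
    positivity
  have hwk : ∀ k, ∀ r ∈ Set.Ioo (0 : ℝ) 1, w k r = r ^ k * w 0 r := fun k r hr => by
    simp only [hw, Nat.cast_zero, add_zero]
    rw [show a + k - 1 = k + (a - 1) by ring, Real.rpow_add hr.1, Real.rpow_natCast]
    ring
  set F : ℕ → ℝ → ℂ := fun k r => w k r • homPart u k x with hF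
  have hFi : ∀ k, Integrable (F k) (volume.restrict (Set.Ioo 0 1)) := fun k =>
    (hwi k).smul_const _
  have hle1 : ∀ k, poch a k / poch (a + c) k * β ≤ β := fun k => by
    rw [← hwv k, hβdef, ← (beta_integral ha hc).2]
    refine setIntegral_mono_on (hwi k) (beta_integral ha hc).1 measurableSet_Ioo fun r hr => ?_
    have h2 := hwnn 0 r hr
    rw [hwk k r hr]
    calc r ^ k * w 0 r ≤ 1 * w 0 r := by
          gcongr; exact pow_le_one₀ hr.1.le hr.2.le
      _ = _ := by simp [hw]
  have hFn : ∀ k, ∫ r in Set.Ioo (0 : ℝ) 1, ‖F k r‖ = poch a k / poch (a + c) k * β * ‖homPart u k x‖ := by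
    intro k
    rw [← hwv k, ← integral_mul_const]
    refine setIntegral_congr_fun measurableSet_Ioo fun r hr => ?_
    simp only [hF, norm_smul, Real.norm_of_nonneg (hwnn k r hr)]
  have hsum : Summable fun k => ∫ r in Set.Ioo (0 : ℝ) 1, ‖F k r‖ := by
    simp_rw [hFn]
    have hp : ∀ k, 0 ≤ poch a k / poch (a + c) k * β := fun k =>
      mul_nonneg (div_nonneg (poch_pos ha k).le (poch_pos (add_pos ha hc) k).le) hβ.le
    refine Summable.of_nonneg_of_le (fun k => mul_nonneg (hp k) (norm_nonneg _)) (fun k => ?_)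
      ((summable_geometric_of_lt_one hθ0.le hθ1).mul_left (β * D))
    rw [mul_assoc β]
    exact mul_le_mul (hle1 k) (hgeo k x le_rfl) (norm_nonneg _) hβ.le
  have hswap := (hasSum_integral_of_summable_integral_norm hFi hsum).tsum_eq
  have hFint : ∀ k, ∫ r in Set.Ioo (0 : ℝ) 1, F k r =
      (β : ℂ) * (((poch a k / poch (a + c) k : ℝ) : ℂ) * homPart u k x) := by
    intro k
    rw [hF, integral_smul_const, hwv, Complex.real_smul]
    push_cast; ring
  simp_rw [hFint] at hswap
  rw [tsum_mul_left] at hswap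
  change (β : ℂ) * mult (fun k => poch a k / poch (a + c) k) u x = _ at hswap
  obtain ⟨g, hgi, hgle, hgint⟩ := hK ‖x‖ (norm_nonneg x) (by linarith)
  have hbound : ‖∫ r in Set.Ioo (0 : ℝ) 1, ∑' k, F k r‖ ≤ ∫ r in Set.Ioo (0 : ℝ) 1, C * g r := by
    refine norm_integral_le_of_norm_le (hgi.const_mul C) (ae_restrict_of_forall_mem measurableSet_Ioo
      fun r hr => ?_)
    have hrx : ‖r • x‖ = r * ‖x‖ := by rw [norm_smul, Real.norm_of_nonneg hr.1.le]
    have hrB : r • x ∈ B n := by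
      rw [Metric.mem_ball, dist_zero_right, hrx]; nlinarith [norm_nonneg x, hr.1, hr.2]
    have : ∑' k, F k r = w 0 r • u (r • x) := by
      rw [← (hexp.hasSum _ hrB).tsum_eq, ← (hexp.hasSum _ hrB).summable.tsum_const_smul]
      refine tsum_congr fun k => ?_
      simp only [hF]
      rw [hwk k r hr, (hexp.mem k).smul, smul_smul, mul_comm]
    rw [this, norm_smul, Real.norm_of_nonneg (hwnn 0 r hr)]
    have h1 := hC _ hrB
    rw [hrx] at h1
    have h2 := hgle r hr
    calc w 0 r * ‖u (r • x)‖ ≤ w 0 r * (C * (1 - r * ‖x‖) ^ (-A)) :=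
          mul_le_mul_of_nonneg_left h1 (hwnn 0 r hr)
      _ = C * ((1 - r * ‖x‖) ^ (-A) * (r ^ (a - 1) * (1 - r) ^ (c - 1))) := by
          simp only [hw, Nat.cast_zero, add_zero]; ring
      _ ≤ C * g r := by gcongr
  rw [← hswap, integral_const_mul, norm_mul, Complex.norm_real, Real.norm_of_nonneg hβ.le] at hbound
  have h3 : ‖mult (fun k => poch a k / poch (a + c) k) u x‖ ≤ β⁻¹ * (C * (K * (1 - ‖x‖) ^ (c - A))) := by
    rw [inv_mul_eq_div, le_div_iff₀ hβ, mul_comm]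
    exact hbound.trans (by gcongr)
  calc (1 - ‖x‖) ^ (A - c) * ‖mult (fun k => poch a k / poch (a + c) k) u x‖
      ≤ (1 - ‖x‖) ^ (A - c) * (β⁻¹ * (C * (K * (1 - ‖x‖) ^ (c - A)))) := by gcongr
    _ = β⁻¹ * (C * K) * ((1 - ‖x‖) ^ (A - c) * (1 - ‖x‖) ^ (c - A)) := by ring
    _ = _ := by rw [← Real.rpow_add hx1]; simp

/-! ### Multipliers of a given order -/

/-- The multiplier `m` maps harmonic functions of growth `A > lo` to functions of growth `A + τ`. -/
def ShiftsGrowth (n : ℕ) (m : ℕ → ℝ) (lo τ : ℝ) : Prop :=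
  SubExp m ∧ ∀ (A : ℝ) (u : E n → ℂ), lo < A → u ∈ harm n → Growth A u → Growth (A + τ) (mult m u)

theorem ShiftsGrowth.comp (hn : 0 < n) {m₁ m₂ : ℕ → ℝ} {l₁ l₂ l a b : ℝ} (h₁ : ShiftsGrowth n m₁ l₁ a)
    (h₂ : ShiftsGrowth n m₂ l₂ b) (hl₁ : l₁ ≤ l) (hl₂ : l₂ ≤ l + a) :
    ShiftsGrowth n (fun k => m₂ k * m₁ k) l (a + b) := by
  refine ⟨h₂.1.mul h₁.1, fun A u hA hu hg => ?_⟩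
  rw [← mult_mult hn h₁.1 m₂ hu, ← add_assoc]
  exact h₂.2 _ _ (by linarith) (mult_mem_harm hn h₁.1 hu) (h₁.2 A u (by linarith) hu hg)

/-- `m` is a multiplier of order `τ`: a product of one that raises the growth by `a` and one that
lowers it by `b`, with `τ = a - b`. The splitting makes it possible to do all differentiations
before all integrations in a product of such multipliers. -/
def HasOrder (n : ℕ) (m : ℕ → ℝ) (τ : ℝ) : Prop :=
  ∃ (m₁ m₂ : ℕ → ℝ) (a b : ℝ), 0 ≤ a ∧ 0 ≤ b ∧ τ = a - b ∧ (∀ k, m k = m₂ k * m₁ k) ∧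
    ShiftsGrowth n m₁ 0 a ∧ ShiftsGrowth n m₂ b (-b)

theorem HasOrder.mul (hn : 0 < n) {m m' : ℕ → ℝ} {τ τ' : ℝ} (h : HasOrder n m τ)
    (h' : HasOrder n m' τ') : HasOrder n (fun k => m k * m' k) (τ + τ') := by
  obtain ⟨m₁, m₂, a, b, ha, hb, rfl, hm, h₁, h₂⟩ := h
  obtain ⟨m₁', m₂', a', b', ha', hb', rfl, hm', h₁', h₂'⟩ := h'
  refine ⟨fun k => m₁' k * m₁ k, fun k => m₂' k * m₂ k, a + a', b + b', by linarith, by linarith,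
    by ring, fun k => by simp only [hm, hm']; ring, h₁.comp hn h₁' le_rfl (by linarith), ?_⟩
  have := h₂.comp hn h₂' (l := b + b') (by linarith) (by linarith)
  rwa [← neg_add] at this

theorem HasOrder.congr {m m' : ℕ → ℝ} {τ τ' : ℝ} (h : HasOrder n m τ) (hm : ∀ k, m' k = m k)
    (hτ : τ' = τ) : HasOrder n m' τ' := by
  rw [hτ, show m' = m from funext hm]; exact h

theorem HasOrder.subExp {m : ℕ → ℝ} {τ : ℝ} (h : HasOrder n m τ) : SubExp m := by
  obtain ⟨m₁, m₂, a, b, -, -, -, hm, h₁, h₂⟩ := h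
  rw [show m = fun k => m₂ k * m₁ k from funext hm]
  exact h₂.1.mul h₁.1

theorem HasOrder.growth (hn : 0 < n) {m : ℕ → ℝ} {τ A : ℝ} (h : HasOrder n m τ) (hA : 0 < A)
    (hAτ : 0 < A + τ) {u : E n → ℂ} (hu : u ∈ harm n) (hg : Growth A u) :
    Growth (A + τ) (mult m u) := by
  obtain ⟨m₁, m₂, a, b, ha, hb, rfl, hm, h₁, h₂⟩ := h
  have := h₂.2 _ _ (by linarith) (mult_mem_harm hn h₁.1 hu) (h₁.2 A u hA hu hg)
  rw [mult_mult hn h₁.1 m₂ hu] at this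
  rw [show m = fun k => m₂ k * m₁ k from funext hm, show A + (a - b) = A + a + -b by ring]
  exact this

theorem shiftsGrowth_poch_add_nat (hn : 0 < n) {q : ℝ} (hq : 0 < q) (N : ℕ) :
    ShiftsGrowth n (fun k => poch (q + N) k / poch q k) 0 N := by
  induction N with
  | zero =>
    have h1 : (fun k => poch (q + (0 : ℕ)) k / poch q k) = fun _ => 1 := by
      ext k; simp [(poch_pos hq k).ne']
    refine ⟨subExp_poch_div (by simpa) hq, fun A u hA hu hg => ?_⟩
    obtain ⟨C, hC⟩ := hg
    refine ⟨C, fun x hx => ?_⟩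
    rw [h1, mult_one hn hu hx]
    simpa using hC x hx
  | succ N ih =>
    have hqN : 0 < q + N := by positivity
    have hstep : ShiftsGrowth n (fun k => poch (q + N + 1) k / poch (q + N) k) 0 1 := by
      refine ⟨subExp_poch_div (by positivity) hqN, fun A u hA hu hg => ?_⟩
      simp_rw [poch_add_one_div hqN]
      exact hg.mult_add_div hn hA hqN hu
    have := ih.comp hn hstep le_rfl (by positivity)
    convert this using 1
    · ext k
      have := (poch_pos hqN k).ne'
      push_cast
      rw [← add_assoc]
      field_simp
    · push_cast; ring

/-- To reach `(p)_k / (q)_k`, raise `q` to `q + N` with `N` large by derivatives and come back to `p`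
by averages of dilations. -/
theorem hasOrder_poch_div (hn : 0 < n) {p q : ℝ} (hp : 0 < p) (hq : 0 < q) :
    HasOrder n (fun k => poch p k / poch q k) (p - q) := by
  obtain ⟨N, hN⟩ := exists_nat_gt (p - q)
  have hqN : 0 < q + N := by positivity
  refine ⟨fun k => poch (q + N) k / poch q k, fun k => poch p k / poch (q + N) k, N, q + N - p,
    by positivity, by linarith, by ring, fun k => ?_, shiftsGrowth_poch_add_nat hn hq N,
    subExp_poch_div hp hqN, fun A u hA hu hg => ?_⟩
  · have := (poch_pos hqN k).ne'
    field_simp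
  · have := hg.mult_poch_div hn hp (c := q + N - p) (by linarith) hA hu
    rw [add_sub_cancel] at this
    rwa [← sub_eq_add_neg]

/-- Both formulas for `γ_k(α)` are products of two quotients of rising factorials whose parameters
have the total excess `1 + α`; hence `γ_k(α)` is comparable to `(k + 1) ^ (1 + α)`. -/
theorem gammaCoeff_eq (hn : 0 < n) (α : ℝ) : ∃ a b c d : ℝ, 0 < a ∧ 0 < b ∧ 0 < c ∧ 0 < d ∧
    a - c + (b - d) = 1 + α ∧ ∀ k, gammaCoeff n α k = poch a k / poch c k * (poch b k / poch d k) := by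
  have hn' : (0 : ℝ) < n / 2 := by positivity
  by_cases h : -(1 + (n : ℝ) / 2) < α
  · refine ⟨1 + n / 2 + α, 1, n / 2, 1, by linarith, one_pos, hn', one_pos, by ring, fun k => ?_⟩
    rw [gammaCoeff, if_pos h, div_self (poch_pos one_pos k).ne', mul_one]
  · refine ⟨1, 1, 1 - (n / 2 + α), n / 2, one_pos, one_pos, by linarith, hn', by ring, fun k => ?_⟩
    rw [gammaCoeff, if_neg h, poch_one]
    field_simp

theorem gammaCoeff_pos (hn : 0 < n) (α : ℝ) (k : ℕ) : 0 < gammaCoeff n α k := by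
  obtain ⟨a, b, c, d, ha, hb, hc, hd, -, h⟩ := gammaCoeff_eq hn α
  rw [h]
  have := poch_pos ha k; have := poch_pos hb k; have := poch_pos hc k; have := poch_pos hd k
  positivity

theorem hasOrder_gammaCoeff (hn : 0 < n) (α : ℝ) : HasOrder n (gammaCoeff n α) (1 + α) := by
  obtain ⟨a, b, c, d, ha, hb, hc, hd, hs, h⟩ := gammaCoeff_eq hn α
  exact ((hasOrder_poch_div hn ha hc).mul hn (hasOrder_poch_div hn hb hd)).congr h hs.symm

theorem hasOrder_gammaCoeff_inv (hn : 0 < n) (α : ℝ) :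
    HasOrder n (fun k => (gammaCoeff n α k)⁻¹) (-(1 + α)) := by
  obtain ⟨a, b, c, d, ha, hb, hc, hd, hs, h⟩ := gammaCoeff_eq hn α
  exact ((hasOrder_poch_div hn hc ha).mul hn (hasOrder_poch_div hn hd hb)).congr
    (fun k => by rw [h, mul_inv, inv_div, inv_div]) (by linarith)

theorem hasOrder_gammaCoeff_div (hn : 0 < n) (s t : ℝ) :
    HasOrder n (fun k => gammaCoeff n (s + t) k / gammaCoeff n s k) t :=
  ((hasOrder_gammaCoeff hn (s + t)).mul hn (hasOrder_gammaCoeff_inv hn s)).congr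
    (fun k => div_eq_mul_inv _ _) (by ring)

/-! ### Zonal harmonics -/

/-- Integration in polar coordinates: the weighted `L²` norm on the ball of a homogeneous harmonic
polynomial is controlled by its `L²` norm on the sphere, uniformly in the degree. -/
theorem exists_integral_bump_le_integral_sphere (hn : 0 < n) : ∃ C : ℝ, 0 ≤ C ∧
    ∀ k, ∀ p ∈ harmonicPoly n k,
      ∫ x, p x ^ 2 * bump x ≤ C * ∫ ζ, p ζ.1 * p ζ.1 ∂sphereMeasure n := by
  have : NeZero n := ⟨hn.ne'⟩
  set ν := (volume : Measure (E n)).toSphere with hν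
  set ρ := Measure.volumeIoiPow (Module.finrank ℝ (E n) - 1) with hρ
  let one : Set.Ioi (0 : ℝ) := ⟨1, Set.mem_Ioi.2 one_pos⟩
  have hone : ρ (Set.Iio one) ≠ ⊤ := by
    rw [hρ, Measure.volumeIoiPow_apply_Iio]; exact ENNReal.ofReal_ne_top
  have hmass : ν.real Set.univ ≠ 0 := by
    rw [measureReal_def, ENNReal.toReal_ne_zero]
    exact ⟨mt Measure.measure_univ_eq_zero.1 (Measure.toSphere_ne_zero _), measure_ne_top _ _⟩
  refine ⟨ν.real Set.univ * ρ.real (Set.Iio one), by positivity, fun k p hp => ?_⟩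
  have hpolar : ∫ x, p x ^ 2 * bump x =
      (∫ ζ, p ζ.1 * p ζ.1 ∂ν) * ∫ r, r.1 ^ (2 * k) * max 0 (1 - r.1 ^ 2) ∂ρ := by
    calc ∫ x, p x ^ 2 * bump x
        = ∫ x : ({(0 : E n)}ᶜ : Set (E n)), p x.1 ^ 2 * bump x.1 ∂(volume.comap Subtype.val) := by
          rw [integral_subtype_comap (measurableSet_singleton _).compl fun x => p x ^ 2 * bump x,
            restrict_compl_singleton]
      _ = ∫ z, (p z.1.1 * p z.1.1) * (z.2.1 ^ (2 * k) * max 0 (1 - z.2.1 ^ 2)) ∂ν.prod ρ := by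
          rw [← (volume : Measure (E n)).measurePreserving_homeomorphUnitSphereProd.integral_comp
            (Homeomorph.measurableEmbedding _)]
          refine integral_congr_ae (Eventually.of_forall fun x => ?_)
          have hx0 : ‖x.1‖ ≠ 0 := norm_ne_zero_iff.2 x.2
          have hx : x.1 = ‖x.1‖ • (‖x.1‖⁻¹ • x.1) := by
            rw [smul_smul, mul_inv_cancel₀ hx0, one_smul]
          have h1 : p x.1 = ‖x.1‖ ^ k * p (‖x.1‖⁻¹ • x.1) := by
            conv_lhs => rw [hx, harmonicPoly_smul hp]
          simp only [homeomorphUnitSphereProd_apply_fst_coe,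
            homeomorphUnitSphereProd_apply_snd_coe, bump]
          rw [h1]
          ring
      _ = _ := integral_prod_mul (fun ζ : Metric.sphere (0 : E n) 1 => p ζ.1 * p ζ.1)
          fun r : Set.Ioi (0 : ℝ) => r.1 ^ (2 * k) * max 0 (1 - r.1 ^ 2)
  have hsphere : ∫ ζ, p ζ.1 * p ζ.1 ∂ν =
      ν.real Set.univ * ∫ ζ, p ζ.1 * p ζ.1 ∂sphereMeasure n := by
    rw [sphereMeasure, integral_smul_measure, ENNReal.toReal_inv, smul_eq_mul, ← mul_assoc,
      ← measureReal_def, mul_inv_cancel₀ hmass, one_mul]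
  have hrad : ∫ r, r.1 ^ (2 * k) * max 0 (1 - r.1 ^ 2) ∂ρ ≤ ρ.real (Set.Iio one) := by
    have h1 : Integrable ((Set.Iio one).indicator fun _ => (1 : ℝ)) ρ :=
      (integrable_indicator_iff measurableSet_Iio).2 (integrableOn_const hone)
    refine (integral_mono_of_nonneg (Eventually.of_forall fun r => ?_) h1
      (Eventually.of_forall fun r => ?_)).trans_eq ?_
    · exact mul_nonneg (pow_nonneg (le_of_lt r.2) _) (le_max_left _ _)
    · have hr0 : (0 : ℝ) < r.1 := r.2
      by_cases hr : r < one
      · have hr1 : r.1 < 1 := hr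
        simp only [Set.indicator_of_mem (Set.mem_Iio.2 hr)]
        exact mul_le_one₀ (pow_le_one₀ hr0.le hr1.le) (le_max_left _ _)
          (max_le zero_le_one (by nlinarith))
      · have hr1 : 1 ≤ r.1 := not_lt.1 hr
        rw [Set.indicator_of_notMem (by simpa using hr)]
        rw [max_eq_left (by nlinarith), mul_zero]
    · rw [integral_indicator_const _ measurableSet_Iio, smul_eq_mul, mul_one]
  have hpos : 0 ≤ ∫ ζ, p ζ.1 * p ζ.1 ∂ν := integral_nonneg fun ζ => mul_self_nonneg _
  rw [hpolar]
  refine (mul_le_mul_of_nonneg_left hrad hpos).trans_eq ?_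
  rw [hsphere]
  ring

/-- Pointwise bounds in the interior by the `L²` norm on the sphere, with a constant that does not
depend on the degree. -/
theorem exists_sq_le_integral_sphere (hn : 0 < n) {r : ℝ} (hr : r < 1) : ∃ C : ℝ, 0 ≤ C ∧
    ∀ k, ∀ p ∈ harmonicPoly n k, ∀ a : E n, ‖a‖ ≤ r →
      p a ^ 2 ≤ C * ∫ ζ, p ζ.1 * p ζ.1 ∂sphereMeasure n := by
  obtain ⟨C, hC, h⟩ := exists_sq_le_integral_bump n hr
  obtain ⟨C', hC', h'⟩ := exists_integral_bump_le_integral_sphere hn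
  refine ⟨C * C', mul_nonneg hC hC', fun k p hp a ha => ?_⟩
  obtain ⟨P, -, hP, rfl⟩ := mem_harmonicPoly_iff.1 hp
  rw [mul_assoc]
  exact (h P hP a ha).trans (mul_le_mul_of_nonneg_left (h' k _ hp) hC)

theorem zonal_mem (hn : 0 < n) (k : ℕ) (y : E n) : (fun x => zonal k x y) ∈ harmonicPoly n k :=
  (zonal_spec hn k y).1

theorem zonal_symm (hn : 0 < n) (k : ℕ) (x y : E n) : zonal k x y = zonal k y x := by
  have h1 := (zonal_spec hn k x).2 _ (zonal_mem hn k y)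
  have h2 := (zonal_spec hn k y).2 _ (zonal_mem hn k x)
  simp only at h1 h2
  rw [h1, h2]
  simp only [mul_comm]

theorem zonal_smul_smul (hn : 0 < n) (k : ℕ) (c d : ℝ) (x y : E n) :
    zonal k (c • x) (d • y) = (c * d) ^ k * zonal k x y := by
  rw [harmonicPoly_smul (zonal_mem hn k (d • y)) c x, zonal_symm hn,
    harmonicPoly_smul (zonal_mem hn k x) d y, zonal_symm hn, mul_pow, mul_assoc]

theorem continuous_zonal (hn : 0 < n) (k : ℕ) (x : E n) : Continuous fun y => zonal k x y := by
  simp_rw [zonal_symm hn k x]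
  exact harmonicPoly_continuous (zonal_mem hn k x)

/-- The zonal harmonic is a finite sum of products; the second factors are dual to the first ones
for the inner product of the sphere. -/
theorem exists_zonal_eq_sum (hn : 0 < n) (k : ℕ) : ∃ (N : ℕ) (e q : Fin N → E n → ℝ),
    (∀ j, e j ∈ harmonicPoly n k) ∧ (∀ j, q j ∈ harmonicPoly n k) ∧
      ∀ x y, zonal k x y = ∑ j, q j y * e j x := by
  let Φ : LinearMap.BilinForm ℝ (harmonicPoly n k) :=
    LinearMap.mk₂ ℝ (fun q p => ∫ ζ, q.1 ζ.1 * p.1 ζ.1 ∂(sphereMeasure n))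
      (fun q₁ q₂ p => by
        rw [← integral_add (harmonicPoly_mul_integrable q₁.2 p.2)
          (harmonicPoly_mul_integrable q₂.2 p.2)]
        simp [add_mul])
      (fun c q p => by
        rw [smul_eq_mul, ← integral_const_mul]
        simp [mul_assoc])
      (fun q p₁ p₂ => by
        rw [← integral_add (harmonicPoly_mul_integrable q.2 p₁.2)
          (harmonicPoly_mul_integrable q.2 p₂.2)]
        simp [mul_add])
      (fun c q p => by
        rw [smul_eq_mul, ← integral_const_mul]
        simp [mul_left_comm])
  have hΦ : ∀ p q : harmonicPoly n k, Φ p q = ∫ ζ, p.1 ζ.1 * q.1 ζ.1 ∂(sphereMeasure n) :=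
    fun _ _ => rfl
  have hnd : Φ.Nondegenerate :=
    ⟨fun p hp => Subtype.ext (harmonicPoly_eq_zero hn p.2 (hp p)),
      fun p hp => Subtype.ext (harmonicPoly_eq_zero hn p.2 (hp p))⟩
  let b := Module.finBasis ℝ (harmonicPoly n k)
  let d := Φ.dualBasis hnd b
  refine ⟨_, fun j => (b j).1, fun j => (d j).1, fun j => (b j).2, fun j => (d j).2,
    fun x y => ?_⟩
  have hz : IsZonal k y (∑ j, (d j).1 y • b j : harmonicPoly n k).1 := by
    refine ⟨Subtype.prop _, fun p hp => ?_⟩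
    have h1 := d.sum_repr ⟨p, hp⟩
    simp only [d, LinearMap.BilinForm.dualBasis_repr_apply] at h1
    have h2 : p y = ∑ j, Φ ⟨p, hp⟩ (b j) * (d j).1 y := by
      have := congrFun (congrArg Subtype.val h1) y
      simpa [d] using this.symm
    rw [h2, ← hΦ ⟨p, hp⟩ (∑ j, (d j).1 y • b j), map_sum]
    refine Finset.sum_congr rfl fun j _ => ?_
    rw [map_smul, smul_eq_mul, mul_comm]
  have := congrFun (isZonal_unique hn (zonal_spec hn k y) hz) x
  simpa using this

/-- The reproducing property makes `Z_k(b, b)` the square of the `L²` norm of `Z_k(·, b)`, so the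
pointwise bound gives `Z_k(b, b) ^ 2 ≤ C Z_k(b, b)`. -/
theorem exists_abs_zonal_le (hn : 0 < n) {r : ℝ} (hr : r < 1) : ∃ C : ℝ, 0 ≤ C ∧
    ∀ k, ∀ a b : E n, ‖a‖ ≤ r → ‖b‖ ≤ r → |zonal k a b| ≤ C := by
  obtain ⟨C, hC, h⟩ := exists_sq_le_integral_sphere hn hr
  refine ⟨C, hC, fun k a b ha hb => ?_⟩
  have hr := (zonal_spec hn k b).2 _ (zonal_mem hn k b)
  have h1 := h k _ (zonal_mem hn k b) a ha
  have h2 := h k _ (zonal_mem hn k b) b hb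
  simp only at hr h1 h2
  rw [← hr] at h1 h2
  have h3 : zonal k b b ≤ C := by
    by_contra! hlt
    nlinarith
  refine abs_le_of_sq_le_sq (h1.trans ?_) hC
  nlinarith

/-- The zonal harmonics decay geometrically in the degree, locally uniformly in one variable and
uniformly on the unit ball in the other one. -/
theorem exists_abs_zonal_le_geometric (hn : 0 < n) {r : ℝ} (hr : r < 1) : ∃ C θ : ℝ, 0 ≤ C ∧
    0 < θ ∧ θ < 1 ∧ ∀ k, ∀ a b : E n, ‖a‖ ≤ r → ‖b‖ ≤ 1 → |zonal k a b| ≤ C * θ ^ k := by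
  by_cases hr0 : r < 0
  · exact ⟨1, 1 / 2, by norm_num, by norm_num, by norm_num, fun k a b ha =>
      absurd ((norm_nonneg a).trans ha) (not_le.2 hr0)⟩
  -- by homogeneity, `Z_k(a, b) = θ ^ k * Z_k(θ⁻² a, θ b)`, and both arguments have norm at most `θ`
  set θ : ℝ := 1 - (1 - r) / 3 with hθ
  have hθ0 : 0 < θ := by linarith
  have hθ1 : θ < 1 := by linarith
  have hθr : r ≤ θ ^ 3 := by
    have : 1 - θ = (1 - r) / 3 := by rw [hθ]; ring
    nlinarith [mul_nonneg (sq_nonneg (1 - θ)) (by linarith : 0 ≤ 2 + θ)]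
  obtain ⟨C, hC, h⟩ := exists_abs_zonal_le hn hθ1
  refine ⟨C, θ, hC, hθ0, hθ1, fun k a b ha hb => ?_⟩
  have h1 := h k ((θ ^ 2)⁻¹ • a) (θ • b) (by
      rw [norm_smul, norm_inv, Real.norm_of_nonneg (by positivity), inv_mul_le_iff₀ (by positivity)]
      nlinarith) (by
      rw [norm_smul, Real.norm_of_nonneg hθ0.le]; nlinarith)
  have h2 : (θ ^ 2)⁻¹ * θ = θ⁻¹ := by field_simp
  rw [zonal_smul_smul hn, h2, abs_mul, abs_pow, abs_inv, abs_of_pos hθ0, inv_pow,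
    inv_mul_le_iff₀ (by positivity)] at h1
  linarith

/-! ### Integral operators with kernel `R_α` -/

theorem SubExp.summable {m : ℕ → ℝ} (hm : SubExp m) {θ : ℝ} (h0 : 0 < θ) (h1 : θ < 1) :
    Summable fun k => |m k| * θ ^ k := by
  obtain ⟨η, hθη, hη1⟩ := exists_between h1
  have hη0 : 0 < η := h0.trans hθη
  obtain ⟨C, hC⟩ := hm (θ / η) (by positivity) (by rwa [div_lt_one hη0])
  refine Summable.of_nonneg_of_le (fun k => by positivity) (fun k => ?_)
    ((summable_geometric_of_lt_one hη0.le hη1).mul_left C)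
  have : θ ^ k = (θ / η) ^ k * η ^ k := by rw [← mul_pow, div_mul_cancel₀ _ hη0.ne']
  rw [this, ← mul_assoc]
  exact mul_le_mul_of_nonneg_right (hC k) (by positivity)

/-- The series of `R_α(a, b)` has a summable majorant, uniformly for `|a| ≤ r < 1` and `|b| ≤ 1`. -/
theorem exists_kernel_majorant (hn : 0 < n) (α : ℝ) {r : ℝ} (hr : r < 1) : ∃ M : ℕ → ℝ,
    Summable M ∧ ∀ k, ∀ a b : E n, ‖a‖ ≤ r → ‖b‖ ≤ 1 → ‖gammaCoeff n α k * zonal k a b‖ ≤ M k := by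
  obtain ⟨C, θ, hC, h0, h1, h⟩ := exists_abs_zonal_le_geometric hn hr
  refine ⟨_, ((hasOrder_gammaCoeff hn α).subExp.summable h0 h1).mul_left C, fun k a b ha hb => ?_⟩
  rw [norm_mul, Real.norm_eq_abs, Real.norm_eq_abs]
  calc _ ≤ |gammaCoeff n α k| * (C * θ ^ k) := by gcongr; exact h k a b ha hb
    _ = _ := by ring

theorem summable_kernel (hn : 0 < n) (α : ℝ) {x y : E n} (hx : x ∈ B n) (hy : y ∈ B n) :
    Summable fun k => gammaCoeff n α k * zonal k x y := by
  obtain ⟨M, hM, h⟩ := exists_kernel_majorant hn α (r := ‖x‖) (by simpa using hx)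
  exact Summable.of_norm_bounded hM fun k => h k x y le_rfl (by simpa using (Metric.mem_ball.1 hy).le)

theorem norm_le_one_of_mem {y : E n} (hy : y ∈ B n) : ‖y‖ ≤ 1 := by
  simpa using (Metric.mem_ball.1 hy).le

theorem continuousOn_kernel (hn : 0 < n) (α : ℝ) {x : E n} (hx : x ∈ B n) :
    ContinuousOn (fun y => kernel α x y) (B n) := by
  obtain ⟨M, hM, h⟩ := exists_kernel_majorant hn α (r := ‖x‖) (by simpa using hx)
  exact continuousOn_tsum (fun k => (continuous_const.mul (continuous_zonal hn k x)).continuousOn) hM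
    fun k y hy => h k x y le_rfl (norm_le_one_of_mem hy)

theorem exists_abs_kernel_le (hn : 0 < n) (α : ℝ) {x : E n} (hx : x ∈ B n) :
    ∃ C, ∀ y ∈ B n, |kernel α x y| ≤ C := by
  obtain ⟨M, hM, h⟩ := exists_kernel_majorant hn α (r := ‖x‖) (by simpa using hx)
  exact ⟨∑' k, M k, fun y hy =>
    tsum_of_norm_bounded hM.hasSum fun k => h k x y le_rfl (norm_le_one_of_mem hy)⟩

/-- A bounded continuous factor preserves integrability on the ball. -/
theorem integrableOn_ofReal_mul {μ : Measure (E n)} {F : E n → ℂ} (hF : IntegrableOn F (B n) μ)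
    {g : E n → ℝ} (hg : ContinuousOn g (B n)) {C : ℝ} (hC : ∀ y ∈ B n, |g y| ≤ C) :
    IntegrableOn (fun y => (g y : ℂ) * F y) (B n) μ := by
  refine Integrable.bdd_mul (c := C) hF
    ((Complex.continuous_ofReal.comp_continuousOn hg).aestronglyMeasurable measurableSet_ball) ?_
  filter_upwards [ae_restrict_mem measurableSet_ball] with y hy
  simpa using hC y hy

theorem integrableOn_kernel_mul (hn : 0 < n) {μ : Measure (E n)} {F : E n → ℂ}
    (hF : IntegrableOn F (B n) μ) (α : ℝ) {x : E n} (hx : x ∈ B n) :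
    IntegrableOn (fun y => (kernel α x y : ℂ) * F y) (B n) μ := by
  obtain ⟨C, hC⟩ := exists_abs_kernel_le hn α hx
  exact integrableOn_ofReal_mul hF (continuousOn_kernel hn α hx) hC

/-- The integral of the zonal harmonic of degree `k` against the complex measure `F μ` on the
ball. -/
def zonalIntegral (μ : Measure (E n)) (F : E n → ℂ) (k : ℕ) (x : E n) : ℂ :=
  ∫ y in B n, (zonal k x y : ℂ) * F y ∂μ

theorem exists_abs_le_of_mem_harmonicPoly {k : ℕ} {p : E n → ℝ} (hp : p ∈ harmonicPoly n k) :
    ∃ C, ∀ y ∈ B n, |p y| ≤ C := by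
  obtain ⟨C, hC⟩ := (isCompact_closedBall (0 : E n) 1).exists_bound_of_continuousOn
    (harmonicPoly_continuous hp).continuousOn
  exact ⟨C, fun y hy => hC y (Metric.ball_subset_closedBall hy)⟩

theorem integrableOn_harmonicPoly_mul {μ : Measure (E n)} {F : E n → ℂ}
    (hF : IntegrableOn F (B n) μ) {k : ℕ} {p : E n → ℝ} (hp : p ∈ harmonicPoly n k) :
    IntegrableOn (fun y => (p y : ℂ) * F y) (B n) μ := by
  obtain ⟨C, hC⟩ := exists_abs_le_of_mem_harmonicPoly hp
  exact integrableOn_ofReal_mul hF (harmonicPoly_continuous hp).continuousOn hC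

theorem hPoly_zonalIntegral (hn : 0 < n) {μ : Measure (E n)} {F : E n → ℂ}
    (hF : IntegrableOn F (B n) μ) (k : ℕ) : HPoly k (zonalIntegral μ F k) := by
  obtain ⟨N, e, q, he, hq, hz⟩ := exists_zonal_eq_sum hn k
  have h : zonalIntegral μ F k = fun x => ∑ j, (e j x : ℂ) * ∫ y in B n, (q j y : ℂ) * F y ∂μ := by
    ext x
    rw [zonalIntegral]
    simp_rw [← integral_const_mul]
    rw [← integral_finsetSum _ fun j _ => (integrableOn_harmonicPoly_mul hF (hq j)).const_mul _]
    congr 1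
    ext y
    rw [hz, Complex.ofReal_sum, Finset.sum_mul]
    refine Finset.sum_congr rfl fun j _ => ?_
    push_cast
    ring
  set c : Fin N → ℂ := fun j => ∫ y in B n, (q j y : ℂ) * F y ∂μ
  rw [h]
  constructor
  · convert (harmonicPoly n k).sum_mem fun j (_ : j ∈ Finset.univ) =>
      (harmonicPoly n k).smul_mem (c j).re (he j) using 1
    ext x
    simp [mul_comm, c]
  · convert (harmonicPoly n k).sum_mem fun j (_ : j ∈ Finset.univ) =>
      (harmonicPoly n k).smul_mem (c j).im (he j) using 1
    ext x
    simp [mul_comm, c]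

theorem integral_norm_zonal_mul_le (hn : 0 < n) {μ : Measure (E n)} {F : E n → ℂ}
    (hF : IntegrableOn F (B n) μ) {k : ℕ} {x : E n} {c M : ℝ}
    (h : ∀ y ∈ B n, ‖c * zonal k x y‖ ≤ M) :
    ∫ y in B n, ‖((c * zonal k x y : ℝ) : ℂ) * F y‖ ∂μ ≤ M * ∫ y in B n, ‖F y‖ ∂μ := by
  rw [← integral_const_mul]
  refine setIntegral_mono_on ?_ (hF.norm.const_mul M) measurableSet_ball fun y hy => ?_
  · exact (integrableOn_ofReal_mul hF
      (continuous_const.mul (continuous_zonal hn k x)).continuousOn (C := M) h).norm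
  · rw [norm_mul, Complex.norm_real]
    exact mul_le_mul_of_nonneg_right (h y hy) (norm_nonneg _)

/-- The integral operator with kernel `R_α` can be evaluated degree by degree. -/
theorem isExpansion_integral_kernel (hn : 0 < n) {μ : Measure (E n)} {F : E n → ℂ}
    (hF : IntegrableOn F (B n) μ) (α : ℝ) :
    IsExpansion (fun x => ∫ y in B n, (kernel α x y : ℂ) * F y ∂μ)
      fun k x => (gammaCoeff n α k : ℂ) * zonalIntegral μ F k x := by
  have hterm : ∀ k x, (gammaCoeff n α k : ℂ) * zonalIntegral μ F k x =
      ∫ y in B n, ((gammaCoeff n α k * zonal k x y : ℝ) : ℂ) * F y ∂μ := by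
    intro k x
    rw [zonalIntegral, ← integral_const_mul]
    simp only [Complex.ofReal_mul, mul_assoc]
  refine ⟨fun k => (hPoly_zonalIntegral hn hF k).const_mul _, fun r hr => ?_, fun x hx => ?_⟩
  · obtain ⟨M, hM, h⟩ := exists_kernel_majorant hn α hr
    obtain ⟨C, hC⟩ := hM.tendsto_atTop_zero.bddAbove_range
    refine ⟨C * ∫ y in B n, ‖F y‖ ∂μ, fun k x hx => ?_⟩
    simp only [hterm]
    refine (norm_integral_le_integral_norm _).trans ?_
    exact integral_norm_zonal_mul_le hn hF fun y hy =>
      (h k x y hx (norm_le_one_of_mem hy)).trans (hC ⟨k, rfl⟩)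
  · obtain ⟨M, hM, h⟩ := exists_kernel_majorant hn α (r := ‖x‖) (by simpa using hx)
    simp only [hterm]
    have hs := hasSum_integral_of_summable_integral_norm (μ := μ.restrict (B n))
      (F := fun k y => ((gammaCoeff n α k * zonal k x y : ℝ) : ℂ) * F y)
      (fun k => integrableOn_ofReal_mul hF
        (continuous_const.mul (continuous_zonal hn k x)).continuousOn
        (C := M k) fun y hy => h k x y le_rfl (norm_le_one_of_mem hy))
      (Summable.of_nonneg_of_le (fun k => integral_nonneg fun y => norm_nonneg _)
        (fun k => integral_norm_zonal_mul_le hn hF fun y hy => h k x y le_rfl (norm_le_one_of_mem hy))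
        (hM.mul_right _))
    have heq : ∀ y, ∑' k, ((gammaCoeff n α k * zonal k x y : ℝ) : ℂ) * F y =
        (kernel α x y : ℂ) * F y := fun y => by
      rw [tsum_mul_right, kernel, Complex.ofReal_tsum]
    simpa only [heq] using hs

/-! ### Radial differential operators on Bloch spaces -/

theorem one_sub_sq_pos {x : E n} (hx : x ∈ B n) : 0 < 1 - ‖x‖ ^ 2 := by
  have : ‖x‖ < 1 := by simpa using hx
  nlinarith [norm_nonneg x]

theorem subExp_radialCoeff (hn : 0 < n) (s t : ℝ) :
    SubExp fun k => gammaCoeff n (s + t) k / gammaCoeff n s k :=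
  (hasOrder_gammaCoeff_div hn s t).subExp

theorem isExpansion_radialD (hn : 0 < n) (s t : ℝ) {f : E n → ℂ} (hf : f ∈ harm n) :
    IsExpansion (radialD s t f) fun k x => radialTerm s t f x k :=
  mult_isExpansion hn (subExp_radialCoeff hn s t) hf

theorem radialD_mem_harm (hn : 0 < n) (s t : ℝ) {f : E n → ℂ} (hf : f ∈ harm n) :
    radialD s t f ∈ harm n := (isExpansion_radialD hn s t hf).harm

theorem summable_radialTerm (hn : 0 < n) (s t : ℝ) {f : E n → ℂ} (hf : f ∈ harm n) {x : E n}
    (hx : x ∈ B n) : Summable (radialTerm s t f x) :=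
  ((isExpansion_radialD hn s t hf).hasSum x hx).summable

theorem radialD_congr (s t : ℝ) {f g : E n → ℂ} (h : ∀ x ∈ B n, f x = g x) :
    radialD s t f = radialD s t g := mult_congr h _

theorem mult_eq_self (hn : 0 < n) {m : ℕ → ℝ} (hm : ∀ k, m k = 1) {f : E n → ℂ} (hf : f ∈ harm n)
    {x : E n} (hx : x ∈ B n) : mult m f x = f x := by
  rw [show m = fun _ => 1 from funext hm, mult_one hn hf hx]

theorem radialD_zero (hn : 0 < n) (s : ℝ) {f : E n → ℂ} (hf : f ∈ harm n) {x : E n}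
    (hx : x ∈ B n) : radialD s 0 f x = f x :=
  mult_eq_self hn (m := fun k => gammaCoeff n (s + 0) k / gammaCoeff n s k)
    (fun k => by rw [add_zero, div_self (gammaCoeff_pos hn s k).ne']) hf hx

theorem radialD_neg_radialD (hn : 0 < n) (s t : ℝ) {f : E n → ℂ} (hf : f ∈ harm n) {x : E n}
    (hx : x ∈ B n) : radialD (s + t) (-t) (radialD s t f) x = f x := by
  change mult _ (mult _ f) x = f x
  rw [mult_mult hn (subExp_radialCoeff hn s t) _ hf]
  refine mult_eq_self hn (fun k => ?_) hf hx
  have h1 := (gammaCoeff_pos hn s k).ne'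
  have h2 := (gammaCoeff_pos hn (s + t) k).ne'
  rw [add_neg_cancel_right]
  field_simp

theorem radialD_radialD_neg (hn : 0 < n) (s t : ℝ) {g : E n → ℂ} (hg : g ∈ harm n) {x : E n}
    (hx : x ∈ B n) : radialD s t (radialD (s + t) (-t) g) x = g x := by
  change mult _ (mult _ g) x = g x
  rw [mult_mult hn (subExp_radialCoeff hn (s + t) (-t)) _ hg]
  refine mult_eq_self hn (fun k => ?_) hg hx
  have h1 := (gammaCoeff_pos hn s k).ne'
  have h2 := (gammaCoeff_pos hn (s + t) k).ne'
  rw [add_neg_cancel_right]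
  field_simp

theorem IsExpansion.sub {f g : E n → ℂ} {p q : ℕ → E n → ℂ} (hf : IsExpansion f p)
    (hg : IsExpansion g q) : IsExpansion (f - g) fun k x => p k x - q k x := by
  refine ⟨fun k => (hf.mem k).sub (hg.mem k), fun r hr => ?_,
    fun x hx => (hf.hasSum x hx).sub (hg.hasSum x hx)⟩
  obtain ⟨C, hC⟩ := hf.bound r hr
  obtain ⟨D, hD⟩ := hg.bound r hr
  exact ⟨C + D, fun k x hx => (norm_sub_le _ _).trans (add_le_add (hC k x hx) (hD k x hx))⟩

theorem sub_mem_harm (hn : 0 < n) {f g : E n → ℂ} (hf : f ∈ harm n) (hg : g ∈ harm n) :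
    f - g ∈ harm n :=
  ((isExpansion_homPart hn hf).sub (isExpansion_homPart hn hg)).harm

theorem radialD_sub (hn : 0 < n) (s t : ℝ) {f g : E n → ℂ} (hf : f ∈ harm n) (hg : g ∈ harm n)
    {x : E n} (hx : x ∈ B n) : radialD s t (f - g) x = radialD s t f x - radialD s t g x := by
  have h := ((isExpansion_homPart hn hf).sub (isExpansion_homPart hn hg)).homPart
  rw [radialD, radialD, radialD,
    ← (summable_radialTerm hn s t hf hx).tsum_sub (summable_radialTerm hn s t hg hx)]
  simp only [radialTerm, h, mul_sub]

theorem growth_iff {A : ℝ} (hA : 0 < A) {u : E n → ℂ} :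
    Growth A u ↔ ∃ C : ℝ, ∀ x ∈ B n, (1 - ‖x‖ ^ 2) ^ A * ‖u x‖ ≤ C := by
  have hx1 : ∀ x ∈ B n, ‖x‖ < 1 := fun x hx => by simpa using hx
  constructor
  · rintro ⟨C, hC⟩
    refine ⟨2 ^ A * C, fun x hx => ?_⟩
    have h1 := hx1 x hx
    have h2 : (1 - ‖x‖ ^ 2) ^ A ≤ 2 ^ A * (1 - ‖x‖) ^ A := by
      rw [← Real.mul_rpow (by norm_num) (by linarith)]
      exact Real.rpow_le_rpow (one_sub_sq_pos hx).le (by nlinarith [norm_nonneg x]) hA.le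
    calc _ ≤ 2 ^ A * (1 - ‖x‖) ^ A * ‖u x‖ := by gcongr
      _ ≤ 2 ^ A * C := by rw [mul_assoc]; gcongr; exact hC x hx
  · rintro ⟨C, hC⟩
    refine ⟨C, fun x hx => le_trans ?_ (hC x hx)⟩
    have h1 := hx1 x hx
    gcongr
    · nlinarith [norm_nonneg x]

theorem rpow_mul_norm_radialI (s t α : ℝ) (f : E n → ℂ) {x : E n} (hx : x ∈ B n) :
    (1 - ‖x‖ ^ 2) ^ α * ‖radialI s t f x‖ = (1 - ‖x‖ ^ 2) ^ (α + t) * ‖radialD s t f x‖ := by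
  have h := one_sub_sq_pos hx
  rw [radialI, norm_mul, Complex.norm_real, Real.norm_of_nonneg (by positivity), Real.rpow_add h,
    mul_assoc]

/-- Membership in a Bloch space can be tested with any admissible pair `s, t`: the multiplier that
leads from `D^{t'}_{s'} f` to `D^t_s f` has order `t - t'`. -/
theorem mem_bloch_iff (hn : 0 < n) {α t : ℝ} (s : ℝ) (hα : 0 < α + t) {f : E n → ℂ} :
    f ∈ bloch n α ↔ f ∈ harm n ∧ Growth (α + t) (radialD s t f) := by
  constructor
  · rintro ⟨hf, s', t', hα', C, hC⟩
    refine ⟨hf, ?_⟩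
    have h1 : Growth (α + t') (radialD s' t' f) :=
      (growth_iff hα').2 ⟨C, fun x hx => by rw [← rpow_mul_norm_radialI s' t' α f hx]; exact hC x hx⟩
    have ho := (hasOrder_gammaCoeff_div hn s t).mul hn
      ((hasOrder_gammaCoeff hn s').mul hn (hasOrder_gammaCoeff_inv hn (s' + t')))
    have h2 := ho.growth hn hα' (by linarith) (radialD_mem_harm hn s' t' hf) h1
    rw [show α + t' + (t + (1 + s' + -(1 + (s' + t')))) = α + t by ring] at h2
    change Growth _ (mult _ (mult _ f)) at h2
    rw [mult_mult hn (subExp_radialCoeff hn s' t') _ hf] at h2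
    convert h2 using 1
    change mult _ f = _
    congr 1
    ext k
    have h3 := (gammaCoeff_pos hn s' k).ne'
    have h4 := (gammaCoeff_pos hn (s' + t') k).ne'
    field_simp
  · rintro ⟨hf, hg⟩
    obtain ⟨C, hC⟩ := (growth_iff hα).1 hg
    exact ⟨hf, s, t, hα, C, fun x hx => by rw [rpow_mul_norm_radialI s t α f hx]; exact hC x hx⟩

theorem Growth.congr {A : ℝ} {u v : E n → ℂ} (h : Growth A u) (huv : ∀ x ∈ B n, u x = v x) :
    Growth A v := by
  obtain ⟨C, hC⟩ := h
  exact ⟨C, fun x hx => huv x hx ▸ hC x hx⟩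

theorem bloch_congr {α : ℝ} {f g : E n → ℂ} (hf : f ∈ bloch n α) (h : ∀ x ∈ B n, f x = g x) :
    g ∈ bloch n α := by
  obtain ⟨hf, s, t, hα, C, hC⟩ := hf
  refine ⟨harm_congr hf h, s, t, hα, C, fun x hx => ?_⟩
  rw [radialI, ← radialD_congr s t h]
  exact hC x hx

/-- For a positive exponent, the Bloch space is a space of growth. -/
theorem mem_bloch_iff_growth (hn : 0 < n) {β : ℝ} (hβ : 0 < β) {g : E n → ℂ} :
    g ∈ bloch n β ↔ g ∈ harm n ∧ Growth β g := by
  rw [mem_bloch_iff hn (t := 0) 0 (by simpa)]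
  refine and_congr_right fun hg => ?_
  rw [add_zero]
  exact ⟨fun h => h.congr fun x hx => radialD_zero hn 0 hg hx,
    fun h => h.congr fun x hx => (radialD_zero hn 0 hg hx).symm⟩

theorem radialD_mem_bloch_iff (hn : 0 < n) {α t : ℝ} (s : ℝ) (hα : 0 < α + t) {f : E n → ℂ}
    (hf : f ∈ harm n) : radialD s t f ∈ bloch n (α + t) ↔ f ∈ bloch n α := by
  rw [mem_bloch_iff hn s hα, mem_bloch_iff_growth hn hα]
  simp only [hf, radialD_mem_harm hn s t hf, true_and]

theorem radialD_neg_mem_bloch (hn : 0 < n) {α t : ℝ} (s : ℝ) (hα : 0 < α + t) {g : E n → ℂ}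
    (hg : g ∈ bloch n (α + t)) : radialD (s + t) (-t) g ∈ bloch n α :=
  (radialD_mem_bloch_iff hn s hα (radialD_mem_harm hn (s + t) (-t) hg.1)).1
    (bloch_congr hg fun _ hx => (radialD_radialD_neg hn s t hg.1 hx).symm)

theorem blochNorm_congr (s t α : ℝ) {f g : E n → ℂ} (h : ∀ x ∈ B n, f x = g x) :
    blochNorm s t α f = blochNorm s t α g := by
  simp only [blochNorm, radialI, radialD_congr s t h]

/-- `D^t_s` is an isometry. -/
theorem blochNorm_radialD (hn : 0 < n) (s t α : ℝ) {f : E n → ℂ} (hf : f ∈ harm n) :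
    blochNorm (s + t) 0 (α + t) (radialD s t f) = blochNorm s t α f := by
  unfold blochNorm
  congr 1
  ext x
  rw [rpow_mul_norm_radialI _ _ _ _ x.2, rpow_mul_norm_radialI _ _ _ _ x.2,
    radialD_zero hn _ (radialD_mem_harm hn s t hf) x.2, add_zero]

/-! ### Operators intertwined by `D^t_s` -/

section Intertwining

variable {s t α₁ α₂ : ℝ} {T K : (E n → ℂ) → E n → ℂ}

/-- Up to the values outside the ball, `D^t_s` is a bijection from `b^∞_α` to `b^∞_{α+t}`, so an
operator `K` that only depends on the values on the ball has the mapping properties of `T` when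
`D^t_s T = K D^t_s`. -/
theorem mapsTo_iff_of_intertwining (hn : 0 < n) (h₁ : 0 < α₁ + t) (h₂ : 0 < α₂ + t)
    (hT : ∀ f ∈ bloch n α₁, T f ∈ harm n)
    (hD : ∀ f ∈ bloch n α₁, ∀ x ∈ B n, radialD s t (T f) x = K (radialD s t f) x)
    (hK : ∀ g h : E n → ℂ, (∀ x ∈ B n, g x = h x) → K g = K h) :
    (∀ f ∈ bloch n α₁, T f ∈ bloch n α₂) ↔ ∀ g ∈ bloch n (α₁ + t), K g ∈ bloch n (α₂ + t) := by
  constructor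
  · intro h g hg
    have hf := radialD_neg_mem_bloch hn s h₁ hg
    rw [hK g _ fun x hx => (radialD_radialD_neg hn s t hg.1 hx).symm]
    exact bloch_congr ((radialD_mem_bloch_iff hn s h₂ (hT _ hf)).2 (h _ hf)) (hD _ hf)
  · intro h f hf
    have hg := (radialD_mem_bloch_iff hn s h₁ hf.1).2 hf
    exact (radialD_mem_bloch_iff hn s h₂ (hT f hf)).1
      (bloch_congr (h _ hg) fun x hx => (hD f hf x hx).symm)

theorem boundedBetween_iff_of_intertwining (hn : 0 < n) (h₁ : 0 < α₁ + t) (h₂ : 0 < α₂ + t)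
    (hT : ∀ f ∈ bloch n α₁, T f ∈ harm n)
    (hD : ∀ f ∈ bloch n α₁, ∀ x ∈ B n, radialD s t (T f) x = K (radialD s t f) x)
    (hK : ∀ g h : E n → ℂ, (∀ x ∈ B n, g x = h x) → K g = K h) :
    BoundedBetween (bloch n α₁) (bloch n α₂) (blochNorm s t α₁) (blochNorm s t α₂) T ↔
      BoundedBetween (bloch n (α₁ + t)) (bloch n (α₂ + t)) (blochNorm (s + t) 0 (α₁ + t))
        (blochNorm (s + t) 0 (α₂ + t)) K := by
  have hmap := mapsTo_iff_of_intertwining hn h₁ h₂ hT hD hK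
  have hnorm : ∀ f ∈ bloch n α₁,
      blochNorm (s + t) 0 (α₂ + t) (K (radialD s t f)) = blochNorm s t α₂ (T f) := fun f hf => by
    rw [← blochNorm_radialD hn s t α₂ (hT f hf), blochNorm_congr _ _ _ (hD f hf)]
  constructor
  · rintro ⟨C, hC⟩
    refine ⟨C, fun g hg => ⟨hmap.1 (fun f hf => (hC f hf).1) g hg, ?_⟩⟩
    have hf := radialD_neg_mem_bloch hn s h₁ hg
    have hg' : ∀ x ∈ B n, g x = radialD s t (radialD (s + t) (-t) g) x := fun x hx =>
      (radialD_radialD_neg hn s t hg.1 hx).symm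
    rw [hK g _ hg', hnorm _ hf, blochNorm_congr _ _ _ hg', blochNorm_radialD hn s t α₁ hf.1]
    exact (hC _ hf).2
  · rintro ⟨C, hC⟩
    refine ⟨C, fun f hf => ⟨hmap.2 (fun g hg => (hC g hg).1) f hf, ?_⟩⟩
    rw [← hnorm f hf, ← blochNorm_radialD hn s t α₁ hf.1]
    exact (hC _ ((radialD_mem_bloch_iff hn s h₁ hf.1).2 hf)).2

theorem compactBetween_iff_of_intertwining (hn : 0 < n) (h₁ : 0 < α₁ + t) (h₂ : 0 < α₂ + t)
    (hT : ∀ f ∈ bloch n α₁, T f ∈ harm n)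
    (hD : ∀ f ∈ bloch n α₁, ∀ x ∈ B n, radialD s t (T f) x = K (radialD s t f) x)
    (hK : ∀ g h : E n → ℂ, (∀ x ∈ B n, g x = h x) → K g = K h) :
    CompactBetween (bloch n α₁) (bloch n α₂) (blochNorm s t α₁) (blochNorm s t α₂) T ↔
      CompactBetween (bloch n (α₁ + t)) (bloch n (α₂ + t)) (blochNorm (s + t) 0 (α₁ + t))
        (blochNorm (s + t) 0 (α₂ + t)) K := by
  have hmap := mapsTo_iff_of_intertwining hn h₁ h₂ hT hD hK
  have hnorm : ∀ f ∈ bloch n α₁, ∀ g ∈ harm n,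
      blochNorm (s + t) 0 (α₂ + t) (K (radialD s t f) - radialD s t g) =
        blochNorm s t α₂ (T f - g) := fun f hf g hg => by
    rw [← blochNorm_radialD hn s t α₂ (sub_mem_harm hn (hT f hf) hg)]
    refine blochNorm_congr _ _ _ fun x hx => ?_
    rw [radialD_sub hn s t (hT f hf) hg hx, hD f hf x hx, Pi.sub_apply]
  constructor
  · rintro ⟨hm, hc⟩
    refine ⟨hmap.1 hm, fun v hv => ?_⟩
    have hu : ∀ j, radialD (s + t) (-t) (v j) ∈ bloch n α₁ := fun j =>
      radialD_neg_mem_bloch hn s h₁ (hv j).1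
    have hvu : ∀ j, ∀ x ∈ B n, v j x = radialD s t (radialD (s + t) (-t) (v j)) x :=
      fun j x hx => (radialD_radialD_neg hn s t (hv j).1.1 hx).symm
    obtain ⟨g, hg, φ, hφ, hlim⟩ := hc (fun j => radialD (s + t) (-t) (v j)) fun j => ⟨hu j, by
      rw [← blochNorm_radialD hn s t α₁ (hu j).1, ← blochNorm_congr _ _ _ (hvu j)]
      exact (hv j).2⟩
    refine ⟨radialD s t g, (radialD_mem_bloch_iff hn s h₂ hg.1).2 hg, φ, hφ, hlim.congr fun j => ?_⟩
    rw [hK _ _ (hvu (φ j)), hnorm _ (hu _) g hg.1]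
  · rintro ⟨hm, hc⟩
    refine ⟨hmap.2 hm, fun u hu => ?_⟩
    obtain ⟨g, hg, φ, hφ, hlim⟩ := hc (fun j => radialD s t (u j)) fun j =>
      ⟨(radialD_mem_bloch_iff hn s h₁ (hu j).1.1).2 (hu j).1, by
        rw [blochNorm_radialD hn s t α₁ (hu j).1.1]; exact (hu j).2⟩
    have hf := radialD_neg_mem_bloch hn s h₂ hg
    refine ⟨_, hf, φ, hφ, hlim.congr fun j => ?_⟩
    rw [← hnorm _ (hu _).1 _ hf.1]
    refine blochNorm_congr _ _ _ fun x hx => ?_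
    rw [Pi.sub_apply, Pi.sub_apply, radialD_radialD_neg hn s t hg.1 hx]

end Intertwining

/-! ### Toeplitz operators -/

/-- The density `(1 - |y|²)^β g(y)` on the ball. -/
def weightedDensity (β : ℝ) (g : E n → ℂ) (y : E n) : ℂ := (((1 - ‖y‖ ^ 2) ^ β : ℝ) : ℂ) * g y

theorem weighted_restrict (β : ℝ) (μ : Measure (E n)) :
    (weighted β μ).restrict (B n) = weighted β μ := by
  rw [weighted, restrict_withDensity measurableSet_ball, Measure.restrict_restrict measurableSet_ball,
    Set.inter_self]

theorem measurable_weight (β : ℝ) :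
    Measurable fun y : E n => ENNReal.ofReal ((1 - ‖y‖ ^ 2) ^ β) := by fun_prop

theorem toReal_weight_smul (β : ℝ) (μ : Measure (E n)) (φ : E n → ℂ) :
    (fun y => (ENNReal.ofReal ((1 - ‖y‖ ^ 2) ^ β)).toReal • φ y) =ᵐ[μ.restrict (B n)]
      weightedDensity β φ := by
  filter_upwards [ae_restrict_mem measurableSet_ball] with y hy
  rw [ENNReal.toReal_ofReal (Real.rpow_nonneg (one_sub_sq_pos hy).le _), weightedDensity,
    Complex.real_smul]

theorem setIntegral_weighted (β : ℝ) (μ : Measure (E n)) (φ : E n → ℂ) :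
    ∫ y in B n, φ y ∂weighted β μ = ∫ y in B n, weightedDensity β φ y ∂μ := by
  rw [weighted_restrict, weighted, integral_withDensity_eq_integral_toReal_smul
    (measurable_weight β) (Eventually.of_forall fun _ => ENNReal.ofReal_lt_top)]
  exact integral_congr_ae (toReal_weight_smul β μ φ)

theorem integrableOn_weighted_iff (β : ℝ) (μ : Measure (E n)) (φ : E n → ℂ) :
    IntegrableOn φ (B n) (weighted β μ) ↔ IntegrableOn (weightedDensity β φ) (B n) μ := by
  rw [IntegrableOn, weighted_restrict, weighted, integrable_withDensity_iff_integrable_smul'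
    (measurable_weight β) (Eventually.of_forall fun _ => ENNReal.ofReal_lt_top)]
  exact integrable_congr (toReal_weight_smul β μ φ)

theorem toeplitz_integrand_eq (s t : ℝ) (f : E n → ℂ) (x : E n) {y : E n} (hy : y ∈ B n) :
    (kernel s x y : ℂ) * radialI s t f y * (((1 - ‖y‖ ^ 2) ^ s : ℝ) : ℂ) =
      (kernel s x y : ℂ) * weightedDensity (s + t) (radialD s t f) y := by
  rw [weightedDensity, radialI, Real.rpow_add (one_sub_sq_pos hy), Complex.ofReal_mul]
  ring

theorem toeplitz_eq (s t : ℝ) (μ : Measure (E n)) (f : E n → ℂ) (x : E n) :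
    toeplitz s t μ f x = ((V n s)⁻¹ : ℝ) *
      ∫ y in B n, (kernel s x y : ℂ) * weightedDensity (s + t) (radialD s t f) y ∂μ := by
  rw [toeplitz]
  congr 1
  exact setIntegral_congr_fun measurableSet_ball fun y hy => toeplitz_integrand_eq s t f x hy

theorem weightedDensity_kernel_mul (s t : ℝ) (g : E n → ℂ) (x : E n) :
    weightedDensity (s + t) (fun y => (kernel (s + t) x y : ℂ) * g y) =
      fun y => (kernel (s + t) x y : ℂ) * weightedDensity (s + t) g y := by
  ext y
  simp only [weightedDensity]
  ring

theorem classicalToeplitz_eq (s t : ℝ) (μ : Measure (E n)) (g : E n → ℂ) (x : E n) :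
    classicalToeplitz s t (weighted (s + t) μ) g x = ((V n s)⁻¹ : ℝ) *
      ∫ y in B n, (kernel (s + t) x y : ℂ) * weightedDensity (s + t) g y ∂μ := by
  rw [classicalToeplitz, setIntegral_weighted, weightedDensity_kernel_mul]

theorem classicalToeplitz_congr (s t : ℝ) (κ : Measure (E n)) {g h : E n → ℂ}
    (hgh : ∀ x ∈ B n, g x = h x) : classicalToeplitz s t κ g = classicalToeplitz s t κ h := by
  ext x
  rw [classicalToeplitz, classicalToeplitz]
  congr 1
  exact setIntegral_congr_fun measurableSet_ball fun y hy => by simp only [hgh y hy]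

theorem continuousOn_of_mem_harm {f : E n → ℂ} (hf : f ∈ harm n) : ContinuousOn f (B n) :=
  fun x hx => (hf x hx).1.continuousAt.continuousWithinAt

/-- The bound `(1 - |y|²)^(α+t) |g| ≤ C` makes `(1 - |y|²)^(s+t) g` integrable as soon as
`(1 - |y|²)^(s-α)` is. -/
theorem integrableOn_weightedDensity (hn : 0 < n) {s t α : ℝ} (hα : 0 < α + t)
    {μ : Measure (E n)}
    (hμ : ∫⁻ y in B n, ENNReal.ofReal ((1 - ‖y‖ ^ 2) ^ (s - α)) ∂μ < ⊤)
    {g : E n → ℂ} (hg : g ∈ bloch n (α + t)) :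
    IntegrableOn (weightedDensity (s + t) g) (B n) μ := by
  obtain ⟨hh, hgr⟩ := (mem_bloch_iff_growth hn hα).1 hg
  obtain ⟨C, hC⟩ := (growth_iff hα).1 hgr
  have hw : IntegrableOn (fun y : E n => (1 - ‖y‖ ^ 2) ^ (s - α)) (B n) μ := by
    refine ⟨(by fun_prop : Measurable _).aestronglyMeasurable, ?_⟩
    rw [hasFiniteIntegral_iff_ofReal]
    · exact hμ
    · filter_upwards [ae_restrict_mem measurableSet_ball] with y hy
      exact Real.rpow_nonneg (one_sub_sq_pos hy).le _
  refine Integrable.mono' (hw.mul_const C) ?_ ?_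
  · refine AEStronglyMeasurable.mul ?_
      ((continuousOn_of_mem_harm hh).aestronglyMeasurable measurableSet_ball)
    exact (by fun_prop : Measurable _).aestronglyMeasurable
  · filter_upwards [ae_restrict_mem measurableSet_ball] with y hy
    have hp := one_sub_sq_pos hy
    rw [weightedDensity, norm_mul, Complex.norm_real, Real.norm_of_nonneg (by positivity),
      show s + t = s - α + (α + t) by ring, Real.rpow_add hp, mul_assoc]
    exact mul_le_mul_of_nonneg_left (hC y hy) (by positivity)

theorem IsExpansion.const_mul {f : E n → ℂ} {p : ℕ → E n → ℂ} (h : IsExpansion f p) (c : ℂ) :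
    IsExpansion (fun x => c * f x) fun k x => c * p k x := by
  refine ⟨fun k => (h.mem k).const_mul c, fun r hr => ?_, fun x hx => (h.hasSum x hx).mul_left c⟩
  obtain ⟨C, hC⟩ := h.bound r hr
  refine ⟨‖c‖ * C, fun k x hx => ?_⟩
  rw [norm_mul]
  exact mul_le_mul_of_nonneg_left (hC k x hx) (norm_nonneg _)

theorem isExpansion_toeplitz (hn : 0 < n) {s t : ℝ} {μ : Measure (E n)} {f : E n → ℂ}
    (hF : IntegrableOn (weightedDensity (s + t) (radialD s t f)) (B n) μ) :
    IsExpansion (toeplitz s t μ f) fun k x => ((V n s)⁻¹ : ℝ) *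
      ((gammaCoeff n s k : ℂ) * zonalIntegral μ (weightedDensity (s + t) (radialD s t f)) k x) :=
  ((isExpansion_integral_kernel hn hF s).const_mul _).congr fun x _ => (toeplitz_eq s t μ f x).symm

theorem isExpansion_classicalToeplitz (hn : 0 < n) {s t : ℝ} {μ : Measure (E n)} {g : E n → ℂ}
    (hF : IntegrableOn (weightedDensity (s + t) g) (B n) μ) :
    IsExpansion (classicalToeplitz s t (weighted (s + t) μ) g) fun k x => ((V n s)⁻¹ : ℝ) *
      ((gammaCoeff n (s + t) k : ℂ) * zonalIntegral μ (weightedDensity (s + t) g) k x) :=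
  ((isExpansion_integral_kernel hn hF (s + t)).const_mul _).congr fun x _ =>
    (classicalToeplitz_eq s t μ g x).symm

/-- The intertwining relation: `D^t_s` replaces the coefficients `γ_k(s)` of the kernel of `T_μ`
by `γ_k(s + t)`. -/
theorem radialD_toeplitz (hn : 0 < n) {s t : ℝ} {μ : Measure (E n)} {f : E n → ℂ}
    (hF : IntegrableOn (weightedDensity (s + t) (radialD s t f)) (B n) μ) {x : E n} (hx : x ∈ B n) :
    radialD s t (toeplitz s t μ f) x =
      classicalToeplitz s t (weighted (s + t) μ) (radialD s t f) x := by
  rw [radialD, ← ((isExpansion_classicalToeplitz hn hF).hasSum x hx).tsum_eq]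
  refine tsum_congr fun k => ?_
  rw [radialTerm, (isExpansion_toeplitz hn hF).homPart]
  have h : (gammaCoeff n s k : ℂ) ≠ 0 := by exact_mod_cast (gammaCoeff_pos hn s k).ne'
  push_cast
  field_simp

end

end HarmonicBloch

theorem theorem4p1 (n : ℕ) (hn : 2 ≤ n) (s t α₁ α₂ : ℝ)
    (ht₁ : 0 < α₁ + t) (ht₂ : 0 < α₂ + t) (hs₁ : α₁ - 1 < s) (hs₂ : α₂ - 1 < s)
    (μ : Measure (E n))
    (hμ : ∫⁻ y in B n, ENNReal.ofReal ((1 - ‖y‖ ^ 2) ^ (s - α₁)) ∂μ < ⊤) :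
    -- the series that define the two kernels converge
    (∀ x ∈ B n, ∀ y ∈ B n,
      Summable (fun k => gammaCoeff n s k * zonal k x y) ∧
      Summable (fun k => gammaCoeff n (s + t) k * zonal k x y)) ∧
    -- the operators in the first two identities are well defined
    (∀ f ∈ bloch n α₁,
      radialD s t f ∈ bloch n (α₁ + t) ∧
      toeplitz s t μ f ∈ harm n ∧
      classicalToeplitz s t (weighted (s + t) μ) (radialD s t f) ∈ harm n ∧
      ∀ x ∈ B n,
        IntegrableOn (fun y => (kernel s x y : ℂ) * radialI s t f y *
          (((1 - ‖y‖ ^ 2) ^ s : ℝ) : ℂ)) (B n) μ ∧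
        IntegrableOn (fun y => (kernel (s + t) x y : ℂ) * radialD s t f y) (B n)
          (weighted (s + t) μ) ∧
        Summable (radialTerm s t f x) ∧
        Summable (radialTerm s t (toeplitz s t μ f) x) ∧
        Summable (radialTerm (s + t) (-t)
          (classicalToeplitz s t (weighted (s + t) μ) (radialD s t f)) x)) ∧
    -- the operators in the third identity are well defined
    (∀ g ∈ bloch n (α₁ + t),
      radialD (s + t) (-t) g ∈ bloch n α₁ ∧
      classicalToeplitz s t (weighted (s + t) μ) g ∈ harm n ∧
      ∀ x ∈ B n,
        IntegrableOn (fun y => (kernel (s + t) x y : ℂ) * g y) (B n) (weighted (s + t) μ) ∧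
        Summable (radialTerm (s + t) (-t) g x)) ∧
    -- `D^t_s T_μ = T_κ D^t_s`
    (∀ f ∈ bloch n α₁, ∀ x ∈ B n,
      radialD s t (toeplitz s t μ f) x =
        classicalToeplitz s t (weighted (s + t) μ) (radialD s t f) x) ∧
    -- `T_μ = D^{-t}_{s+t} T_κ D^t_s`
    (∀ f ∈ bloch n α₁, ∀ x ∈ B n,
      toeplitz s t μ f x =
        radialD (s + t) (-t)
          (classicalToeplitz s t (weighted (s + t) μ) (radialD s t f)) x) ∧
    -- `T_κ = D^t_s T_μ D^{-t}_{s+t}`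
    (∀ g ∈ bloch n (α₁ + t), ∀ x ∈ B n,
      classicalToeplitz s t (weighted (s + t) μ) g x =
        radialD s t (toeplitz s t μ (radialD (s + t) (-t) g)) x) ∧
    -- mapping, boundedness and compactness questions for `T_μ` are those for `T_κ`
    ((∀ f ∈ bloch n α₁, toeplitz s t μ f ∈ bloch n α₂) ↔
      ∀ g ∈ bloch n (α₁ + t),
        classicalToeplitz s t (weighted (s + t) μ) g ∈ bloch n (α₂ + t)) ∧
    (BoundedBetween (bloch n α₁) (bloch n α₂) (blochNorm s t α₁) (blochNorm s t α₂)
        (toeplitz s t μ) ↔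
      BoundedBetween (bloch n (α₁ + t)) (bloch n (α₂ + t))
        (blochNorm (s + t) 0 (α₁ + t)) (blochNorm (s + t) 0 (α₂ + t))
        (classicalToeplitz s t (weighted (s + t) μ))) ∧
    (CompactBetween (bloch n α₁) (bloch n α₂) (blochNorm s t α₁) (blochNorm s t α₂)
        (toeplitz s t μ) ↔
      CompactBetween (bloch n (α₁ + t)) (bloch n (α₂ + t))
        (blochNorm (s + t) 0 (α₁ + t)) (blochNorm (s + t) 0 (α₂ + t))
        (classicalToeplitz s t (weighted (s + t) μ))) := by
  have hn0 : 0 < n := by omega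
  have hint : ∀ g ∈ bloch n (α₁ + t), IntegrableOn (weightedDensity (s + t) g) (B n) μ :=
    fun g hg => integrableOn_weightedDensity hn0 ht₁ hμ hg
  have hmem : ∀ f ∈ bloch n α₁, radialD s t f ∈ bloch n (α₁ + t) := fun f hf =>
    (radialD_mem_bloch_iff hn0 s ht₁ hf.1).2 hf
  have hTh : ∀ f ∈ bloch n α₁, toeplitz s t μ f ∈ harm n := fun f hf =>
    (isExpansion_toeplitz hn0 (hint _ (hmem f hf))).harm
  have hKh : ∀ g ∈ bloch n (α₁ + t), classicalToeplitz s t (weighted (s + t) μ) g ∈ harm n :=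
    fun g hg => (isExpansion_classicalToeplitz hn0 (hint g hg)).harm
  have hKint : ∀ g ∈ bloch n (α₁ + t), ∀ x ∈ B n,
      IntegrableOn (fun y => (kernel (s + t) x y : ℂ) * g y) (B n) (weighted (s + t) μ) := by
    intro g hg x hx
    rw [integrableOn_weighted_iff, weightedDensity_kernel_mul]
    exact integrableOn_kernel_mul hn0 (hint g hg) (s + t) hx
  have hD : ∀ f ∈ bloch n α₁, ∀ x ∈ B n, radialD s t (toeplitz s t μ f) x =
      classicalToeplitz s t (weighted (s + t) μ) (radialD s t f) x := fun f hf x hx =>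
    radialD_toeplitz hn0 (hint _ (hmem f hf)) hx
  have hK : ∀ g h : E n → ℂ, (∀ x ∈ B n, g x = h x) →
      classicalToeplitz s t (weighted (s + t) μ) g = classicalToeplitz s t (weighted (s + t) μ) h :=
    fun g h hgh => classicalToeplitz_congr s t _ hgh
  refine ⟨fun x hx y hy => ⟨summable_kernel hn0 s hx hy, summable_kernel hn0 (s + t) hx hy⟩,
    fun f hf => ⟨hmem f hf, hTh f hf, hKh _ (hmem f hf), fun x hx => ⟨?_, hKint _ (hmem f hf) x hx,
      summable_radialTerm hn0 s t hf.1 hx, summable_radialTerm hn0 s t (hTh f hf) hx,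
      summable_radialTerm hn0 (s + t) (-t) (hKh _ (hmem f hf)) hx⟩⟩,
    fun g hg => ⟨radialD_neg_mem_bloch hn0 s ht₁ hg, hKh g hg, fun x hx => ⟨hKint g hg x hx,
      summable_radialTerm hn0 (s + t) (-t) hg.1 hx⟩⟩,
    hD, fun f hf x hx => ?_, fun g hg x hx => ?_,
    mapsTo_iff_of_intertwining hn0 ht₁ ht₂ hTh hD hK,
    boundedBetween_iff_of_intertwining hn0 ht₁ ht₂ hTh hD hK,
    compactBetween_iff_of_intertwining hn0 ht₁ ht₂ hTh hD hK⟩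
  · exact (integrableOn_kernel_mul hn0 (hint _ (hmem f hf)) s hx).congr_fun
      (fun y hy => (toeplitz_integrand_eq s t f x hy).symm) measurableSet_ball
  · rw [← radialD_congr (s + t) (-t) (hD f hf), radialD_neg_radialD hn0 s t (hTh f hf) hx]
  · rw [hD _ (radialD_neg_mem_bloch hn0 s ht₁ hg) x hx]
    exact congrFun (hK _ _ fun y hy => (radialD_radialD_neg hn0 s t hg.1 hy).symm) x
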